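/- Consider the two-component Pavlov–Mikhalev system $\mathcal E$ $$u_{yy}=u_{xt}-u_xu_{xy}+u_yu_{xx},\qquad v_{yy}=v_{xt}-u_xv_{xy}-2v_yu_{xx}+2v_xu_{xy}+u_yv_{xx},$$ and its tangent equation $\mathcal{TE}$, obtained by adding, for odd unknowns $p,q$, the linearized equations $$p_{yy}=u_yp_{xx}-u_{xy}p_x-u_xp_{xy}+u_{xx}p_y+p_{xt},$$ $$q_{yy}=2v_xp_{xy}+v_{xx}p_y-v_{xy}p_x-2v_yp_{xx}+2u_{xy}q_x+u_yq_{xx}-u_xq_{xy}-2u_{xx}q_y+q_{xt}.$$ Let $\tau\colon W\to\mathcal{TE}$ be the covering with odd nonlocal variables $w_i,w_{i,t},w_{i,tt},\dots$, $i=1,\dots,4$, defined by $w_{i,x}=X_i$, $w_{i,y}=Y_i$, where $$X_1=2u_xp_x+p_y,\quad Y_1=u_yp_x+u_xp_y+p_t,$$ $$X_2=q_y-v_xp_x-u_xq_x,\quad Y_2=q_t-2v_yp_x+v_xp_y+u_yq_x-2u_xq_y,$$ $$X_3=\left(\tfrac32u_x^2-yu_{xt}\right)p_x+\left(yu_{xx}+\tfrac12\right)p_t-u_{xy}p+u_xp_y-\tfrac12yp_{yt},$$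 $$Y_3=(u_xu_{xy}-u_yu_{xx}-u_{xt})p+\left(u_xu_y-\tfrac12yu_{yt}\right)p_x+\tfrac12(u_x^2-yu_{xt})p_y+(yu_{xy}+u_x)p_t-\tfrac12y(u_yp_{xt}-u_xp_{yt}+p_{tt}),$$ $$X_4=y(v_{xx}p_t-v_{xt}p_x+u_{xx}q_t-u_{xt}q_x+q_{yt})-v_{xy}p+v_xp_y-u_{xy}q+u_xq_y-q_t,$$ $$\begin{aligned}Y_4={}&(u_xv_{xy}+2v_yu_{xx}-2v_xu_{xy}-u_yv_{xx}-v_{xt})p+(u_yv_x-2u_xv_y-2yv_{yt})p_x+(u_xv_x+yv_{xt})p_y+(yv_{xy}+v_x)p_t\\&+(u_xu_{xy}-u_yu_{xx}-u_{xt})q+(u_xu_y+yu_{yt})q_x-(u_x^2+2yu_{xt})q_y+(yu_{xy}+u_x)q_t\\&+y(2v_xp_{yt}-2v_yp_{xt}+u_yq_{xt}-u_xq_{yt}+q_{tt}).\end{aligned}$$ Functions on $W$ are polynomials in the odd (anticommuting) coordinates whose coefficients are smooth functions of finitely many of the even internal coordinates; they are graded by the degree in the odd coordinates. $D_x,D_y,D_t$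 denote the total derivatives on $W$, and $d_{\mathcal C}$ the odd vector field on $W$ given by the Cartan differential: $d_{\mathcal C}u_\sigma=p_\sigma$, $d_{\mathcal C}v_\sigma=q_\sigma$, $d_{\mathcal C}p_\sigma=d_{\mathcal C}q_\sigma=0$, $d_{\mathcal C}w_1=d_{\mathcal C}w_2=0$, $d_{\mathcal C}w_3=yp_xp_t+pp_y$, $d_{\mathcal C}w_4=y(p_xq_t-p_tq_x)+pq_y-p_yq$, and $d_{\mathcal C}\partial_t^l w_i=D_t^l(d_{\mathcal C}w_i)$. Consider $$\Phi_1=\bigl(u_xp-w_1,\ v_xp-2u_xq-w_2\bigr),$$ $$\Phi_2=\bigl(u_yp-2yu_xp_t-u_xw_1+yw_{1,t}+2w_3,\ -2v_yp+yv_xp_t+(3u_x^2+u_y)q+yu_xq_t-v_xw_1+2u_xw_2+yw_{2,t}-w_4\bigr).$$ For functions $\varphi=(\varphi^u,\varphi^v,\varphi^p,\varphi^q,\varphi^{w_1},\dots,\varphi^{w_4})$ on $W$ let $\mathbf{E}_\varphi$ be the evolutionary vector field on $W$ that annihilates $x,y,t$, takes $u_\sigma,v_\sigma,p_\sigma,q_\sigma$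 to $D_\sigma\varphi^u,D_\sigma\varphi^v,D_\sigma\varphi^p,D_\sigma\varphi^q$ and takes $\partial_t^lw_i$ to $D_t^l\varphi^{w_i}$. Call $\varphi$ an odd nonlocal symmetry if $\varphi^u,\varphi^v$ have degree $1$ and the other components degree $2$ in the odd coordinates and $\mathbf{E}_\varphi$ commutes with $D_x,D_y,D_t$; its bracket with another one, $\psi$, is the generating section $[\![\varphi,\psi]\!]$ whose components are the values of $\mathbf{E}_\varphi\mathbf{E}_\psi+\mathbf{E}_\psi\mathbf{E}_\varphi$ on $u,v,p,q,w_1,\dots,w_4$. An odd nonlocal symmetry $\varphi$ is a lift of a pair $\Phi=(\Phi^u,\Phi^v)$ if $\varphi^u=\Phi^u$, $\varphi^v=\Phi^v$, $\varphi^p=-d_{\mathcal C}\Phi^u$, $\varphi^q=-d_{\mathcal C}\Phi^v$. **Proposition.** $\Phi_1$ and $\Phi_2$ are shadows, i.e. they are linear in the odd variables and satisfy the linearization of $\mathcal E$ lifted to $W$; so they define recursion operators $\mathcal R_1$, $\mathcal R_2$. Both shadows lift to $W$. The operators $\mathcal R_1$ and $\mathcal R_2$ are hereditary and compatible: for all lifts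 $\varphi_1$ of $\Phi_1$ and $\varphi_2$ of $\Phi_2$, the Frölicher–Nijenhuis brackets vanish, $$[\![\varphi_1,\varphi_1]\!]=[\![\varphi_2,\varphi_2]\!]=[\![\varphi_1,\varphi_2]\!]=0 .$$ Here the brackets are the super-commutators of odd nonlocal symmetries: for any two odd nonlocal symmetries $\varphi,\psi$ one has $\mathbf{E}_\varphi\mathbf{E}_\psi+\mathbf{E}_\psi\mathbf{E}_\varphi=\mathbf{E}_{[\![\varphi,\psi]\!]}$. -/

import Mathlib

open scoped TensorProduct ContDiff

noncomputable section

namespace PavlovMikhalev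

/-- Even coordinates on the infinitely prolonged equation
`u_yy = u_xt - u_x u_xy + u_y u_xx`,
`v_yy = v_xt - u_x v_xy - 2 v_y u_xx + 2 v_x u_xy + u_y v_xx`:
the independent variables and the internal coordinates
`u k l = ∂_x^k ∂_t^l u`, `uy k l = ∂_y ∂_x^k ∂_t^l u`, and likewise for `v`. -/
inductive EvenCoord : Type
  | x : EvenCoord
  | y : EvenCoord
  | t : EvenCoord
  | u (k l : ℕ) : EvenCoord
  | uy (k l : ℕ) : EvenCoord
  | v (k l : ℕ) : EvenCoord
  | vy (k l : ℕ) : EvenCoord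
  deriving DecidableEq

/-- Odd coordinates: the fibre coordinates `p`, `q` of the tangent equation (indexed as for
`u`, `v`), and the nonlocal variables `w_i` together with all their `t`-derivatives:
`wi l = ∂_t^l w_i`. -/
inductive OddCoord : Type
  | p (k l : ℕ) : OddCoord
  | py (k l : ℕ) : OddCoord
  | q (k l : ℕ) : OddCoord
  | qy (k l : ℕ) : OddCoord
  | w1 (l : ℕ) : OddCoord
  | w2 (l : ℕ) : OddCoord
  | w3 (l : ℕ) : OddCoord
  | w4 (l : ℕ) : OddCoord

/-- All coordinates on the total space `W` of the covering. -/
abbrev Coord : Type := EvenCoord ⊕ OddCoord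

/-! ### Smooth functions of finitely many even coordinates -/

/-- The real-valued functions on the space of even coordinates that depend on finitely many of
the coordinates, and smoothly so. -/
def SmoothFn : Subalgebra ℝ ((EvenCoord → ℝ) → ℝ) where
  carrier := {f | ∃ (s : Finset EvenCoord) (g : (s → ℝ) → ℝ),
    ContDiff ℝ ∞ g ∧ ∀ z : EvenCoord → ℝ, f z = g (fun c => z c)}
  mul_mem' := by
    rintro a b ⟨s, g, hg, ha⟩ ⟨s', g', hg', hb⟩
    refine ⟨s ∪ s', fun z => g (fun c => z ⟨c, Finset.mem_union_left _ c.2⟩) *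
      g' (fun c => z ⟨c, Finset.mem_union_right _ c.2⟩), ?_, ?_⟩
    · exact (hg.comp (contDiff_pi.2 fun c => contDiff_apply ℝ ℝ _)).mul
        (hg'.comp (contDiff_pi.2 fun c => contDiff_apply ℝ ℝ _))
    · intro z
      simp [ha z, hb z]
  add_mem' := by
    rintro a b ⟨s, g, hg, ha⟩ ⟨s', g', hg', hb⟩
    refine ⟨s ∪ s', fun z => g (fun c => z ⟨c, Finset.mem_union_left _ c.2⟩) +
      g' (fun c => z ⟨c, Finset.mem_union_right _ c.2⟩), ?_, ?_⟩
    · exact (hg.comp (contDiff_pi.2 fun c => contDiff_apply ℝ ℝ _)).add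
        (hg'.comp (contDiff_pi.2 fun c => contDiff_apply ℝ ℝ _))
    · intro z
      simp [ha z, hb z]
  algebraMap_mem' := by
    intro r
    exact ⟨∅, fun _ => r, contDiff_const, fun z => rfl⟩

/-- A coordinate, as a smooth function. -/
def coordFn (c : EvenCoord) : SmoothFn :=
  ⟨fun z => z c, {c}, fun z => z ⟨c, Finset.mem_singleton_self c⟩, contDiff_apply ℝ ℝ _,
    fun _ => rfl⟩

/-- The partial derivative `∂f/∂c` at the point `z`. -/
def pderivAt (c : EvenCoord) (f : (EvenCoord → ℝ) → ℝ) (z : EvenCoord → ℝ) : ℝ :=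
  deriv (fun r : ℝ => f (Function.update z c r)) (z c)

theorem hasDerivAt_of_mem {f : (EvenCoord → ℝ) → ℝ} {s : Finset EvenCoord}
    {g : (s → ℝ) → ℝ} (hg : ContDiff ℝ ∞ g)
    (hf : ∀ z : EvenCoord → ℝ, f z = g (fun c => z c)) (c : EvenCoord) (z : EvenCoord → ℝ) :
    HasDerivAt (fun r : ℝ => f (Function.update z c r))
      (fderiv ℝ g (fun d => z d) (fun d : s => if (d : EvenCoord) = c then 1 else 0)) (z c) := by
  have h1 : HasDerivAt (fun r : ℝ => fun d : s => Function.update z c r d)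
      (fun d : s => if (d : EvenCoord) = c then (1 : ℝ) else 0) (z c) := by
    rw [hasDerivAt_pi]
    intro d
    by_cases h : (d : EvenCoord) = c
    · simpa [h, Function.update_apply] using hasDerivAt_id' (z c)
    · simpa [h, Function.update_apply] using hasDerivAt_const (z c) (z d)
  have h2 : HasFDerivAt g (fderiv ℝ g (fun d => z d))
      ((fun r : ℝ => fun d : s => Function.update z c r d) (z c)) := by
    have h3 : (fun d : s => Function.update z c (z c) d) = fun d : s => z d := by
      simp
    simp only [h3]
    exact (hg.differentiable (by simp)).differentiableAt.hasFDerivAt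
  have h4 := h2.comp_hasDerivAt (z c) h1
  refine h4.congr_of_eventuallyEq (Filter.Eventually.of_forall fun r => ?_)
  simp [hf]

theorem pderivAt_mem (c : EvenCoord) (f : SmoothFn) : pderivAt c f ∈ SmoothFn := by
  obtain ⟨f, s, g, hg, hf⟩ := f
  refine ⟨s, fun z => fderiv ℝ g z (fun d : s => if (d : EvenCoord) = c then 1 else 0), ?_, ?_⟩
  · exact (hg.fderiv_right (m := ∞) (by simp)).clm_apply contDiff_const
  · intro z
    exact (hasDerivAt_of_mem hg hf c z).deriv

theorem differentiableAt_slice (c : EvenCoord) (f : SmoothFn) (z : EvenCoord → ℝ) :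
    DifferentiableAt ℝ (fun r : ℝ => (f : (EvenCoord → ℝ) → ℝ) (Function.update z c r)) (z c) := by
  obtain ⟨f, s, g, hg, hf⟩ := f
  exact (hasDerivAt_of_mem hg hf c z).differentiableAt

/-- The partial derivative `∂/∂c` on smooth functions. -/
def pderiv (c : EvenCoord) : SmoothFn →ₗ[ℝ] SmoothFn where
  toFun f := ⟨pderivAt c f, pderivAt_mem c f⟩
  map_add' f g := by
    ext z
    exact deriv_fun_add (differentiableAt_slice c f z) (differentiableAt_slice c g z)
  map_smul' r f := by
    ext z
    exact deriv_const_mul r (differentiableAt_slice c f z)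

theorem finite_pderiv_ne_zero (f : SmoothFn) : {c | pderiv c f ≠ 0}.Finite := by
  obtain ⟨f, s, g, hg, hf⟩ := f
  refine s.finite_toSet.subset fun c hc => ?_
  by_contra hcs
  refine hc ?_
  ext z
  change deriv (fun r : ℝ => f (Function.update z c r)) (z c) = 0
  rw [(hasDerivAt_of_mem hg hf c z).deriv]
  have h0 : (fun d : s => if (d : EvenCoord) = c then (1 : ℝ) else 0) = 0 := by
    funext d
    have hd : (d : EvenCoord) ≠ c := fun h => hcs (by simp [← h])
    simp [hd]
  rw [h0, map_zero]

/-! ### The superalgebra of functions on `W` -/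

/-- The real exterior algebra generated by the odd coordinates. -/
abbrev OddAlg : Type := ExteriorAlgebra ℝ (OddCoord →₀ ℝ)

/-- The superalgebra of functions on `W`: polynomials in the anticommuting odd coordinates
with coefficients the smooth functions of the even coordinates. -/
abbrev SuperFn : Type := SmoothFn ⊗[ℝ] OddAlg

/-- An even coordinate as an element of the superalgebra. -/
def evenGen (c : EvenCoord) : SuperFn := coordFn c ⊗ₜ[ℝ] 1

/-- An odd coordinate as an element of the superalgebra. -/
def oddGen (c : OddCoord) : SuperFn := 1 ⊗ₜ[ℝ] ExteriorAlgebra.ι ℝ (Finsupp.single c 1)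

/-- The functions that are homogeneous of degree `n` in the odd coordinates. -/
def homogeneous (n : ℕ) : Submodule ℝ SuperFn :=
  Submodule.span ℝ {F | ∃ f : SmoothFn, ∃ a ∈ ⋀[ℝ]^n (OddCoord →₀ ℝ), F = f ⊗ₜ[ℝ] a}

/-- The (left) partial derivatives `∂/∂c` on the superalgebra. -/
def partialDer : Coord → Module.End ℝ SuperFn
  | Sum.inl c => TensorProduct.map (pderiv c) LinearMap.id
  | Sum.inr c => TensorProduct.map LinearMap.id
      (CliffordAlgebra.contractLeft (Q := (0 : QuadraticForm ℝ (OddCoord →₀ ℝ)))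
        (Finsupp.lapply c : (OddCoord →₀ ℝ) →ₗ[ℝ] ℝ))

theorem finite_contract_ne_zero (a : OddAlg) :
    {c : OddCoord | CliffordAlgebra.contractLeft (Q := (0 : QuadraticForm ℝ (OddCoord →₀ ℝ)))
      (Finsupp.lapply c : (OddCoord →₀ ℝ) →ₗ[ℝ] ℝ) a ≠ 0}.Finite := by
  induction a using CliffordAlgebra.left_induction with
  | algebraMap r => simp [CliffordAlgebra.contractLeft_algebraMap]
  | add a b ha hb =>
    refine (ha.union hb).subset fun c hc => ?_
    by_contra h
    simp only [Set.mem_union, Set.mem_ofPred_eq, not_or, not_not] at h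
    exact hc (by rw [map_add, h.1, h.2, add_zero])
  | ι_mul a m ha =>
    refine (ha.union m.hasFiniteSupport).subset fun c hc => ?_
    by_contra h
    simp only [Set.mem_union, Set.mem_ofPred_eq, not_or, not_not, Function.mem_support] at h
    refine hc ?_
    rw [CliffordAlgebra.contractLeft_ι_mul, h.1]
    simp [h.2]

theorem finite_partialDer_ne_zero (F : SuperFn) : {c | partialDer c F ≠ 0}.Finite := by
  induction F using TensorProduct.induction_on with
  | zero => simp
  | add F G hF hG =>
    refine (hF.union hG).subset fun c hc => ?_
    by_contra h
    simp only [Set.mem_union, Set.mem_ofPred_eq, not_or, not_not] at h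
    exact hc (by rw [map_add, h.1, h.2, add_zero])
  | tmul f a =>
    refine (((finite_pderiv_ne_zero f).image Sum.inl).union
      ((finite_contract_ne_zero a).image Sum.inr)).subset fun c hc => ?_
    rcases c with c | c
    · refine Or.inl ⟨c, fun h => hc ?_, rfl⟩
      simp [partialDer, h]
    · refine Or.inr ⟨c, fun h => hc ?_, rfl⟩
      simp [partialDer, h]

/-- The vector field `∑ a_c ∂/∂c` on `W` with components `a`, acting on functions. The sum has
only finitely many nonzero terms on every function. -/
def vectorField (a : Coord → SuperFn) : Module.End ℝ SuperFn where
  toFun F := ∑ᶠ c, a c * partialDer c F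
  map_add' F G := by
    rw [← finsum_add_distrib]
    · exact finsum_congr fun c => by rw [map_add, mul_add]
    · exact (finite_partialDer_ne_zero F).subset fun c hc h => hc (by simp [h])
    · exact (finite_partialDer_ne_zero G).subset fun c hc h => hc (by simp [h])
  map_smul' r F := by
    rw [RingHom.id_apply, smul_finsum' r
      ((finite_partialDer_ne_zero F).subset fun c hc h => hc (by simp [h]))]
    exact finsum_congr fun c => by rw [map_smul, mul_smul_comm]

/-! ### Names for the coordinate functions -/

def y : SuperFn := evenGen .y
def u (k l : ℕ) : SuperFn := evenGen (.u k l)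
def uy (k l : ℕ) : SuperFn := evenGen (.uy k l)
def v (k l : ℕ) : SuperFn := evenGen (.v k l)
def vy (k l : ℕ) : SuperFn := evenGen (.vy k l)
def p (k l : ℕ) : SuperFn := oddGen (.p k l)
def py (k l : ℕ) : SuperFn := oddGen (.py k l)
def q (k l : ℕ) : SuperFn := oddGen (.q k l)
def qy (k l : ℕ) : SuperFn := oddGen (.qy k l)
def w1 (l : ℕ) : SuperFn := oddGen (.w1 l)
def w2 (l : ℕ) : SuperFn := oddGen (.w2 l)
def w3 (l : ℕ) : SuperFn := oddGen (.w3 l)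
def w4 (l : ℕ) : SuperFn := oddGen (.w4 l)

/-! ### The equation, its tangent equation and the four coverings -/

/-- Right-hand side of `u_yy = u_xt - u_x u_xy + u_y u_xx`. -/
def rhsU : SuperFn := u 1 1 - u 1 0 * uy 1 0 + uy 0 0 * u 2 0

/-- Right-hand side of `v_yy = v_xt - u_x v_xy - 2 v_y u_xx + 2 v_x u_xy + u_y v_xx`. -/
def rhsV : SuperFn :=
  v 1 1 - u 1 0 * vy 1 0 - 2 * vy 0 0 * u 2 0 + 2 * v 1 0 * uy 1 0 + uy 0 0 * v 2 0

/-- Right-hand side of `p_yy = u_y p_xx - u_xy p_x - u_x p_xy + u_xx p_y + p_xt`. -/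
def rhsP : SuperFn :=
  uy 0 0 * p 2 0 - uy 1 0 * p 1 0 - u 1 0 * py 1 0 + u 2 0 * py 0 0 + p 1 1

/-- Right-hand side of `q_yy = 2 v_x p_xy + v_xx p_y - v_xy p_x - 2 v_y p_xx + 2 u_xy q_x
+ u_y q_xx - u_x q_xy - 2 u_xx q_y + q_xt`. -/
def rhsQ : SuperFn :=
  2 * v 1 0 * py 1 0 + v 2 0 * py 0 0 - vy 1 0 * p 1 0 - 2 * vy 0 0 * p 2 0
    + 2 * uy 1 0 * q 1 0 + uy 0 0 * q 2 0 - u 1 0 * qy 1 0 - 2 * u 2 0 * qy 0 0 + q 1 1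

/-- `w_{1,x}` -/
def X1 : SuperFn := 2 * u 1 0 * p 1 0 + py 0 0

/-- `w_{1,y}` -/
def Y1 : SuperFn := uy 0 0 * p 1 0 + u 1 0 * py 0 0 + p 0 1

/-- `w_{2,x}` -/
def X2 : SuperFn := qy 0 0 - v 1 0 * p 1 0 - u 1 0 * q 1 0

/-- `w_{2,y}` -/
def Y2 : SuperFn :=
  q 0 1 - 2 * vy 0 0 * p 1 0 + v 1 0 * py 0 0 + uy 0 0 * q 1 0 - 2 * u 1 0 * qy 0 0

/-- `w_{3,x}` -/
def X3 : SuperFn :=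
  ((3 / 2 : ℝ) • u 1 0 ^ 2 - y * u 1 1) * p 1 0 + (y * u 2 0 + (1 / 2 : ℝ) • 1) * p 0 1
    - uy 1 0 * p 0 0 + u 1 0 * py 0 0 - (1 / 2 : ℝ) • (y * py 0 1)

/-- `w_{3,y}` -/
def Y3 : SuperFn :=
  (u 1 0 * uy 1 0 - uy 0 0 * u 2 0 - u 1 1) * p 0 0
    + (u 1 0 * uy 0 0 - (1 / 2 : ℝ) • (y * uy 0 1)) * p 1 0
    + (1 / 2 : ℝ) • ((u 1 0 ^ 2 - y * u 1 1) * py 0 0)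
    + (y * uy 1 0 + u 1 0) * p 0 1
    - (1 / 2 : ℝ) • (y * (uy 0 0 * p 1 1 - u 1 0 * py 0 1 + p 0 2))

/-- `w_{4,x}` -/
def X4 : SuperFn :=
  y * (v 2 0 * p 0 1 - v 1 1 * p 1 0 + u 2 0 * q 0 1 - u 1 1 * q 1 0 + qy 0 1)
    - vy 1 0 * p 0 0 + v 1 0 * py 0 0 - uy 1 0 * q 0 0 + u 1 0 * qy 0 0 - q 0 1

/-- `w_{4,y}` -/
def Y4 : SuperFn :=
  (u 1 0 * vy 1 0 + 2 * vy 0 0 * u 2 0 - 2 * v 1 0 * uy 1 0 - uy 0 0 * v 2 0 - v 1 1) * p 0 0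
    + (uy 0 0 * v 1 0 - 2 * u 1 0 * vy 0 0 - 2 * y * vy 0 1) * p 1 0
    + (u 1 0 * v 1 0 + y * v 1 1) * py 0 0
    + (y * vy 1 0 + v 1 0) * p 0 1
    + (u 1 0 * uy 1 0 - uy 0 0 * u 2 0 - u 1 1) * q 0 0
    + (u 1 0 * uy 0 0 + y * uy 0 1) * q 1 0
    - (u 1 0 ^ 2 + 2 * y * u 1 1) * qy 0 0
    + (y * uy 1 0 + u 1 0) * q 0 1
    + y * (2 * v 1 0 * py 0 1 - 2 * vy 0 0 * p 1 1 + uy 0 0 * q 1 1 - u 1 0 * qy 0 1 + q 0 2)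

/-- The total derivative `D_t` on `W`. -/
def Dt : Module.End ℝ SuperFn := vectorField fun
  | .inl .x => 0
  | .inl .y => 0
  | .inl .t => 1
  | .inl (.u k l) => u k (l + 1)
  | .inl (.uy k l) => uy k (l + 1)
  | .inl (.v k l) => v k (l + 1)
  | .inl (.vy k l) => vy k (l + 1)
  | .inr (.p k l) => p k (l + 1)
  | .inr (.py k l) => py k (l + 1)
  | .inr (.q k l) => q k (l + 1)
  | .inr (.qy k l) => qy k (l + 1)
  | .inr (.w1 l) => w1 (l + 1)
  | .inr (.w2 l) => w2 (l + 1)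
  | .inr (.w3 l) => w3 (l + 1)
  | .inr (.w4 l) => w4 (l + 1)

/-- The total derivative `D_x` on `W`. -/
def Dx : Module.End ℝ SuperFn := vectorField fun
  | .inl .x => 1
  | .inl .y => 0
  | .inl .t => 0
  | .inl (.u k l) => u (k + 1) l
  | .inl (.uy k l) => uy (k + 1) l
  | .inl (.v k l) => v (k + 1) l
  | .inl (.vy k l) => vy (k + 1) l
  | .inr (.p k l) => p (k + 1) l
  | .inr (.py k l) => py (k + 1) l
  | .inr (.q k l) => q (k + 1) l
  | .inr (.qy k l) => qy (k + 1) l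
  | .inr (.w1 l) => (Dt ^ l) X1
  | .inr (.w2 l) => (Dt ^ l) X2
  | .inr (.w3 l) => (Dt ^ l) X3
  | .inr (.w4 l) => (Dt ^ l) X4

/-- The total derivative `D_y` on `W`. -/
def Dy : Module.End ℝ SuperFn := vectorField fun
  | .inl .x => 0
  | .inl .y => 1
  | .inl .t => 0
  | .inl (.u k l) => uy k l
  | .inl (.uy k l) => (Dx ^ k) ((Dt ^ l) rhsU)
  | .inl (.v k l) => vy k l
  | .inl (.vy k l) => (Dx ^ k) ((Dt ^ l) rhsV)
  | .inr (.p k l) => py k l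
  | .inr (.py k l) => (Dx ^ k) ((Dt ^ l) rhsP)
  | .inr (.q k l) => qy k l
  | .inr (.qy k l) => (Dx ^ k) ((Dt ^ l) rhsQ)
  | .inr (.w1 l) => (Dt ^ l) Y1
  | .inr (.w2 l) => (Dt ^ l) Y2
  | .inr (.w3 l) => (Dt ^ l) Y3
  | .inr (.w4 l) => (Dt ^ l) Y4

/-- The Cartan differential as an odd vector field on the tangent equation, extended to `W` so
that it commutes with the total derivatives:
`d w_1 = d w_2 = 0`, `d w_3 = y p_x p_t + p p_y`, `d w_4 = y (p_x q_t - p_t q_x) + p q_y - p_y q`. -/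
def dC : Module.End ℝ SuperFn := vectorField fun
  | .inl .x => 0
  | .inl .y => 0
  | .inl .t => 0
  | .inl (.u k l) => p k l
  | .inl (.uy k l) => py k l
  | .inl (.v k l) => q k l
  | .inl (.vy k l) => qy k l
  | .inr (.p _ _) => 0
  | .inr (.py _ _) => 0
  | .inr (.q _ _) => 0
  | .inr (.qy _ _) => 0
  | .inr (.w1 _) => 0
  | .inr (.w2 _) => 0
  | .inr (.w3 l) => (Dt ^ l) (y * p 1 0 * p 0 1 + p 0 0 * py 0 0)
  | .inr (.w4 l) =>
      (Dt ^ l) (y * (p 1 0 * q 0 1 - p 0 1 * q 1 0) + p 0 0 * qy 0 0 - py 0 0 * q 0 0)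

/-! ### Shadows, nonlocal symmetries, lifts and brackets -/

/-- A pair `Φ = (Φ^u, Φ^v)` of functions on `W`. -/
@[ext]
structure Shadow where
  u : SuperFn
  v : SuperFn

/-- `Φ` is linear in the odd variables and satisfies the linearized equation, lifted to `W`. -/
structure IsShadow (Φ : Shadow) : Prop where
  linear_u : Φ.u ∈ homogeneous 1
  linear_v : Φ.v ∈ homogeneous 1
  eq_u : Dy (Dy Φ.u) = Dx (Dt Φ.u) + u 2 0 * Dy Φ.u + uy 0 0 * Dx (Dx Φ.u)
    - u 1 0 * Dx (Dy Φ.u) - uy 1 0 * Dx Φ.u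
  eq_v : Dy (Dy Φ.v) = 2 * v 1 0 * Dx (Dy Φ.u) - vy 1 0 * Dx Φ.u + v 2 0 * Dy Φ.u
    - 2 * vy 0 0 * Dx (Dx Φ.u) + Dx (Dt Φ.v) + 2 * uy 1 0 * Dx Φ.v - 2 * u 2 0 * Dy Φ.v
    + uy 0 0 * Dx (Dx Φ.v) - u 1 0 * Dx (Dy Φ.v)

/-- Generating sections of evolutionary fields on `W`. -/
@[ext]
structure GenSection where
  u : SuperFn
  v : SuperFn
  p : SuperFn
  q : SuperFn
  w1 : SuperFn
  w2 : SuperFn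
  w3 : SuperFn
  w4 : SuperFn

/-- The evolutionary vector field on `W` with generating section `φ`. -/
def Ev (φ : GenSection) : Module.End ℝ SuperFn := vectorField fun
  | .inl .x => 0
  | .inl .y => 0
  | .inl .t => 0
  | .inl (.u k l) => (Dx ^ k) ((Dt ^ l) φ.u)
  | .inl (.uy k l) => Dy ((Dx ^ k) ((Dt ^ l) φ.u))
  | .inl (.v k l) => (Dx ^ k) ((Dt ^ l) φ.v)
  | .inl (.vy k l) => Dy ((Dx ^ k) ((Dt ^ l) φ.v))
  | .inr (.p k l) => (Dx ^ k) ((Dt ^ l) φ.p)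
  | .inr (.py k l) => Dy ((Dx ^ k) ((Dt ^ l) φ.p))
  | .inr (.q k l) => (Dx ^ k) ((Dt ^ l) φ.q)
  | .inr (.qy k l) => Dy ((Dx ^ k) ((Dt ^ l) φ.q))
  | .inr (.w1 l) => (Dt ^ l) φ.w1
  | .inr (.w2 l) => (Dt ^ l) φ.w2
  | .inr (.w3 l) => (Dt ^ l) φ.w3
  | .inr (.w4 l) => (Dt ^ l) φ.w4

/-- `φ` generates an odd nonlocal symmetry: the field `Ev φ` raises the degree in the odd
variables by one and preserves the Cartan distribution on `W`. -/
structure IsOddNonlocalSymmetry (φ : GenSection) : Prop where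
  deg_u : φ.u ∈ homogeneous 1
  deg_v : φ.v ∈ homogeneous 1
  deg_p : φ.p ∈ homogeneous 2
  deg_q : φ.q ∈ homogeneous 2
  deg_w1 : φ.w1 ∈ homogeneous 2
  deg_w2 : φ.w2 ∈ homogeneous 2
  deg_w3 : φ.w3 ∈ homogeneous 2
  deg_w4 : φ.w4 ∈ homogeneous 2
  comm_x : Ev φ * Dx = Dx * Ev φ
  comm_y : Ev φ * Dy = Dy * Ev φ
  comm_t : Ev φ * Dt = Dt * Ev φ

/-- `φ` lifts the shadow `Φ` to `W`: it is a nonlocal symmetry that restricts to `Φ` on the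
equation, and its action on the fibre variables `p = dC u`, `q = dC v` of the tangent equation
is the one prescribed by anticommutation with the Cartan differential. -/
structure IsLift (Φ : Shadow) (φ : GenSection) : Prop where
  symm : IsOddNonlocalSymmetry φ
  restrict_u : φ.u = Φ.u
  restrict_v : φ.v = Φ.v
  tangent_p : φ.p = -dC Φ.u
  tangent_q : φ.q = -dC Φ.v

/-- The super-commutator of the two odd fields `Ev φ`, `Ev ψ`. -/
def superCommutator (φ ψ : GenSection) : Module.End ℝ SuperFn :=
  Ev φ * Ev ψ + Ev ψ * Ev φ

/-- The Frölicher–Nijenhuis bracket of two (lifted) generating sections: the generating section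
of the super-commutator of the corresponding odd fields. -/
def fnBracket (φ ψ : GenSection) : GenSection where
  u := superCommutator φ ψ (u 0 0)
  v := superCommutator φ ψ (v 0 0)
  p := superCommutator φ ψ (p 0 0)
  q := superCommutator φ ψ (q 0 0)
  w1 := superCommutator φ ψ (w1 0)
  w2 := superCommutator φ ψ (w2 0)
  w3 := superCommutator φ ψ (w3 0)
  w4 := superCommutator φ ψ (w4 0)

/-- The zero generating section. -/
instance : Zero GenSection := ⟨⟨0, 0, 0, 0, 0, 0, 0, 0⟩⟩

/-- The recursion operator given by the shadow `Φ` is hereditary: `Φ` lifts to `W`, and the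
bracket of its lift with itself vanishes. -/
def IsHereditary (Φ : Shadow) : Prop :=
  (∃ φ, IsLift Φ φ) ∧ ∀ φ, IsLift Φ φ → fnBracket φ φ = 0

/-- The recursion operators given by the shadows `Φ`, `Ψ` are compatible: both shadows lift to
`W`, and the bracket of the lifts vanishes. -/
def AreCompatible (Φ Ψ : Shadow) : Prop :=
  (∃ φ, IsLift Φ φ) ∧ (∃ ψ, IsLift Ψ ψ) ∧
    ∀ φ ψ, IsLift Φ φ → IsLift Ψ ψ → fnBracket φ ψ = 0

/-- The shadow `Φ_1 = (u_x p - w_1, v_x p - 2 u_x q - w_2)`. -/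
def Phi1 : Shadow where
  u := u 1 0 * p 0 0 - w1 0
  v := v 1 0 * p 0 0 - 2 * u 1 0 * q 0 0 - w2 0

/-- The shadow `Φ_2`, with
`Φ_2^u = u_y p - 2 y u_x p_t - u_x w_1 + y w_{1,t} + 2 w_3` and
`Φ_2^v = -2 v_y p + y v_x p_t + (3 u_x^2 + u_y) q + y u_x q_t - v_x w_1 + 2 u_x w_2
+ y w_{2,t} - w_4`. -/
def Phi2 : Shadow where
  u := uy 0 0 * p 0 0 - 2 * y * u 1 0 * p 0 1 - u 1 0 * w1 0 + y * w1 1 + 2 * w3 0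
  v := -2 * vy 0 0 * p 0 0 + y * v 1 0 * p 0 1 + (3 * u 1 0 ^ 2 + uy 0 0) * q 0 0
    + y * u 1 0 * q 0 1 - v 1 0 * w1 0 + 2 * u 1 0 * w2 0 + y * w2 1 - w4 0

end PavlovMikhalev

end

noncomputable section

namespace PavlovMikhalev

/-! The proof combines a rigidity property of the covering with finite polynomial computations.

Supercalculus. A vector field on `W` is determined by its values on the coordinates and satisfies
the graded Leibniz rule. The second-order parts of a supercommutator cancel, so it is again a vector
field (`IsVectorField.commutator`), and two fields supercommute as soon as they do so on coordinates
(`IsVectorField.commute_of_gen`). A field that kills x, y, t and commutes with the total derivatives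
is evolutionary (`IsVectorField.eq_Ev`); applied to the supercommutator of two odd symmetries, this
gives the last assertion of the theorem. On coordinates, the conditions for `Ev φ` to commute with
the total derivatives reduce to twelve identities: four linearized equations, and one x- and one
y-identity for each nonlocal variable (`IsOddNonlocalSymmetry.of_hasDegrees`).

Rigidity. A function of positive odd degree killed by `Dx` and `Dy` is zero (`eq_zero_of_Dx_of_Dy`).
For a function free of the `w_i`, the highest x-derivative in each family of coordinates cannot
cancel in `Dx F`, so F depends on x, y, t only and has no part of positive degree. In degree one,
the coefficients of F along the `w_i` are killed by `Dx` and `Dy` and hence do not depend on y. The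
terms `y p_yt` in `X3` and `y q_yt` in `X4` then force the coefficients along `w_3` and `w_4` to
vanish, and after that `p_y` in `X1` and `q_y` in `X2` remove `w_1` and `w_2`. Higher degrees follow
by induction, since the derivatives along the `w_i` commute with `Dx` and `Dy`.

Rigidity is used twice. The `Dx`- and `Dy`-derivatives of `w_i` are local, so two symmetries with
equal u, v, p, q components agree on them, and their `w_i` components are equal as well: lifts are
unique (`IsLift.eq`). In the same way, a bracket whose u, v, p, q components vanish is zero
(`IsOddNonlocalSymmetry.fnBracket_eq_zero`).

What remains concerns two explicit sections, `lift1` and `lift2`: the twelve identities for each,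
the shadow equations, the lift conditions, and the u, v, p, q components of three brackets. All are
identities between polynomials with dyadic coefficients. They are decided by a normal form for
supercommutative polynomials whose soundness is `Expr.eval_eq_zero`, and the kernel evaluates it. -/

/-- The ring structure on the superalgebra, with operations that unify with those of the tensor
product of modules. -/
instance (priority := 10000) instRingSuperFn : Ring SuperFn :=
  { (Algebra.TensorProduct.instSemiring : Semiring SuperFn) with
    neg := fun F => -F
    sub := fun F G => F - G
    sub_eq_add_neg := fun F G =>
      (Algebra.TensorProduct.instRing : Ring SuperFn).sub_eq_add_neg F G
    zsmul := (Algebra.TensorProduct.instRing : Ring SuperFn).zsmul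
    zsmul_zero' := (Algebra.TensorProduct.instRing : Ring SuperFn).zsmul_zero'
    zsmul_succ' := (Algebra.TensorProduct.instRing : Ring SuperFn).zsmul_succ'
    zsmul_neg' := (Algebra.TensorProduct.instRing : Ring SuperFn).zsmul_neg'
    intCast := (Algebra.TensorProduct.instRing : Ring SuperFn).intCast
    intCast_ofNat := (Algebra.TensorProduct.instRing : Ring SuperFn).intCast_ofNat
    intCast_negSucc := (Algebra.TensorProduct.instRing : Ring SuperFn).intCast_negSucc
    neg_add_cancel := (Algebra.TensorProduct.instRing : Ring SuperFn).neg_add_cancel }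

instance (priority := 10000) instAddCommGroupSuperFn : AddCommGroup SuperFn :=
  instRingSuperFn.toAddCommGroup

/-! ### Parity -/

/-- The parity automorphism of the superalgebra of functions on `W`. -/
def parityAut : SuperFn →ₐ[ℝ] SuperFn :=
  Algebra.TensorProduct.map (AlgHom.id ℝ SmoothFn)
    (CliffordAlgebra.involute (Q := (0 : QuadraticForm ℝ (OddCoord →₀ ℝ))))

@[simp] theorem parityAut_tmul (f : SmoothFn) (a : OddAlg) :
    parityAut (f ⊗ₜ a) = f ⊗ₜ[ℝ]
      CliffordAlgebra.involute (Q := (0 : QuadraticForm ℝ (OddCoord →₀ ℝ))) a := rfl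

@[simp] theorem parityAut_parityAut (F : SuperFn) : parityAut (parityAut F) = F := by
  induction F using TensorProduct.induction_on with
  | zero => simp
  | add F G hF hG => rw [map_add, map_add, hF, hG]
  | tmul f a => rw [parityAut_tmul, parityAut_tmul, CliffordAlgebra.involute_involute]

/-- The power of the parity automorphism with exponent `0` or `1`. -/
def parityPow (e : Bool) (F : SuperFn) : SuperFn := if e then parityAut F else F

/-- The Koszul sign of the exchange of elements of parities `e` and `f`. -/
def koszul (e f : Bool) : ℝ := if e && f then -1 else 1

/-- `F` is even for `e = false` and odd for `e = true`. -/
def HasParity (e : Bool) (F : SuperFn) : Prop := parityAut F = if e then -F else F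

/-- Crossing one generator costs one sign, so crossing a product of n generators costs (-1)^n, which
is what the involution does to it. -/
theorem ι_mul_eq_involute_mul (m : OddCoord →₀ ℝ) (b : OddAlg) :
    ExteriorAlgebra.ι ℝ m * b =
      CliffordAlgebra.involute (Q := (0 : QuadraticForm ℝ (OddCoord →₀ ℝ))) b *
        ExteriorAlgebra.ι ℝ m := by
  induction b using CliffordAlgebra.left_induction with
  | algebraMap r =>
    rw [AlgHom.commutes]; exact (Algebra.commutes r _).symm
  | add a b ha hb => rw [mul_add, ha, hb, map_add, add_mul]
  | ι_mul a n ha =>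
    have h : ExteriorAlgebra.ι ℝ m * ExteriorAlgebra.ι ℝ n
        = -(ExteriorAlgebra.ι ℝ n * ExteriorAlgebra.ι ℝ m) :=
      eq_neg_of_add_eq_zero_left (ExteriorAlgebra.ι_add_mul_swap m n)
    change ExteriorAlgebra.ι ℝ m * (ExteriorAlgebra.ι ℝ n * a) = _
    rw [map_mul, CliffordAlgebra.involute_ι, ← mul_assoc, h, neg_mul, mul_assoc, ha, neg_mul,
      neg_mul, mul_assoc]

/-- Supercommutativity without homogeneity assumptions. The sum and the difference of a and its
involute are twice the even and the odd part of a; the even part commutes with b, and the odd part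
does so up to the involution of b. The factor 2 avoids halving. -/
theorem oddAlg_mul_comm (a b : OddAlg) :
    (2 : ℝ) • (a * b) =
      b * (a + CliffordAlgebra.involute (Q := (0 : QuadraticForm ℝ (OddCoord →₀ ℝ))) a) +
      CliffordAlgebra.involute (Q := (0 : QuadraticForm ℝ (OddCoord →₀ ℝ))) b *
        (a - CliffordAlgebra.involute (Q := (0 : QuadraticForm ℝ (OddCoord →₀ ℝ))) a) := by
  induction a using CliffordAlgebra.left_induction generalizing b with
  | algebraMap r =>
    rw [AlgHom.commutes, sub_self, mul_zero, add_zero, mul_add, ← two_smul ℝ]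
    congr 1
    exact Algebra.commutes r _
  | add a c ha hc => rw [add_mul, smul_add, ha, hc, map_add]; noncomm_ring
  | ι_mul a n ha =>
    have h1 := ι_mul_eq_involute_mul n b
    have h2 := ι_mul_eq_involute_mul n
      (CliffordAlgebra.involute (Q := (0 : QuadraticForm ℝ (OddCoord →₀ ℝ))) b)
    rw [CliffordAlgebra.involute_involute] at h2
    change (2 : ℝ) • (ExteriorAlgebra.ι ℝ n * a * b) =
      b * (ExteriorAlgebra.ι ℝ n * a + CliffordAlgebra.involute (ExteriorAlgebra.ι ℝ n * a)) +
      CliffordAlgebra.involute b *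
        (ExteriorAlgebra.ι ℝ n * a - CliffordAlgebra.involute (ExteriorAlgebra.ι ℝ n * a))
    rw [mul_assoc, ← mul_smul_comm, ha, map_mul, mul_add, ← mul_assoc, ← mul_assoc, h1, h2,
      show CliffordAlgebra.involute (ExteriorAlgebra.ι ℝ n) = -ExteriorAlgebra.ι ℝ n from
        CliffordAlgebra.involute_ι n]
    noncomm_ring

theorem two_smul_mul_comm (F G : SuperFn) :
    (2 : ℝ) • (F * G) = G * (F + parityAut F) + parityAut G * (F - parityAut F) := by
  induction F using TensorProduct.induction_on with
  | zero => simp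
  | add F H hF hH => rw [add_mul, smul_add, hF, hH, map_add]; noncomm_ring
  | tmul f a =>
    induction G using TensorProduct.induction_on with
    | zero => simp
    | add G H hG hH => rw [mul_add, smul_add, hG, hH, map_add]; noncomm_ring
    | tmul g b =>
      rw [parityAut_tmul, parityAut_tmul, ← TensorProduct.tmul_add, ← TensorProduct.tmul_sub,
        Algebra.TensorProduct.tmul_mul_tmul, Algebra.TensorProduct.tmul_mul_tmul,
        Algebra.TensorProduct.tmul_mul_tmul, mul_comm g f, ← TensorProduct.tmul_add,
        ← oddAlg_mul_comm, TensorProduct.tmul_smul]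

/-- Of the sum and the difference of F and `parityAut F` one vanishes and the other is 2F, so
`two_smul_mul_comm` gives the claim after cancelling 2. Only F has to be homogeneous, which allows
Leibniz rules for arbitrary functions. -/
theorem HasParity.mul_comm {e : Bool} {F : SuperFn} (hF : HasParity e F) (G : SuperFn) :
    F * G = parityPow e G * F := by
  have h := two_smul_mul_comm F G
  unfold HasParity at hF
  rw [hF] at h
  have h2 : (2 : ℝ) ≠ 0 := two_ne_zero
  apply smul_right_injective SuperFn h2
  cases e
  · simp only [parityPow] at *
    simpa [two_smul, mul_add] using h
  · simp only [parityPow] at *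
    simpa [two_smul, mul_add] using h

theorem HasParity.parityPow_eq {e f : Bool} {F : SuperFn} (hF : HasParity e F) :
    parityPow f F = koszul e f • F := by
  unfold HasParity at hF
  cases e <;> cases f <;> simp [parityPow, koszul, hF]

theorem HasParity.zero (e : Bool) : HasParity e 0 := by simp [HasParity]

theorem HasParity.add {e : Bool} {F G : SuperFn} (hF : HasParity e F) (hG : HasParity e G) :
    HasParity e (F + G) := by
  unfold HasParity at *
  rw [map_add, hF, hG]; cases e <;> simp [add_comm]

theorem HasParity.neg {e : Bool} {F : SuperFn} (hF : HasParity e F) : HasParity e (-F) := by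
  unfold HasParity at *
  rw [map_neg, hF]; cases e <;> simp

theorem HasParity.sub {e : Bool} {F G : SuperFn} (hF : HasParity e F) (hG : HasParity e G) :
    HasParity e (F - G) := sub_eq_add_neg F G ▸ hF.add hG.neg

theorem HasParity.smul {e : Bool} {F : SuperFn} (r : ℝ) (hF : HasParity e F) :
    HasParity e (r • F) := by
  unfold HasParity at *
  rw [map_smul, hF]; cases e <;> simp

theorem HasParity.mul {e f : Bool} {F G : SuperFn} (hF : HasParity e F) (hG : HasParity f G) :
    HasParity (e ^^ f) (F * G) := by
  unfold HasParity at *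
  rw [map_mul, hF, hG]; cases e <;> cases f <;> simp

theorem HasParity.one : HasParity false 1 := by simp [HasParity]

theorem hasParity_evenGen (c : EvenCoord) : HasParity false (evenGen c) := by
  simp [HasParity, evenGen]

theorem hasParity_oddGen (c : OddCoord) : HasParity true (oddGen c) := by
  simp only [HasParity, oddGen, parityAut_tmul, if_true]
  rw [← TensorProduct.tmul_neg]
  congr 1
  exact CliffordAlgebra.involute_ι _

theorem HasParity.sum {ι : Type*} {e : Bool} (s : Finset ι) (F : ι → SuperFn)
    (h : ∀ i ∈ s, HasParity e (F i)) : HasParity e (∑ i ∈ s, F i) := by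
  classical
  induction s using Finset.induction_on with
  | empty => simpa using HasParity.zero e
  | insert a s ha ih =>
    rw [Finset.sum_insert ha]
    exact (h a (by simp)).add (ih fun i hi => h i (by simp [hi]))

/-! ### Partial derivatives -/

/-- The parity of a coordinate. -/
def Coord.odd (c : Coord) : Bool := Sum.isRight c

@[simp] theorem Coord.odd_inl (c : EvenCoord) : Coord.odd (Sum.inl c) = false := rfl
@[simp] theorem Coord.odd_inr (c : OddCoord) : Coord.odd (Sum.inr c) = true := rfl

/-- A coordinate as a function on `W`. -/
def gen : Coord → SuperFn
  | .inl c => evenGen c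
  | .inr c => oddGen c

theorem pderiv_apply (c : EvenCoord) (f : SmoothFn) (z : EvenCoord → ℝ) :
    (pderiv c f : (EvenCoord → ℝ) → ℝ) z =
      deriv (fun r : ℝ => (f : (EvenCoord → ℝ) → ℝ) (Function.update z c r)) (z c) := rfl

theorem pderiv_mul (c : EvenCoord) (f g : SmoothFn) :
    pderiv c (f * g) = pderiv c f * g + f * pderiv c g := by
  ext z
  have h := deriv_fun_mul (differentiableAt_slice c f z) (differentiableAt_slice c g z)
  simpa [pderiv_apply] using h

theorem pderiv_coordFn (c d : EvenCoord) :
    pderiv c (coordFn d) = if d = c then 1 else 0 := by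
  ext z
  rw [pderiv_apply]
  by_cases h : d = c
  · subst h
    simp [coordFn]
  · simp [coordFn, h]

theorem pderiv_eq_fderiv {f : SmoothFn} {s : Finset EvenCoord} {g : (s → ℝ) → ℝ}
    (hg : ContDiff ℝ ∞ g) (hf : ∀ z : EvenCoord → ℝ, (f : (EvenCoord → ℝ) → ℝ) z = g (fun c => z c))
    (c : EvenCoord) (z : EvenCoord → ℝ) : (pderiv c f : (EvenCoord → ℝ) → ℝ) z =
      fderiv ℝ g (fun d => z d) (fun d : s => if (d : EvenCoord) = c then 1 else 0) :=
  (hasDerivAt_of_mem hg hf c z).deriv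

/-- Schwarz's theorem: both sides are values of the second Fréchet derivative of a representative of
f in finitely many variables, and this derivative is symmetric. -/
theorem pderiv_comm (c d : EvenCoord) (f : SmoothFn) :
    pderiv c (pderiv d f) = pderiv d (pderiv c f) := by
  obtain ⟨s, g, hg, hf⟩ := f.2
  have key : ∀ c d : EvenCoord, ∀ z, (pderiv c (pderiv d f) : (EvenCoord → ℝ) → ℝ) z =
      fderiv ℝ (fderiv ℝ g) (fun e => z e) (fun e : s => if (e : EvenCoord) = c then 1 else 0)
        (fun e : s => if (e : EvenCoord) = d then 1 else 0) := by
    intro c d z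
    have hg' : ContDiff ℝ ∞ (fderiv ℝ g) := hg.fderiv_right (by simp)
    rw [pderiv_eq_fderiv (hg'.clm_apply contDiff_const) (pderiv_eq_fderiv hg hf d) c z]
    rw [fderiv_clm_apply (hg'.differentiable (by simp)).differentiableAt
      (differentiableAt_const _)]
    simp
  ext z
  rw [key, key]
  exact (hg.contDiffAt.isSymmSndFDerivAt (by simpa using ENat.LEInfty.out)).eq _ _

/-- Contraction is an antiderivation. Mathlib's `contractLeft_ι_mul` is the case where a is a
generator, and induction on a extends it to all products. -/
theorem contractLeft_mul (d : Module.Dual ℝ (OddCoord →₀ ℝ)) (a b : OddAlg) :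
    CliffordAlgebra.contractLeft (Q := (0 : QuadraticForm ℝ (OddCoord →₀ ℝ))) d (a * b) =
      CliffordAlgebra.contractLeft (Q := (0 : QuadraticForm ℝ (OddCoord →₀ ℝ))) d a * b +
      CliffordAlgebra.involute (Q := (0 : QuadraticForm ℝ (OddCoord →₀ ℝ))) a *
      CliffordAlgebra.contractLeft (Q := (0 : QuadraticForm ℝ (OddCoord →₀ ℝ))) d b := by
  induction a using CliffordAlgebra.left_induction with
  | algebraMap r =>
    rw [CliffordAlgebra.contractLeft_algebraMap_mul, CliffordAlgebra.contractLeft_algebraMap,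
      zero_mul, zero_add, AlgHom.commutes]
  | add a c ha hc => rw [add_mul, map_add, ha, hc, map_add, map_add]; noncomm_ring
  | ι_mul a n ha =>
    rw [mul_assoc, CliffordAlgebra.contractLeft_ι_mul, ha, CliffordAlgebra.contractLeft_ι_mul,
      map_mul, CliffordAlgebra.involute_ι]
    simp only [sub_mul, mul_add, neg_mul, smul_mul_assoc, mul_assoc]
    abel

theorem partialDer_inl_tmul (c : EvenCoord) (f : SmoothFn) (a : OddAlg) :
    partialDer (.inl c) (f ⊗ₜ a) = pderiv c f ⊗ₜ a := rfl

theorem partialDer_inr_tmul (c : OddCoord) (f : SmoothFn) (a : OddAlg) :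
    partialDer (.inr c) (f ⊗ₜ a) = f ⊗ₜ[ℝ]
      CliffordAlgebra.contractLeft (Q := (0 : QuadraticForm ℝ (OddCoord →₀ ℝ)))
        (Finsupp.lapply c : (OddCoord →₀ ℝ) →ₗ[ℝ] ℝ) a := rfl

@[simp] theorem parityPow_zero (e : Bool) : parityPow e 0 = 0 := by cases e <;> simp [parityPow]

theorem parityPow_add (e : Bool) (F G : SuperFn) :
    parityPow e (F + G) = parityPow e F + parityPow e G := by cases e <;> simp [parityPow]

theorem partialDer_mul (c : Coord) (F G : SuperFn) :
    partialDer c (F * G) = partialDer c F * G + parityPow (Coord.odd c) F * partialDer c G := by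
  induction F using TensorProduct.induction_on with
  | zero => simp
  | add F H hF hH => rw [add_mul, map_add, hF, hH, map_add, parityPow_add]; noncomm_ring
  | tmul f a =>
    induction G using TensorProduct.induction_on with
    | zero => simp
    | add G H hG hH => rw [mul_add, map_add, hG, hH, map_add]; noncomm_ring
    | tmul g b =>
      rw [Algebra.TensorProduct.tmul_mul_tmul]
      rcases c with c | c
      · simp only [partialDer_inl_tmul, Coord.odd_inl, parityPow,
          Algebra.TensorProduct.tmul_mul_tmul, pderiv_mul, TensorProduct.add_tmul]
        simp
      · simp only [partialDer_inr_tmul, Coord.odd_inr, parityPow, if_true, parityAut_tmul,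
          Algebra.TensorProduct.tmul_mul_tmul, contractLeft_mul, TensorProduct.tmul_add]

/-- Two even derivatives commute by Schwarz, two contractions anticommute, and a mixed pair acts on
different tensor factors. -/
theorem partialDer_comm (c d : Coord) (F : SuperFn) :
    partialDer c (partialDer d F) =
      koszul (Coord.odd c) (Coord.odd d) • partialDer d (partialDer c F) := by
  induction F using TensorProduct.induction_on with
  | zero => simp
  | add F H hF hH => simp only [map_add, hF, hH, smul_add]
  | tmul f a =>
    rcases c with c | c <;> rcases d with d | d <;>
      simp only [partialDer_inr_tmul, partialDer_inl_tmul, Coord.odd_inl, Coord.odd_inr, koszul]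
    · simp [pderiv_comm c d f]
    · simp
    · simp
    · rw [CliffordAlgebra.contractLeft_comm]
      simp [TensorProduct.tmul_neg]

open scoped Classical in
theorem partialDer_gen (c d : Coord) : partialDer c (gen d) = if d = c then 1 else 0 := by
  rcases c with c | c <;> rcases d with d | d
  · simp only [gen, evenGen, partialDer_inl_tmul, pderiv_coordFn, Sum.inl.injEq]
    split_ifs
    · rfl
    · simp
  · simp only [gen, oddGen, partialDer_inl_tmul]
    have h : pderiv c 1 = 0 := by ext z; simp [pderiv_apply]
    simp [h]
  · simp only [gen, evenGen, partialDer_inr_tmul]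
    have h := CliffordAlgebra.contractLeft_one (Q := (0 : QuadraticForm ℝ (OddCoord →₀ ℝ)))
      (Finsupp.lapply c : (OddCoord →₀ ℝ) →ₗ[ℝ] ℝ)
    erw [h]
    simp
  · simp only [gen, oddGen, partialDer_inr_tmul, Sum.inr.injEq]
    have h := CliffordAlgebra.contractLeft_ι (Q := (0 : QuadraticForm ℝ (OddCoord →₀ ℝ)))
      (Finsupp.lapply c : (OddCoord →₀ ℝ) →ₗ[ℝ] ℝ) (Finsupp.single d 1)
    erw [h]
    by_cases hcd : d = c
    · subst hcd
      simp [Algebra.TensorProduct.one_def]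
    · simp [hcd]

theorem parityAut_partialDer (c : Coord) (F : SuperFn) :
    parityAut (partialDer c F) = koszul (Coord.odd c) true • partialDer c (parityAut F) := by
  induction F using TensorProduct.induction_on with
  | zero => simp
  | add F H hF hH => simp only [map_add, hF, hH, smul_add]
  | tmul f a =>
    rcases c with c | c
    · simp [partialDer_inl_tmul, koszul]
    · simp only [partialDer_inr_tmul, parityAut_tmul, Coord.odd_inr, koszul]
      have : ∀ a : CliffordAlgebra (0 : QuadraticForm ℝ (OddCoord →₀ ℝ)),
          CliffordAlgebra.involute
          (CliffordAlgebra.contractLeft (Q := (0 : QuadraticForm ℝ (OddCoord →₀ ℝ)))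
          (Finsupp.lapply c : (OddCoord →₀ ℝ) →ₗ[ℝ] ℝ) a) =
          -CliffordAlgebra.contractLeft (Q := (0 : QuadraticForm ℝ (OddCoord →₀ ℝ)))
          (Finsupp.lapply c : (OddCoord →₀ ℝ) →ₗ[ℝ] ℝ) (CliffordAlgebra.involute a) := by
        intro a
        induction a using CliffordAlgebra.left_induction with
        | algebraMap r => simp [CliffordAlgebra.contractLeft_algebraMap]
        | add a b ha hb => simp only [map_add, ha, hb, neg_add]
        | ι_mul a n ha =>
          rw [CliffordAlgebra.contractLeft_ι_mul, map_sub, map_smul, map_mul, map_mul, ha,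
            CliffordAlgebra.involute_ι]
          simp [CliffordAlgebra.contractLeft_ι_mul]
      rw [this]
      simp [TensorProduct.tmul_neg]

theorem HasParity.partialDer {e : Bool} {F : SuperFn} (hF : HasParity e F) (c : Coord) :
    HasParity (e ^^ Coord.odd c) (partialDer c F) := by
  unfold HasParity at *
  rw [parityAut_partialDer, hF]
  cases e <;> cases Coord.odd c <;> simp [koszul]

@[simp] theorem partialDer_one (c : Coord) : partialDer c 1 = 0 := by
  have h := partialDer_mul c 1 1
  have h1 : parityPow (Coord.odd c) 1 = 1 := by cases Coord.odd c <;> simp [parityPow]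
  simpa [h1] using h

/-! ### Vector fields -/

theorem vectorField_apply (a : Coord → SuperFn) (F : SuperFn) :
    vectorField a F = ∑ᶠ c, a c * partialDer c F := rfl

/-- Any finite set outside of which the derivatives vanish will do, so one set can serve several
functions within a computation. -/
theorem vectorField_eq_sum (a : Coord → SuperFn) {F : SuperFn} {s : Finset Coord}
    (h : ∀ c, c ∉ s → partialDer c F = 0) :
    vectorField a F = ∑ c ∈ s, a c * partialDer c F := by
  rw [vectorField_apply]
  refine finsum_eq_sum_of_support_subset _ fun c hc => ?_
  by_contra hcs
  exact hc (by simp [h c hcs])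

/-- A finite set containing the coordinates on which `F` depends. -/
def depSet (F : SuperFn) : Finset Coord := (finite_partialDer_ne_zero F).toFinset

theorem partialDer_eq_zero_of_notMem {F : SuperFn} {c : Coord} (h : c ∉ depSet F) :
    partialDer c F = 0 := by
  simpa [depSet] using h

@[simp] theorem vectorField_gen (a : Coord → SuperFn) (c : Coord) :
    vectorField a (gen c) = a c := by
  classical
  rw [vectorField_eq_sum a (s := {c})]
  · simp [partialDer_gen]
  · intro d hd
    rw [partialDer_gen, if_neg]
    simpa [eq_comm] using hd

/-- A linear operator that is a vector field of parity `e`. -/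
structure IsVectorField (e : Bool) (V : Module.End ℝ SuperFn) : Prop where
  eq_vectorField : V = vectorField fun c => V (gen c)
  parity : ∀ c, HasParity (e ^^ Coord.odd c) (V (gen c))

theorem isVectorField_vectorField {e : Bool} {a : Coord → SuperFn}
    (ha : ∀ c, HasParity (e ^^ Coord.odd c) (a c)) : IsVectorField e (vectorField a) := by
  constructor
  · simp
  · simpa using ha

theorem partialDer_eq_vectorField (c : Coord) [DecidableEq Coord] :
    partialDer c = vectorField (Pi.single c 1) := by
  classical
  refine LinearMap.ext fun F => ?_
  rw [vectorField_eq_sum (Pi.single c 1) (s := insert c (depSet F))]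
  · rw [Finset.sum_eq_single c]
    · simp
    · intro d _ hd
      simp [Pi.single_eq_of_ne hd]
    · simp
  · intro d hd
    exact partialDer_eq_zero_of_notMem fun h => hd (Finset.mem_insert_of_mem h)

theorem isVectorField_partialDer (c : Coord) : IsVectorField (Coord.odd c) (partialDer c) := by
  classical
  constructor
  · rw [partialDer_eq_vectorField c]
    simp
  · intro d
    rw [partialDer_gen]
    split_ifs with h
    · subst h
      simpa using HasParity.one
    · exact HasParity.zero _

theorem parityPow_parityPow (e f : Bool) (F : SuperFn) :
    parityPow e (parityPow f F) = parityPow (e ^^ f) F := by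
  cases e <;> cases f <;> simp [parityPow]

theorem HasParity.supercomm
    {e f : Bool} {F G : SuperFn} (hF : HasParity e F) (hG : HasParity f G) :
    F * G = koszul e f • (G * F) := by
  rw [hF.mul_comm G, hG.parityPow_eq, smul_mul_assoc]
  cases e <;> cases f <;> rfl

namespace IsVectorField

variable {e f : Bool} {V W : Module.End ℝ SuperFn}

theorem apply_eq_sum (hV : IsVectorField e V) {F : SuperFn} {s : Finset Coord}
    (h : ∀ c, c ∉ s → partialDer c F = 0) : V F = ∑ c ∈ s, V (gen c) * partialDer c F := by
  conv_lhs => rw [hV.eq_vectorField]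
  exact vectorField_eq_sum _ h

theorem map_one (hV : IsVectorField e V) : V 1 = 0 := by
  rw [hV.apply_eq_sum (s := ∅) (by simp)]
  simp

theorem leibniz (hV : IsVectorField e V) (F G : SuperFn) :
    V (F * G) = V F * G + parityPow e F * V G := by
  classical
  set s := depSet F ∪ depSet G ∪ depSet (F * G) with hs
  have h1 : ∀ c, c ∉ s → partialDer c F = 0 := fun c hc =>
    partialDer_eq_zero_of_notMem fun h => hc (by simp [hs, h])
  have h2 : ∀ c, c ∉ s → partialDer c G = 0 := fun c hc =>
    partialDer_eq_zero_of_notMem fun h => hc (by simp [hs, h])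
  have h3 : ∀ c, c ∉ s → partialDer c (F * G) = 0 := fun c hc =>
    partialDer_eq_zero_of_notMem fun h => hc (by simp [hs, h])
  rw [hV.apply_eq_sum h1, hV.apply_eq_sum h2, hV.apply_eq_sum h3, Finset.sum_mul, Finset.mul_sum,
    ← Finset.sum_add_distrib]
  refine Finset.sum_congr rfl fun c _ => ?_
  -- The coefficient at c has parity `e + |c|`. Moving it past the `|c|`-fold parity twist of F
  -- leaves the e-fold twist, for every c alike.
  rw [partialDer_mul, mul_add, ← mul_assoc, ← mul_assoc, (hV.parity c).mul_comm (parityPow _ F),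
    parityPow_parityPow, mul_assoc]
  simp [mul_assoc]

theorem hasParity_apply (hV : IsVectorField e V) {F : SuperFn} (hF : HasParity f F) :
    HasParity (e ^^ f) (V F) := by
  rw [hV.apply_eq_sum (s := depSet F) fun c => partialDer_eq_zero_of_notMem]
  refine HasParity.sum _ _ fun c _ => ?_
  convert (hV.parity c).mul (hF.partialDer c) using 1
  cases e <;> cases f <;> cases Coord.odd c <;> rfl

/-- The supercommutator of two vector fields is a vector field. -/
theorem commutator (hV : IsVectorField e V) (hW : IsVectorField f W) :
    IsVectorField (e ^^ f) (V * W - koszul e f • (W * V)) := by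
  constructor
  · refine LinearMap.ext fun F => ?_
    set s := depSet F with hs
    have h1 : ∀ c, c ∉ s → partialDer c F = 0 := fun c => partialDer_eq_zero_of_notMem
    -- A derivative of F depends on no coordinates beyond those of F, so the inner sums also run
    -- over s.
    have h2 : ∀ d c, c ∉ s → partialDer c (partialDer d F) = 0 := fun d c hc => by
      rw [partialDer_comm, h1 c hc, map_zero, smul_zero]
    -- The composite of two fields splits into a first-order part, with coefficients `V (W (gen
    -- c))`, and a second-order part.
    have key : ∀ {e f : Bool} {V W : Module.End ℝ SuperFn}, IsVectorField e V →
        IsVectorField f W → V (W F) = ∑ c ∈ s, V (W (gen c)) * partialDer c F +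
          ∑ c ∈ s, ∑ d ∈ s, koszul (f ^^ Coord.odd c) e •
            (W (gen c) * V (gen d) * partialDer d (partialDer c F)) := by
      intro e f V W hV hW
      rw [hW.apply_eq_sum h1, map_sum, ← Finset.sum_add_distrib]
      refine Finset.sum_congr rfl fun c _ => ?_
      rw [hV.leibniz, hV.apply_eq_sum (h2 c), Finset.mul_sum, (hW.parity c).parityPow_eq]
      simp only [smul_mul_assoc, mul_assoc]
    rw [vectorField_eq_sum _ h1]
    simp only [LinearMap.sub_apply, LinearMap.smul_apply, Module.End.mul_apply]
    rw [key hV hW, key hW hV, smul_add, add_sub_add_comm, Finset.smul_sum]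
    -- The second-order parts of VW and of WV agree up to the Koszul sign: exchange the names c and
    -- d, then supercommute both the coefficients and the partial derivatives.
    have hz : ∑ c ∈ s, ∑ d ∈ s, koszul (f ^^ Coord.odd c) e •
            (W (gen c) * V (gen d) * partialDer d (partialDer c F)) =
        koszul e f • ∑ c ∈ s, ∑ d ∈ s, koszul (e ^^ Coord.odd c) f •
            (V (gen c) * W (gen d) * partialDer d (partialDer c F)) := by
      rw [Finset.sum_comm, Finset.smul_sum]
      refine Finset.sum_congr rfl fun d _ => ?_
      rw [Finset.smul_sum]
      refine Finset.sum_congr rfl fun c _ => ?_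
      rw [partialDer_comm c d F, (hV.parity d).supercomm (hW.parity c)]
      simp only [mul_smul_comm, smul_mul_assoc, smul_smul]
      congr 1
      cases e <;> cases f <;> cases Coord.odd c <;> cases Coord.odd d <;> simp [koszul]
    rw [hz, sub_self, add_zero, ← Finset.sum_sub_distrib]
    refine Finset.sum_congr rfl fun c _ => ?_
    rw [sub_mul, smul_mul_assoc]
  · intro c
    simp only [LinearMap.sub_apply, LinearMap.smul_apply, Module.End.mul_apply]
    have h1 := hV.hasParity_apply (hW.parity c)
    have h2 := (hW.hasParity_apply (hV.parity c)).smul (koszul e f)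
    have e1 : (e ^^ (f ^^ Coord.odd c)) = (e ^^ f ^^ Coord.odd c) := by simp
    have e2 : (f ^^ (e ^^ Coord.odd c)) = (e ^^ f ^^ Coord.odd c) := by
      cases e <;> cases f <;> cases Coord.odd c <;> rfl
    rw [e1] at h1
    rw [e2] at h2
    exact h1.sub h2

/-- Vector fields supercommute if they do so on the coordinates. -/
theorem commute_of_gen (hV : IsVectorField e V) (hW : IsVectorField f W)
    (h : ∀ c, V (W (gen c)) = koszul e f • W (V (gen c))) : V * W = koszul e f • (W * V) := by
  refine sub_eq_zero.1 ?_
  rw [(hV.commutator hW).eq_vectorField]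
  refine LinearMap.ext fun F => ?_
  rw [vectorField_apply]
  simp [h]

/-- The action of a partial derivative on the derivative along a vector field. -/
theorem partialDer_apply (hV : IsVectorField e V) (c : Coord) (F : SuperFn) :
    partialDer c (V F) = koszul (Coord.odd c) e • V (partialDer c F) +
      vectorField (fun d => partialDer c (V (gen d))) F := by
  have h := congrArg (fun T : Module.End ℝ SuperFn => T F)
    ((isVectorField_partialDer c).commutator hV).eq_vectorField
  simp only [LinearMap.sub_apply, LinearMap.smul_apply, Module.End.mul_apply] at h
  rw [← sub_eq_iff_eq_add', h]
  congr 2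
  ext1 d
  -- The derivative of a coordinate is 0 or 1 and is killed by V, so on coordinates the commutator
  -- is just `partialDer c (V (gen d))`.
  rw [partialDer_gen]
  split_ifs <;> simp [hV.map_one]

end IsVectorField

/-! ### A normal form for polynomials in the coordinates -/

/-- Polynomial expressions in the coordinates, with dyadic rational coefficients. -/
inductive Expr : Type
  /-- The constant `n / 2 ^ e`. -/
  | const (n : ℤ) (e : ℕ) : Expr
  | gen (c : Coord) : Expr
  | add (a b : Expr) : Expr
  | mul (a b : Expr) : Expr
  | neg (a : Expr) : Expr

namespace Expr

instance : Add Expr := ⟨add⟩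
instance : Mul Expr := ⟨mul⟩
instance : Neg Expr := ⟨neg⟩
instance : Sub Expr := ⟨fun a b => add a (neg b)⟩
instance (n : ℕ) : OfNat Expr n := ⟨const n 0⟩

/-- The function on `W` given by an expression. -/
def eval : Expr → SuperFn
  | const n e => ((n : ℝ) / 2 ^ e) • 1
  | gen c => PavlovMikhalev.gen c
  | add a b => eval a + eval b
  | mul a b => eval a * eval b
  | neg a => -eval a

@[simp] theorem eval_add (a b : Expr) : (a + b).eval = a.eval + b.eval := rfl
@[simp] theorem eval_mul (a b : Expr) : (a * b).eval = a.eval * b.eval := rfl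
@[simp] theorem eval_neg (a : Expr) : (-a).eval = -a.eval := rfl
@[simp] theorem eval_sub (a b : Expr) : (a - b).eval = a.eval - b.eval :=
  (sub_eq_add_neg _ _).symm
theorem eval_const (n : ℤ) (e : ℕ) : (const n e).eval = ((n : ℝ) / 2 ^ e) • 1 := rfl
@[simp] theorem eval_gen (c : Coord) : (gen c).eval = PavlovMikhalev.gen c := rfl
theorem eval_ofNat (n : ℕ) [n.AtLeastTwo] :
    (const n 0).eval = (OfNat.ofNat n : SuperFn) := by
  rw [eval_const, pow_zero, div_one, Int.cast_natCast, Nat.cast_smul_eq_nsmul, nsmul_one]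
  rfl
@[simp] theorem eval_two : (2 : Expr).eval = 2 := eval_ofNat 2
@[simp] theorem eval_three : (3 : Expr).eval = 3 := eval_ofNat 3
@[simp] theorem eval_zero : (0 : Expr).eval = 0 := by
  change (((0 : ℕ) : ℤ) / 2 ^ 0 : ℝ) • (1 : SuperFn) = 0
  simp

/-! #### Monomials -/

/-- An injective numbering of the even coordinates. -/
def evenCode : EvenCoord → ℕ
  | .x => 0
  | .y => 5
  | .t => 10
  | .u k l => 5 * Nat.pair k l + 1
  | .uy k l => 5 * Nat.pair k l + 2
  | .v k l => 5 * Nat.pair k l + 3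
  | .vy k l => 5 * Nat.pair k l + 4

/-- An injective numbering of the odd coordinates. -/
def oddCode : OddCoord → ℕ
  | .p k l => 8 * Nat.pair k l
  | .py k l => 8 * Nat.pair k l + 1
  | .q k l => 8 * Nat.pair k l + 2
  | .qy k l => 8 * Nat.pair k l + 3
  | .w1 l => 8 * l + 4
  | .w2 l => 8 * l + 5
  | .w3 l => 8 * l + 6
  | .w4 l => 8 * l + 7

/-- The residue modulo 5 separates the four dependent families from one another and from x, y, t,
which share residue 0; within a family the pairing function is injective. For `oddCode` the modulus
is 8. -/
theorem evenCode_injective : Function.Injective evenCode := by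
  intro a b h
  cases a <;> cases b <;> simp only [evenCode] at h <;>
    first
    | rfl
    | (exfalso; omega)
    | simp_all [Nat.pair_eq_pair]

theorem oddCode_injective : Function.Injective oddCode := by
  intro a b h
  cases a <;> cases b <;> simp only [oddCode] at h <;>
    first
    | rfl
    | (exfalso; omega)
    | (congr 1; omega)
    | simp_all [Nat.pair_eq_pair]

instance : Nonempty EvenCoord := ⟨.x⟩
instance : Nonempty OddCoord := ⟨.w1 0⟩

/-- The even coordinate with a given number. -/
def evenAtom (n : ℕ) : SuperFn := evenGen (Function.invFun evenCode n)

/-- The odd coordinate with a given number. -/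
def oddAtom (n : ℕ) : SuperFn := oddGen (Function.invFun oddCode n)

theorem evenAtom_evenCode (c : EvenCoord) : evenAtom (evenCode c) = evenGen c := by
  rw [evenAtom, Function.leftInverse_invFun evenCode_injective]

theorem oddAtom_oddCode (c : OddCoord) : oddAtom (oddCode c) = oddGen c := by
  rw [oddAtom, Function.leftInverse_invFun oddCode_injective]

/-- A product of even coordinates. -/
def evenMon (l : List ℕ) : SuperFn := (l.map evenAtom).prod

/-- A product of odd coordinates. -/
def oddMon (l : List ℕ) : SuperFn := (l.map oddAtom).prod

@[simp] theorem evenMon_nil : evenMon [] = 1 := rfl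
@[simp] theorem oddMon_nil : oddMon [] = 1 := rfl
@[simp] theorem evenMon_cons (a : ℕ) (l : List ℕ) :
    evenMon (a :: l) = evenAtom a * evenMon l := by simp [evenMon]
@[simp] theorem oddMon_cons (a : ℕ) (l : List ℕ) :
    oddMon (a :: l) = oddAtom a * oddMon l := by simp [oddMon]

theorem evenAtom_mul_comm (a : ℕ) (F : SuperFn) : evenAtom a * F = F * evenAtom a :=
  (hasParity_evenGen _).mul_comm F

theorem evenMon_mul_comm (l : List ℕ) (F : SuperFn) : evenMon l * F = F * evenMon l := by
  induction l with
  | nil => simp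
  | cons a l ih => rw [evenMon_cons, mul_assoc, ih, ← mul_assoc, evenAtom_mul_comm, mul_assoc]

theorem oddAtom_mul_oddAtom (a b : ℕ) : oddAtom a * oddAtom b = -(oddAtom b * oddAtom a) := by
  have h : oddAtom a * oddAtom b = _ • (oddAtom b * oddAtom a) :=
    (hasParity_oddGen _).supercomm (hasParity_oddGen _)
  simpa only [koszul, Bool.and_self, if_true, neg_smul, one_smul] using h

theorem oddAtom_mul_self (a : ℕ) : oddAtom a * oddAtom a = 0 := by
  have h : (2 : ℝ) • (oddAtom a * oddAtom a) = 0 := by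
    rw [two_smul]
    exact add_eq_zero_iff_eq_neg.2 (oddAtom_mul_oddAtom a a)
  exact (smul_eq_zero.1 h).resolve_left two_ne_zero

/-- Insertion into a sorted list. -/
def insertEven (a : ℕ) : List ℕ → List ℕ
  | [] => [a]
  | b :: l => match Nat.ble a b with
    | true => a :: b :: l
    | false => b :: insertEven a l

/-- The product of two even monomials. -/
def mulEven (l m : List ℕ) : List ℕ := l.foldr insertEven m

/-- Insertion into a strictly sorted list, with the sign of the permutation. -/
def insertOdd (a : ℕ) : List ℕ → Option (Bool × List ℕ)
  | [] => some (false, [a])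
  | b :: l => match Nat.ble a b with
    | true => match Nat.beq a b with
      | true => none
      | false => some (false, a :: b :: l)
    | false => match insertOdd a l with
      | none => none
      | some (s, m) => some (!s, b :: m)

/-- The product of two odd monomials, with sign. -/
def mulOdd : List ℕ → List ℕ → Option (Bool × List ℕ)
  | [], m => some (false, m)
  | a :: l, m => match mulOdd l m with
    | none => none
    | some (s, m') => match insertOdd a m' with
      | none => none
      | some (s', m'') => some (s ^^ s', m'')

/-- The value of a signed odd monomial. -/
def signedOddMon : Option (Bool × List ℕ) → SuperFn
  | none => 0
  | some (true, m) => -oddMon m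
  | some (false, m) => oddMon m

theorem evenMon_insertEven (a : ℕ) (l : List ℕ) :
    evenMon (insertEven a l) = evenAtom a * evenMon l := by
  induction l with
  | nil => simp [insertEven]
  | cons b l ih =>
    unfold insertEven
    split
    · simp
    · rw [evenMon_cons, ih, evenMon_cons, ← mul_assoc, ← mul_assoc, evenAtom_mul_comm b]

theorem evenMon_mulEven (l m : List ℕ) : evenMon (mulEven l m) = evenMon l * evenMon m := by
  induction l with
  | nil => simp [mulEven]
  | cons a l ih =>
    change evenMon (insertEven a (mulEven l m)) = _
    rw [evenMon_insertEven, ih, evenMon_cons, mul_assoc]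

/-- Each entry that a is moved past contributes one sign, and meeting a itself gives the square of
an odd coordinate, which is zero. -/
theorem signedOddMon_insertOdd (a : ℕ) (l : List ℕ) :
    signedOddMon (insertOdd a l) = oddAtom a * oddMon l := by
  induction l with
  | nil => simp [insertOdd, signedOddMon]
  | cons b l ih =>
    unfold insertOdd
    split
    · split
      · rename_i h
        obtain rfl := Nat.eq_of_beq_eq_true h
        rw [oddMon_cons, ← mul_assoc, oddAtom_mul_self, zero_mul]; rfl
      · simp [signedOddMon]
    · rw [oddMon_cons, ← mul_assoc, oddAtom_mul_oddAtom, neg_mul, mul_assoc, ← ih]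
      rcases insertOdd a l with _ | ⟨s, m⟩
      · simp [signedOddMon]
      · cases s <;> simp [signedOddMon]

theorem signedOddMon_mulOdd (l m : List ℕ) :
    signedOddMon (mulOdd l m) = oddMon l * oddMon m := by
  induction l with
  | nil => simp [mulOdd, signedOddMon]
  | cons a l ih =>
    unfold mulOdd
    rw [oddMon_cons, mul_assoc, ← ih]
    rcases mulOdd l m with _ | ⟨s, m'⟩
    · simp [signedOddMon]
    · have h := signedOddMon_insertOdd a m'
      dsimp only
      rcases h' : insertOdd a m' with _ | ⟨s', m''⟩
      · rw [h'] at h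
        cases s <;> simp [signedOddMon, ← h]
      · rw [h'] at h
        cases s <;> cases s' <;> simp [signedOddMon, ← h]

/-! #### Terms and sums of terms -/

/-- A monomial with the coefficient `num / 2 ^ exp`. -/
structure Term where
  odd : List ℕ
  even : List ℕ
  num : ℤ
  exp : ℕ

/-- The value of a term. -/
def Term.eval (t : Term) : SuperFn :=
  ((t.num : ℝ) / 2 ^ t.exp) • (evenMon t.even * oddMon t.odd)

/-- The value of a sum of terms. -/
def evalTerms (l : List Term) : SuperFn := (l.map Term.eval).sum

@[simp] theorem evalTerms_nil : evalTerms [] = 0 := rfl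
@[simp] theorem evalTerms_cons (t : Term) (l : List Term) :
    evalTerms (t :: l) = t.eval + evalTerms l := by simp [evalTerms]
@[simp] theorem evalTerms_append (l m : List Term) :
    evalTerms (l ++ m) = evalTerms l + evalTerms m := by simp [evalTerms]

/-- The product of a term with each term of a list. -/
def mulTerm (t : Term) : List Term → List Term
  | [] => []
  | s :: l => match mulOdd t.odd s.odd with
    | none => mulTerm t l
    | some (true, m) =>
      ⟨m, mulEven t.even s.even, -(t.num * s.num), t.exp + s.exp⟩ :: mulTerm t l
    | some (false, m) =>
      ⟨m, mulEven t.even s.even, t.num * s.num, t.exp + s.exp⟩ :: mulTerm t l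

theorem evalTerms_mulTerm (t : Term) (l : List Term) :
    evalTerms (mulTerm t l) = t.eval * evalTerms l := by
  induction l with
  | nil => simp [mulTerm]
  | cons s l ih =>
    have h : t.eval * s.eval = ((t.num * s.num : ℝ) / 2 ^ (t.exp + s.exp)) •
        (evenMon (mulEven t.even s.even) * signedOddMon (mulOdd t.odd s.odd)) := by
      rw [Term.eval, Term.eval, smul_mul_smul_comm, div_mul_div_comm, pow_add, evenMon_mulEven,
        signedOddMon_mulOdd]
      congr 1
      rw [mul_assoc, mul_assoc, ← mul_assoc (oddMon t.odd), ← evenMon_mul_comm, mul_assoc]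
    rw [evalTerms_cons, mul_add, h, ← ih, mulTerm]
    rcases mulOdd t.odd s.odd with _ | ⟨s', m⟩
    · simp [signedOddMon]
    · cases s' <;> simp [signedOddMon, Term.eval, neg_div]

/-- The product of two sums of terms. -/
def mulTerms : List Term → List Term → List Term
  | [], _ => []
  | t :: l, m => mulTerm t m ++ mulTerms l m

theorem evalTerms_mulTerms (l m : List Term) :
    evalTerms (mulTerms l m) = evalTerms l * evalTerms m := by
  induction l with
  | nil => simp [mulTerms]
  | cons t l ih => rw [mulTerms, evalTerms_append, evalTerms_mulTerm, ih, evalTerms_cons, add_mul]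

/-- Change of sign of all terms. -/
def negTerms : List Term → List Term
  | [] => []
  | t :: l => ⟨t.odd, t.even, -t.num, t.exp⟩ :: negTerms l

theorem evalTerms_negTerms (l : List Term) : evalTerms (negTerms l) = -evalTerms l := by
  induction l with
  | nil => simp [negTerms]
  | cons t l ih =>
    rw [negTerms, evalTerms_cons, ih, evalTerms_cons, neg_add]
    simp [Term.eval, neg_div]

/-- The terms of a constant. -/
def constTerms (n : ℤ) (e : ℕ) : List Term :=
  match n with
  | Int.ofNat 0 => []
  | n => [⟨[], [], n, e⟩]

/-- The terms of an expression, before collection. -/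
def terms : Expr → List Term
  | const n e => constTerms n e
  | gen (Sum.inl c) => [⟨[], [evenCode c], 1, 0⟩]
  | gen (Sum.inr c) => [⟨[oddCode c], [], 1, 0⟩]
  | add a b => terms a ++ terms b
  | mul a b => mulTerms (terms a) (terms b)
  | neg a => negTerms (terms a)

theorem evalTerms_terms (a : Expr) : evalTerms (terms a) = a.eval := by
  induction a with
  | const n e =>
    rw [terms]
    unfold constTerms
    split
    · simp [eval]
    · simp [eval, Term.eval]
  | gen c =>
    rcases c with c | c
    · simp [terms, Term.eval, evenAtom_evenCode, eval, PavlovMikhalev.gen]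
    · simp [terms, Term.eval, oddAtom_oddCode, eval, PavlovMikhalev.gen]
  | add a b ha hb => rw [terms, evalTerms_append, ha, hb, eval]
  | mul a b ha hb => rw [terms, evalTerms_mulTerms, ha, hb, eval]
  | neg a ha => rw [terms, evalTerms_negTerms, ha, eval]

/-- Lexicographic comparison. -/
def compareList : List ℕ → List ℕ → Ordering
  | [], [] => .eq
  | [], _ :: _ => .lt
  | _ :: _, [] => .gt
  | a :: l, b :: m => match Nat.beq a b with
    | true => compareList l m
    | false => match Nat.ble a b with
      | true => .lt
      | false => .gt

theorem eq_of_compareList {l m : List ℕ} (h : compareList l m = .eq) : l = m := by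
  induction l generalizing m with
  | nil => cases m with
    | nil => rfl
    | cons b m => simp [compareList] at h
  | cons a l ih => cases m with
    | nil => simp [compareList] at h
    | cons b m =>
      unfold compareList at h
      split at h
      · rename_i hab
        rw [Nat.eq_of_beq_eq_true hab, ih h]
      · split at h <;> simp at h

/-- Comparison of monomials. -/
def compareTerm (t s : Term) : Ordering :=
  match compareList t.odd s.odd with
  | .lt => .lt
  | .gt => .gt
  | .eq => compareList t.even s.even

/-- Addition of a term, with a monomial equal to that of `t`, in front of a list. -/
def addTerm (t s : Term) (l : List Term) : List Term :=
  match t.num * (2 ^ (s.exp - t.exp) : ℕ) + s.num * (2 ^ (t.exp - s.exp) : ℕ) with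
  | Int.ofNat 0 => l
  | n => ⟨t.odd, t.even, n, max t.exp s.exp⟩ :: l

theorem evalTerms_addTerm {t s : Term} (h : compareTerm t s = .eq) (l : List Term) :
    evalTerms (addTerm t s l) = t.eval + s.eval + evalTerms l := by
  have hts : t.odd = s.odd ∧ t.even = s.even := by
    unfold compareTerm at h
    split at h
    · simp at h
    · simp at h
    · rename_i h'
      exact ⟨eq_of_compareList h', eq_of_compareList h⟩
  -- The common denominator is 2 to the larger exponent. Because subtraction of naturals is
  -- truncated, the numerator belonging to that exponent is multiplied by 2^0.
  have key : t.eval + s.eval =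
      (((t.num * (2 ^ (s.exp - t.exp) : ℕ) + s.num * (2 ^ (t.exp - s.exp) : ℕ) : ℤ) : ℝ) /
        2 ^ max t.exp s.exp) • (evenMon t.even * oddMon t.odd) := by
    rw [Term.eval, Term.eval, ← hts.1, ← hts.2, ← add_smul]
    congr 1
    rcases le_total t.exp s.exp with hle | hle
    · obtain ⟨d, hd⟩ := Nat.exists_eq_add_of_le hle
      rw [max_eq_right hle, hd]
      simp only [Nat.add_sub_cancel_left, Nat.sub_eq_zero_of_le (Nat.le_add_right t.exp d)]
      push_cast
      rw [mul_one, pow_add, ← mul_div_mul_right (t.num : ℝ) _ (pow_ne_zero d two_ne_zero),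
        ← add_div]
    · obtain ⟨d, hd⟩ := Nat.exists_eq_add_of_le hle
      rw [max_eq_left hle, hd]
      simp only [Nat.add_sub_cancel_left, Nat.sub_eq_zero_of_le (Nat.le_add_right s.exp d)]
      push_cast
      rw [mul_one, pow_add, ← mul_div_mul_right (s.num : ℝ) _ (pow_ne_zero d two_ne_zero),
        ← add_div]
  rw [key]
  unfold addTerm
  split
  · rename_i h0
    rw [h0]
    simp
  · rw [evalTerms_cons, Term.eval]

/-- Merges `t :: p` with a sorted list, given the operation `f` of merging with `p`. -/
def mergeAux (t : Term) (p : List Term) (f : List Term → List Term) : List Term → List Term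
  | [] => t :: p
  | s :: q => match compareTerm t s with
    | .lt => t :: f (s :: q)
    | .eq => addTerm t s (f q)
    | .gt => s :: mergeAux t p f q

/-- Merges two sorted lists of terms, adding terms with equal monomials. -/
def merge : List Term → List Term → List Term
  | [], q => q
  | t :: p, q => mergeAux t p (merge p) q

/-- The nested induction follows the recursion: `merge` descends in the first list and `mergeAux` in
the second. Sortedness plays no role here; it only affects how many terms get collected. -/
theorem evalTerms_merge (p q : List Term) :
    evalTerms (merge p q) = evalTerms p + evalTerms q := by
  induction p generalizing q with
  | nil => simp [merge]
  | cons t p ih =>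
    rw [merge]
    induction q with
    | nil => simp [mergeAux]
    | cons s q ihq =>
      unfold mergeAux
      split
      · rw [evalTerms_cons, ih, evalTerms_cons, evalTerms_cons]; abel
      · rename_i h
        rw [evalTerms_addTerm h, ih, evalTerms_cons, evalTerms_cons]; abel
      · rw [evalTerms_cons, ihq, evalTerms_cons, evalTerms_cons]; abel

/-- Merges neighbouring lists. -/
def mergePairs : List (List Term) → List (List Term)
  | p :: q :: l => merge p q :: mergePairs l
  | l => l

/-- The value of a sum of sums of terms. -/
def evalLists (l : List (List Term)) : SuperFn := (l.map evalTerms).sum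

theorem evalLists_mergePairs (l : List (List Term)) : evalLists (mergePairs l) = evalLists l := by
  induction l using mergePairs.induct with
  | case1 p q l ih =>
    rw [mergePairs]
    simp only [evalLists, List.map_cons, List.sum_cons, evalTerms_merge] at *
    rw [ih]
    abel
  | case2 l h => rw [mergePairs]; exact h

/-- Merges all lists, in at most `n` rounds of `mergePairs`. -/
def mergeAll : ℕ → List (List Term) → List (List Term)
  | 0, l => l
  | n + 1, l => match l with
    | [] => []
    | [p] => [p]
    | l => mergeAll n (mergePairs l)

theorem evalLists_mergeAll (n : ℕ) (l : List (List Term)) :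
    evalLists (mergeAll n l) = evalLists l := by
  induction n generalizing l with
  | zero => rfl
  | succ n ih =>
    unfold mergeAll
    split
    · rfl
    · rfl
    · rw [ih, evalLists_mergePairs]

/-- The lists of single terms. -/
def singletons : List Term → List (List Term)
  | [] => []
  | t :: l => [t] :: singletons l

theorem evalLists_singletons (l : List Term) : evalLists (singletons l) = evalTerms l := by
  induction l with
  | nil => rfl
  | cons t l ih =>
    simp only [evalLists, singletons, List.map_cons, List.sum_cons, evalTerms_cons,
      evalTerms_nil, add_zero] at *
    rw [ih]

/-- Whether the normal form of the expression is zero. -/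
def isZero (a : Expr) : Bool :=
  match mergeAll 32 (singletons (terms a)) with
  | [] => true
  | [[]] => true
  | _ => false

/-- Only soundness is needed: every stage preserves the value, whether or not it reaches a true
normal form. Each round of `mergePairs` about halves the number of lists. If 32 rounds were too few,
or some terms stayed uncollected, the test would fail rather than accept wrongly. -/
theorem eval_eq_zero {a : Expr} (h : isZero a = true) : a.eval = 0 := by
  rw [← evalTerms_terms, ← evalLists_singletons, ← evalLists_mergeAll 32]
  unfold isZero at h
  split at h
  · rename_i h'; rw [h']; rfl
  · rename_i h'; rw [h']; simp [evalLists]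
  · simp at h

theorem eval_congr {a b : Expr} (h : isZero (a - b) = true) : a.eval = b.eval := by
  have := eval_eq_zero h
  rwa [eval_sub, sub_eq_zero] at this

/-! #### Derivations of expressions -/

/-- The parity automorphism on expressions. -/
def parity : Expr → Expr
  | const n e => const n e
  | gen (Sum.inl c) => gen (Sum.inl c)
  | gen (Sum.inr c) => neg (gen (Sum.inr c))
  | add a b => add (parity a) (parity b)
  | mul a b => mul (parity a) (parity b)
  | neg a => neg (parity a)

theorem eval_parity (a : Expr) : (parity a).eval = parityAut a.eval := by
  induction a with
  | const n e => simp [parity, eval]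
  | gen c =>
    rcases c with c | c
    · exact (hasParity_evenGen c).symm
    · exact (hasParity_oddGen c).symm
  | add a b ha hb => rw [parity, eval, ha, hb, eval, map_add]
  | mul a b ha hb => rw [parity, eval, ha, hb, eval, map_mul]
  | neg a ha => rw [parity, eval, ha, eval, map_neg]

/-- The power of the parity automorphism with exponent `0` or `1`. -/
def parityIf : Bool → Expr → Expr
  | true, a => parity a
  | false, a => a

/-- The derivation of parity `e` with given values on the coordinates. -/
def der (e : Bool) (v : Coord → Expr) : Expr → Expr
  | const _ _ => const 0 0
  | gen c => v c
  | add a b => add (der e v a) (der e v b)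
  | mul a b => add (mul (der e v a) b) (mul (parityIf e a) (der e v b))
  | neg a => neg (der e v a)

/-- By the Leibniz rule a vector field obeys the recursion that defines `der`, so agreement on
coordinates suffices. This carries total derivatives and evolutionary fields over to expressions,
where they can be computed. -/
theorem eval_der {e : Bool} {V : Module.End ℝ SuperFn} (hV : IsVectorField e V)
    {v : Coord → Expr} (hv : ∀ c, (v c).eval = V (PavlovMikhalev.gen c)) (a : Expr) :
    (der e v a).eval = V a.eval := by
  induction a with
  | const n e => simp [der, eval, hV.map_one]
  | gen c => exact hv c
  | add a b ha hb => rw [der, eval, ha, hb, eval, map_add]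
  | mul a b ha hb =>
    rw [der, eval, eval, eval, ha, hb, eval, hV.leibniz]
    cases e
    · rfl
    · simp only [parityIf, eval_parity, parityPow, if_true]
  | neg a ha => rw [der, eval, ha, eval, map_neg]

theorem eval_iterate {V : Module.End ℝ SuperFn} {d : Expr → Expr}
    (hd : ∀ a, (d a).eval = V a.eval) (n : ℕ) (a : Expr) :
    (d^[n] a).eval = (V ^ n) a.eval := by
  induction n with
  | zero => rfl
  | succ n ih => rw [Function.iterate_succ_apply', hd, ih, pow_succ', Module.End.mul_apply]

end Expr

/-! ### Homogeneous functions -/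

theorem smul_one_mem_homogeneous (r : ℝ) : r • (1 : SuperFn) ∈ homogeneous 0 := by
  refine Submodule.smul_mem _ _ (Submodule.subset_span ⟨1, 1, ?_, rfl⟩)
  exact Submodule.one_le.1 (pow_zero (LinearMap.range (ExteriorAlgebra.ι ℝ))).ge

theorem evenGen_mem_homogeneous (c : EvenCoord) : evenGen c ∈ homogeneous 0 := by
  refine Submodule.subset_span ⟨coordFn c, 1, ?_, rfl⟩
  exact Submodule.one_le.1 (pow_zero (LinearMap.range (ExteriorAlgebra.ι ℝ))).ge

theorem oddGen_mem_homogeneous (c : OddCoord) : oddGen c ∈ homogeneous 1 := by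
  refine Submodule.subset_span ⟨1, _, ?_, rfl⟩
  exact (pow_one (LinearMap.range (ExteriorAlgebra.ι ℝ))).ge (LinearMap.mem_range_self _ _)

theorem mul_mem_homogeneous {m n : ℕ} {F G : SuperFn} (hF : F ∈ homogeneous m)
    (hG : G ∈ homogeneous n) : F * G ∈ homogeneous (m + n) := by
  induction hF using Submodule.span_induction with
  | zero => simp
  | add F F' _ _ h h' => rw [add_mul]; exact add_mem h h'
  | smul r F _ h => rw [smul_mul_assoc]; exact Submodule.smul_mem _ _ h
  | mem F hF =>
    obtain ⟨f, a, ha, rfl⟩ := hF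
    induction hG using Submodule.span_induction with
    | zero => simp
    | add G G' _ _ h h' => rw [mul_add]; exact add_mem h h'
    | smul r G _ h => rw [mul_smul_comm]; exact Submodule.smul_mem _ _ h
    | mem G hG =>
      obtain ⟨g, b, hb, rfl⟩ := hG
      refine Submodule.subset_span ⟨f * g, a * b, ?_, Algebra.TensorProduct.tmul_mul_tmul ..⟩
      exact (pow_add (LinearMap.range (ExteriorAlgebra.ι ℝ)) m n).ge
        (Submodule.mul_mem_mul ha hb)

/-- Whether an expression is homogeneous of degree `n` in the odd coordinates. -/
def Expr.hasDegree : ℕ → Expr → Bool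
  | n, const m _ => n == 0 || m == 0
  | n, gen (Sum.inl _) => n == 0
  | n, gen (Sum.inr _) => n == 1
  | n, add a b => hasDegree n a && hasDegree n b
  | n, mul a b => (List.range (n + 1)).any fun i => hasDegree i a && hasDegree (n - i) b
  | n, neg a => hasDegree n a

/-- The constant 0 counts as homogeneous of every degree; the vanishing components of `cartan` rely
on this. -/
theorem Expr.eval_mem_homogeneous {n : ℕ} {a : Expr} (h : hasDegree n a = true) :
    a.eval ∈ homogeneous n := by
  induction a generalizing n with
  | const m e =>
    simp only [hasDegree, Bool.or_eq_true, beq_iff_eq] at h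
    rcases h with rfl | rfl
    · exact smul_one_mem_homogeneous _
    · rw [eval_const, Int.cast_zero, zero_div, zero_smul]
      exact zero_mem _
  | gen c =>
    rcases c with c | c
    · obtain rfl : n = 0 := by simpa [hasDegree] using h
      exact evenGen_mem_homogeneous c
    · obtain rfl : n = 1 := by simpa [hasDegree] using h
      exact oddGen_mem_homogeneous c
  | add a b ha hb =>
    simp only [hasDegree, Bool.and_eq_true] at h
    exact add_mem (ha h.1) (hb h.2)
  | mul a b ha hb =>
    simp only [hasDegree, List.any_eq_true, List.mem_range, Bool.and_eq_true] at h
    obtain ⟨i, hi, h1, h2⟩ := h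
    have := mul_mem_homogeneous (ha h1) (hb h2)
    rwa [Nat.add_sub_cancel' (Nat.lt_succ_iff.1 hi)] at this
  | neg a ha => exact neg_mem (ha h)

namespace Expr

/-! ### Expressions for the objects on `W` -/

def Y : Expr := gen (.inl .y)
def U (k l : ℕ) : Expr := gen (.inl (.u k l))
def UY (k l : ℕ) : Expr := gen (.inl (.uy k l))
def V (k l : ℕ) : Expr := gen (.inl (.v k l))
def VY (k l : ℕ) : Expr := gen (.inl (.vy k l))
def P (k l : ℕ) : Expr := gen (.inr (.p k l))
def PY (k l : ℕ) : Expr := gen (.inr (.py k l))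
def Q (k l : ℕ) : Expr := gen (.inr (.q k l))
def QY (k l : ℕ) : Expr := gen (.inr (.qy k l))
def W1 (l : ℕ) : Expr := gen (.inr (.w1 l))
def W2 (l : ℕ) : Expr := gen (.inr (.w2 l))
def W3 (l : ℕ) : Expr := gen (.inr (.w3 l))
def W4 (l : ℕ) : Expr := gen (.inr (.w4 l))
def half : Expr := const 1 1

def RhsU : Expr := U 1 1 - U 1 0 * UY 1 0 + UY 0 0 * U 2 0
def RhsV : Expr :=
  V 1 1 - U 1 0 * VY 1 0 - 2 * VY 0 0 * U 2 0 + 2 * V 1 0 * UY 1 0 + UY 0 0 * V 2 0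
def RhsP : Expr :=
  UY 0 0 * P 2 0 - UY 1 0 * P 1 0 - U 1 0 * PY 1 0 + U 2 0 * PY 0 0 + P 1 1
def RhsQ : Expr :=
  2 * V 1 0 * PY 1 0 + V 2 0 * PY 0 0 - VY 1 0 * P 1 0 - 2 * VY 0 0 * P 2 0
    + 2 * UY 1 0 * Q 1 0 + UY 0 0 * Q 2 0 - U 1 0 * QY 1 0 - 2 * U 2 0 * QY 0 0 + Q 1 1

def X1 : Expr := 2 * U 1 0 * P 1 0 + PY 0 0
def Y1 : Expr := UY 0 0 * P 1 0 + U 1 0 * PY 0 0 + P 0 1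
def X2 : Expr := QY 0 0 - V 1 0 * P 1 0 - U 1 0 * Q 1 0
def Y2 : Expr :=
  Q 0 1 - 2 * VY 0 0 * P 1 0 + V 1 0 * PY 0 0 + UY 0 0 * Q 1 0 - 2 * U 1 0 * QY 0 0
def X3 : Expr :=
  (3 * half * (U 1 0 * U 1 0) - Y * U 1 1) * P 1 0 + (Y * U 2 0 + half) * P 0 1
    - UY 1 0 * P 0 0 + U 1 0 * PY 0 0 - half * (Y * PY 0 1)
def Y3 : Expr :=
  (U 1 0 * UY 1 0 - UY 0 0 * U 2 0 - U 1 1) * P 0 0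
    + (U 1 0 * UY 0 0 - half * (Y * UY 0 1)) * P 1 0
    + half * ((U 1 0 * U 1 0 - Y * U 1 1) * PY 0 0)
    + (Y * UY 1 0 + U 1 0) * P 0 1
    - half * (Y * (UY 0 0 * P 1 1 - U 1 0 * PY 0 1 + P 0 2))
def X4 : Expr :=
  Y * (V 2 0 * P 0 1 - V 1 1 * P 1 0 + U 2 0 * Q 0 1 - U 1 1 * Q 1 0 + QY 0 1)
    - VY 1 0 * P 0 0 + V 1 0 * PY 0 0 - UY 1 0 * Q 0 0 + U 1 0 * QY 0 0 - Q 0 1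
def Y4 : Expr :=
  (U 1 0 * VY 1 0 + 2 * VY 0 0 * U 2 0 - 2 * V 1 0 * UY 1 0 - UY 0 0 * V 2 0 - V 1 1) * P 0 0
    + (UY 0 0 * V 1 0 - 2 * U 1 0 * VY 0 0 - 2 * Y * VY 0 1) * P 1 0
    + (U 1 0 * V 1 0 + Y * V 1 1) * PY 0 0
    + (Y * VY 1 0 + V 1 0) * P 0 1
    + (U 1 0 * UY 1 0 - UY 0 0 * U 2 0 - U 1 1) * Q 0 0
    + (U 1 0 * UY 0 0 + Y * UY 0 1) * Q 1 0
    - (U 1 0 * U 1 0 + 2 * Y * U 1 1) * QY 0 0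
    + (Y * UY 1 0 + U 1 0) * Q 0 1
    + Y * (2 * V 1 0 * PY 0 1 - 2 * VY 0 0 * P 1 1 + UY 0 0 * Q 1 1 - U 1 0 * QY 0 1 + Q 0 2)

/-- The values of `D_t` on the coordinates. -/
def tCoef : Coord → Expr
  | .inl .x => 0
  | .inl .y => 0
  | .inl .t => const 1 0
  | .inl (.u k l) => U k (l + 1)
  | .inl (.uy k l) => UY k (l + 1)
  | .inl (.v k l) => V k (l + 1)
  | .inl (.vy k l) => VY k (l + 1)
  | .inr (.p k l) => P k (l + 1)
  | .inr (.py k l) => PY k (l + 1)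
  | .inr (.q k l) => Q k (l + 1)
  | .inr (.qy k l) => QY k (l + 1)
  | .inr (.w1 l) => W1 (l + 1)
  | .inr (.w2 l) => W2 (l + 1)
  | .inr (.w3 l) => W3 (l + 1)
  | .inr (.w4 l) => W4 (l + 1)

/-- The total derivative `D_t` on expressions. -/
def dt : Expr → Expr := der false tCoef

/-- The values of `D_x` on the coordinates. -/
def xCoef : Coord → Expr
  | .inl .x => const 1 0
  | .inl .y => 0
  | .inl .t => 0
  | .inl (.u k l) => U (k + 1) l
  | .inl (.uy k l) => UY (k + 1) l
  | .inl (.v k l) => V (k + 1) l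
  | .inl (.vy k l) => VY (k + 1) l
  | .inr (.p k l) => P (k + 1) l
  | .inr (.py k l) => PY (k + 1) l
  | .inr (.q k l) => Q (k + 1) l
  | .inr (.qy k l) => QY (k + 1) l
  | .inr (.w1 l) => dt^[l] X1
  | .inr (.w2 l) => dt^[l] X2
  | .inr (.w3 l) => dt^[l] X3
  | .inr (.w4 l) => dt^[l] X4

/-- The total derivative `D_x` on expressions. -/
def dx : Expr → Expr := der false xCoef

/-- The values of `D_y` on the coordinates. -/
def yCoef : Coord → Expr
  | .inl .x => 0
  | .inl .y => const 1 0
  | .inl .t => 0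
  | .inl (.u k l) => UY k l
  | .inl (.uy k l) => dx^[k] (dt^[l] RhsU)
  | .inl (.v k l) => VY k l
  | .inl (.vy k l) => dx^[k] (dt^[l] RhsV)
  | .inr (.p k l) => PY k l
  | .inr (.py k l) => dx^[k] (dt^[l] RhsP)
  | .inr (.q k l) => QY k l
  | .inr (.qy k l) => dx^[k] (dt^[l] RhsQ)
  | .inr (.w1 l) => dt^[l] Y1
  | .inr (.w2 l) => dt^[l] Y2
  | .inr (.w3 l) => dt^[l] Y3
  | .inr (.w4 l) => dt^[l] Y4

/-- The total derivative `D_y` on expressions. -/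
def dy : Expr → Expr := der false yCoef

/-- Generating sections given by expressions. -/
structure Section where
  u : Expr
  v : Expr
  p : Expr
  q : Expr
  w1 : Expr
  w2 : Expr
  w3 : Expr
  w4 : Expr

/-- The generating section given by expressions. -/
def Section.eval (s : Section) : GenSection :=
  ⟨s.u.eval, s.v.eval, s.p.eval, s.q.eval, s.w1.eval, s.w2.eval, s.w3.eval, s.w4.eval⟩

/-- The values of an evolutionary field on the coordinates. -/
def evCoef (s : Section) : Coord → Expr
  | .inl .x => 0
  | .inl .y => 0
  | .inl .t => 0
  | .inl (.u k l) => dx^[k] (dt^[l] s.u)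
  | .inl (.uy k l) => dy (dx^[k] (dt^[l] s.u))
  | .inl (.v k l) => dx^[k] (dt^[l] s.v)
  | .inl (.vy k l) => dy (dx^[k] (dt^[l] s.v))
  | .inr (.p k l) => dx^[k] (dt^[l] s.p)
  | .inr (.py k l) => dy (dx^[k] (dt^[l] s.p))
  | .inr (.q k l) => dx^[k] (dt^[l] s.q)
  | .inr (.qy k l) => dy (dx^[k] (dt^[l] s.q))
  | .inr (.w1 l) => dt^[l] s.w1
  | .inr (.w2 l) => dt^[l] s.w2
  | .inr (.w3 l) => dt^[l] s.w3
  | .inr (.w4 l) => dt^[l] s.w4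

/-- An odd evolutionary field on expressions. -/
def ev (s : Section) : Expr → Expr := der true (evCoef s)

/-- The generating section of the Cartan differential. -/
def cartan : Section where
  u := P 0 0
  v := Q 0 0
  p := 0
  q := 0
  w1 := 0
  w2 := 0
  w3 := Y * P 1 0 * P 0 1 + P 0 0 * PY 0 0
  w4 := Y * (P 1 0 * Q 0 1 - P 0 1 * Q 1 0) + P 0 0 * QY 0 0 - PY 0 0 * Q 0 0

/-- The lift of the shadow `Φ_1`. -/
def lift1 : Section where
  u := U 1 0 * P 0 0 - W1 0
  v := V 1 0 * P 0 0 - 2 * U 1 0 * Q 0 0 - W2 0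
  p := P 0 0 * P 1 0
  q := P 0 0 * Q 1 0 + 2 * P 1 0 * Q 0 0
  w1 := 2 * U 1 0 * P 0 0 * P 1 0 + P 0 0 * PY 0 0
  w2 :=
    -(V 1 0 * P 0 0 * P 1 0) - U 1 0 * P 0 0 * Q 1 0 + P 0 0 * QY 0 0 - 2 * U 1 0 * P 1 0 * Q 0 0
      + 2 * PY 0 0 * Q 0 0
  w3 :=
    -(half * P 0 0 * P 0 1) + U 2 0 * Y * P 0 0 * P 0 1 + 3 * half * U 1 0 * U 1 0 * P 0 0 * P 1 0
      - U 1 1 * Y * P 0 0 * P 1 0 - UY 0 0 * P 0 0 * P 1 0 + U 1 0 * P 0 0 * PY 0 0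
      - half * Y * P 0 0 * PY 0 1 + U 1 0 * Y * P 0 1 * P 1 0 + half * Y * P 0 1 * PY 0 0
  w4 :=
    V 2 0 * Y * P 0 0 * P 0 1 - V 1 1 * Y * P 0 0 * P 1 0 + 2 * VY 0 0 * P 0 0 * P 1 0
      + V 1 0 * P 0 0 * PY 0 0 - 3 * UY 1 0 * P 0 0 * Q 0 0 - 2 * P 0 0 * Q 0 1
      + U 2 0 * Y * P 0 0 * Q 0 1 - U 1 1 * Y * P 0 0 * Q 1 0 - UY 0 0 * P 0 0 * Q 1 0
      + U 1 0 * P 0 0 * QY 0 0 + Y * P 0 0 * QY 0 1 - 2 * V 1 0 * Y * P 0 1 * P 1 0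
      - P 0 1 * Q 0 0 + 2 * U 2 0 * Y * P 0 1 * Q 0 0 + U 1 0 * Y * P 0 1 * Q 1 0
      + 2 * Y * P 0 1 * QY 0 0 - 2 * U 1 1 * Y * P 1 0 * Q 0 0 + UY 0 0 * P 1 0 * Q 0 0
      - U 1 0 * Y * P 1 0 * Q 0 1 + 2 * U 1 0 * PY 0 0 * Q 0 0 + Y * PY 0 0 * Q 0 1
      + 2 * Y * PY 0 1 * Q 0 0

/-- The lift of the shadow `Φ_2`. -/
def lift2 : Section where
  u := UY 0 0 * P 0 0 - 2 * U 1 0 * Y * P 0 1 - U 1 0 * W1 0 + Y * W1 1 + 2 * W3 0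
  v :=
    -(2 * VY 0 0 * P 0 0) + V 1 0 * Y * P 0 1 + 3 * U 1 0 * U 1 0 * Q 0 0 + UY 0 0 * Q 0 0
      + U 1 0 * Y * Q 0 1 - V 1 0 * W1 0 + 2 * U 1 0 * W2 0 + Y * W2 1 - W4 0
  p := -(P 0 0 * PY 0 0) + P 1 0 * W1 0
  q :=
    -(P 0 0 * QY 0 0) - 6 * U 1 0 * P 1 0 * Q 0 0 - 2 * P 1 0 * W2 0 - 2 * PY 0 0 * Q 0 0
      + Q 1 0 * W1 0
  w1 :=
    -(P 0 0 * P 0 1) - UY 0 0 * P 0 0 * P 1 0 - U 1 0 * P 0 0 * PY 0 0 + 2 * U 1 0 * P 1 0 * W1 0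
      + PY 0 0 * W1 0
  w2 :=
    2 * VY 0 0 * P 0 0 * P 1 0 - V 1 0 * P 0 0 * PY 0 0 - P 0 0 * Q 0 1 - UY 0 0 * P 0 0 * Q 1 0
      + 2 * U 1 0 * P 0 0 * QY 0 0 - 2 * P 0 1 * Q 0 0 + 6 * U 1 0 * U 1 0 * P 1 0 * Q 0 0
      - 2 * UY 0 0 * P 1 0 * Q 0 0 - V 1 0 * P 1 0 * W1 0 + 2 * U 1 0 * P 1 0 * W2 0
      - 2 * U 1 0 * PY 0 0 * Q 0 0 - 2 * PY 0 0 * W2 0 - U 1 0 * Q 1 0 * W1 0 + QY 0 0 * W1 0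
  w3 :=
    -(U 1 0 * P 0 0 * P 0 1) - UY 1 0 * Y * P 0 0 * P 0 1 + half * Y * P 0 0 * P 0 2
      + half * UY 0 1 * Y * P 0 0 * P 1 0 + half * UY 0 0 * Y * P 0 0 * P 1 1
      - half * U 1 0 * U 1 0 * P 0 0 * PY 0 0 + half * U 1 1 * Y * P 0 0 * PY 0 0
      + UY 0 0 * P 0 0 * PY 0 0 - half * U 1 0 * Y * P 0 0 * PY 0 1 - UY 1 0 * P 0 0 * W1 0
      + half * P 0 0 * W1 1 - U 1 0 * U 1 0 * Y * P 0 1 * P 1 0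
      - half * UY 0 0 * Y * P 0 1 * P 1 0 - 3 * half * U 1 0 * Y * P 0 1 * PY 0 0
      + half * P 0 1 * W1 0 + U 2 0 * Y * P 0 1 * W1 0 + 3 * half * U 1 0 * U 1 0 * P 1 0 * W1 0
      - U 1 1 * Y * P 1 0 * W1 0 + U 1 0 * PY 0 0 * W1 0 - half * Y * PY 0 0 * W1 1
      - half * Y * PY 0 1 * W1 0
  w4 :=
    -(V 1 0 * P 0 0 * P 0 1) - VY 1 0 * Y * P 0 0 * P 0 1 - 3 * UY 0 0 * V 1 0 * P 0 0 * P 1 0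
      + 2 * VY 0 1 * Y * P 0 0 * P 1 0 + 2 * VY 0 0 * Y * P 0 0 * P 1 1
      - U 1 0 * V 1 0 * P 0 0 * PY 0 0 - V 1 1 * Y * P 0 0 * PY 0 0 - 2 * VY 0 0 * P 0 0 * PY 0 0
      - 2 * V 1 0 * Y * P 0 0 * PY 0 1 + 3 * U 1 0 * UY 1 0 * P 0 0 * Q 0 0
      + 3 * U 1 1 * P 0 0 * Q 0 0 + 3 * U 2 0 * UY 0 0 * P 0 0 * Q 0 0 + 2 * U 1 0 * P 0 0 * Q 0 1
      - UY 1 0 * Y * P 0 0 * Q 0 1 - Y * P 0 0 * Q 0 2 - UY 0 1 * Y * P 0 0 * Q 1 0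
      - UY 0 0 * Y * P 0 0 * Q 1 1 + U 1 0 * U 1 0 * P 0 0 * QY 0 0
      + 2 * U 1 1 * Y * P 0 0 * QY 0 0 + UY 0 0 * P 0 0 * QY 0 0 + U 1 0 * Y * P 0 0 * QY 0 1
      - VY 1 0 * P 0 0 * W1 0 + 2 * UY 1 0 * P 0 0 * W2 0 + 2 * P 0 0 * W2 1
      + 4 * U 1 0 * V 1 0 * Y * P 0 1 * P 1 0 + 4 * VY 0 0 * Y * P 0 1 * P 1 0
      + U 1 0 * P 0 1 * Q 0 0 - 6 * U 1 0 * U 2 0 * Y * P 0 1 * Q 0 0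
      - 2 * UY 1 0 * Y * P 0 1 * Q 0 0 - 3 * Y * P 0 1 * Q 0 1 - U 1 0 * U 1 0 * Y * P 0 1 * Q 1 0
      - 2 * UY 0 0 * Y * P 0 1 * Q 1 0 + V 2 0 * Y * P 0 1 * W1 0 + 2 * P 0 1 * W2 0
      - 2 * U 2 0 * Y * P 0 1 * W2 0 - 2 * Y * P 0 2 * Q 0 0
      + 6 * U 1 0 * U 1 1 * Y * P 1 0 * Q 0 0 - 3 * U 1 0 * UY 0 0 * P 1 0 * Q 0 0
      - 2 * UY 0 1 * Y * P 1 0 * Q 0 0 + U 1 0 * U 1 0 * Y * P 1 0 * Q 0 1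
      - UY 0 0 * Y * P 1 0 * Q 0 1 - V 1 1 * Y * P 1 0 * W1 0 + 2 * U 1 1 * Y * P 1 0 * W2 0
      - 2 * UY 0 0 * Y * P 1 1 * Q 0 0 - 4 * U 1 0 * U 1 0 * PY 0 0 * Q 0 0
      - 2 * U 1 1 * Y * PY 0 0 * Q 0 0 - UY 0 0 * PY 0 0 * Q 0 0 - 3 * U 1 0 * Y * PY 0 0 * Q 0 1
      + V 1 0 * PY 0 0 * W1 0 - 2 * U 1 0 * PY 0 0 * W2 0 - 2 * Y * PY 0 0 * W2 1
      - 4 * U 1 0 * Y * PY 0 1 * Q 0 0 - 2 * Y * PY 0 1 * W2 0 - UY 1 0 * Q 0 0 * W1 0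
      - Q 0 0 * W1 1 - Q 0 1 * W1 0 + U 2 0 * Y * Q 0 1 * W1 0 - U 1 1 * Y * Q 1 0 * W1 0
      + U 1 0 * QY 0 0 * W1 0 + Y * QY 0 0 * W1 1 + Y * QY 0 1 * W1 0

end Expr

/-! ### Degrees -/

theorem involute_of_mem_exteriorPower {n : ℕ} {a : OddAlg} (ha : a ∈ ⋀[ℝ]^n (OddCoord →₀ ℝ)) :
    CliffordAlgebra.involute (Q := (0 : QuadraticForm ℝ (OddCoord →₀ ℝ))) a =
      (-1 : ℝ) ^ n • a := by
  induction ha using Submodule.pow_induction_on_left' with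
  | algebraMap r => simp
  | add x y i hx hy ihx ihy => rw [map_add, ihx, ihy, smul_add]
  | mem_mul m hm i x hx ih =>
    obtain ⟨m, rfl⟩ := hm
    rw [map_mul, ih, pow_succ', mul_smul, mul_smul_comm,
      show CliffordAlgebra.involute (ExteriorAlgebra.ι ℝ m) = -ExteriorAlgebra.ι ℝ m from
        CliffordAlgebra.involute_ι m]
    simp

/-- The second clause compensates for truncated subtraction: for n = 0 the first one only gives
degree 0. The induction uses it when a generator is multiplied by a scalar. -/
theorem contractLeft_of_mem_exteriorPower (d : Module.Dual ℝ (OddCoord →₀ ℝ)) {n : ℕ} {a : OddAlg}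
    (ha : a ∈ ⋀[ℝ]^n (OddCoord →₀ ℝ)) :
    CliffordAlgebra.contractLeft (Q := (0 : QuadraticForm ℝ (OddCoord →₀ ℝ))) d a ∈
        ⋀[ℝ]^(n - 1) (OddCoord →₀ ℝ) ∧
      (n = 0 → CliffordAlgebra.contractLeft (Q := (0 : QuadraticForm ℝ (OddCoord →₀ ℝ))) d a
        = 0) := by
  induction ha using Submodule.pow_induction_on_left' with
  | algebraMap r =>
    have := CliffordAlgebra.contractLeft_algebraMap (Q := (0 : QuadraticForm ℝ (OddCoord →₀ ℝ)))
      d r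
    refine ⟨?_, fun _ => this⟩
    erw [this]
    exact zero_mem _
  | add x y i hx hy ihx ihy =>
    rw [map_add]
    exact ⟨add_mem ihx.1 ihy.1, fun h => by rw [ihx.2 h, ihy.2 h, add_zero]⟩
  | mem_mul m hm i x hx ih =>
    obtain ⟨m, rfl⟩ := hm
    refine ⟨?_, by simp⟩
    have := CliffordAlgebra.contractLeft_ι_mul (Q := (0 : QuadraticForm ℝ (OddCoord →₀ ℝ)))
      (d := d) m x
    erw [this]
    change _ ∈ ⋀[ℝ]^i _
    refine sub_mem (Submodule.smul_mem _ _ hx) ?_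
    rcases i with _ | i
    · rw [ih.2 rfl, mul_zero]
      exact zero_mem _
    · exact (pow_succ' (LinearMap.range (ExteriorAlgebra.ι ℝ (M := OddCoord →₀ ℝ))) i).ge
        (Submodule.mul_mem_mul (LinearMap.mem_range_self _ _) ih.1)

theorem parityAut_of_mem_homogeneous {n : ℕ} {F : SuperFn} (hF : F ∈ homogeneous n) :
    parityAut F = (-1 : ℝ) ^ n • F := by
  induction hF using Submodule.span_induction with
  | zero => simp
  | add F G _ _ h h' => rw [map_add, h, h', smul_add]
  | smul r F _ h => rw [map_smul, h, smul_comm]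
  | mem F hF =>
    obtain ⟨f, a, ha, rfl⟩ := hF
    rw [parityAut_tmul, involute_of_mem_exteriorPower ha, TensorProduct.tmul_smul]

theorem hasParity_of_mem_homogeneous {n : ℕ} {F : SuperFn} (hF : F ∈ homogeneous n) :
    HasParity (n % 2 == 1) F := by
  unfold HasParity
  rw [parityAut_of_mem_homogeneous hF]
  rcases Nat.mod_two_eq_zero_or_one n with h | h
  · rw [(Nat.even_iff.2 h).neg_one_pow, h]; simp
  · rw [(Nat.odd_iff.2 h).neg_one_pow, h]; simp

theorem partialDer_inl_mem_homogeneous {n : ℕ} {F : SuperFn} (hF : F ∈ homogeneous n)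
    (c : EvenCoord) : partialDer (.inl c) F ∈ homogeneous n := by
  induction hF using Submodule.span_induction with
  | zero => rw [map_zero]; exact zero_mem _
  | add F G _ _ h h' => rw [map_add]; exact add_mem h h'
  | smul r F _ h => rw [map_smul]; exact Submodule.smul_mem _ _ h
  | mem F hF =>
    obtain ⟨f, a, ha, rfl⟩ := hF
    exact Submodule.subset_span ⟨_, _, ha, rfl⟩

theorem partialDer_inr_mem_homogeneous {n : ℕ} {F : SuperFn} (hF : F ∈ homogeneous n)
    (c : OddCoord) : partialDer (.inr c) F ∈ homogeneous (n - 1) := by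
  induction hF using Submodule.span_induction with
  | zero => rw [map_zero]; exact zero_mem _
  | add F G _ _ h h' => rw [map_add]; exact add_mem h h'
  | smul r F _ h => rw [map_smul]; exact Submodule.smul_mem _ _ h
  | mem F hF =>
    obtain ⟨f, a, ha, rfl⟩ := hF
    exact Submodule.subset_span ⟨_, _, (contractLeft_of_mem_exteriorPower _ ha).1, rfl⟩

theorem partialDer_inr_eq_zero {F : SuperFn} (hF : F ∈ homogeneous 0) (c : OddCoord) :
    partialDer (.inr c) F = 0 := by
  induction hF using Submodule.span_induction with
  | zero => rw [map_zero]
  | add F G _ _ h h' => rw [map_add, h, h', add_zero]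
  | smul r F _ h => rw [map_smul, h, smul_zero]
  | mem F hF =>
    obtain ⟨f, a, ha, rfl⟩ := hF
    rw [partialDer_inr_tmul]
    erw [(contractLeft_of_mem_exteriorPower _ ha).2 rfl]
    simp

/-- The Euler field of the odd coordinates. -/
def euler : Module.End ℝ SuperFn := vectorField fun
  | .inl _ => 0
  | .inr c => oddGen c

theorem isVectorField_euler : IsVectorField false euler := by
  refine isVectorField_vectorField fun c => ?_
  rcases c with c | c
  · exact HasParity.zero _
  · exact hasParity_oddGen c

theorem euler_ι (m : OddCoord →₀ ℝ) :
    euler ((1 : SmoothFn) ⊗ₜ[ℝ] ExteriorAlgebra.ι ℝ m) = 1 ⊗ₜ[ℝ] ExteriorAlgebra.ι ℝ m := by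
  induction m using Finsupp.induction_linear with
  | zero => simp
  | add m n hm hn => rw [map_add, TensorProduct.tmul_add, map_add, hm, hn]
  | single c r =>
    have h : (Finsupp.single c r : OddCoord →₀ ℝ) = r • Finsupp.single c 1 := by simp
    rw [h, map_smul, TensorProduct.tmul_smul, map_smul]
    congr 1
    exact vectorField_gen _ (.inr c)

theorem euler_tmul_one (f : SmoothFn) : euler (f ⊗ₜ[ℝ] (1 : OddAlg)) = 0 := by
  rw [euler, vectorField_apply]
  refine finsum_eq_zero_of_forall_eq_zero fun c => ?_
  rcases c with c | c
  · rw [zero_mul]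
  · rw [partialDer_inr_tmul]
    erw [CliffordAlgebra.contractLeft_one]
    simp

/-- Euler's identity: a derivation that kills the coefficients and fixes the odd generators
multiplies degree n by n. -/
theorem euler_of_mem_homogeneous {n : ℕ} {F : SuperFn} (hF : F ∈ homogeneous n) :
    euler F = (n : ℝ) • F := by
  induction hF using Submodule.span_induction with
  | zero => simp
  | add F G _ _ h h' => rw [map_add, h, h', smul_add]
  | smul r F _ h => rw [map_smul, h, smul_comm]
  | mem F hF =>
    obtain ⟨f, a, ha, rfl⟩ := hF
    induction ha using Submodule.pow_induction_on_left' with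
    | algebraMap r =>
      rw [Algebra.algebraMap_eq_smul_one, TensorProduct.tmul_smul, map_smul, euler_tmul_one]
      simp
    | add x y i hx hy ihx ihy =>
      rw [TensorProduct.tmul_add, map_add, ihx, ihy, smul_add]
    | mem_mul m hm i x hx ih =>
      obtain ⟨m, rfl⟩ := hm
      have h : f ⊗ₜ[ℝ] (ExteriorAlgebra.ι ℝ m * x) =
          ((1 : SmoothFn) ⊗ₜ[ℝ] ExteriorAlgebra.ι ℝ m) * f ⊗ₜ[ℝ] x := by
        rw [Algebra.TensorProduct.tmul_mul_tmul, one_mul]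
      rw [h, isVectorField_euler.leibniz, ih, euler_ι, parityPow, mul_smul_comm]
      push_cast
      rw [add_smul, one_smul]
      exact add_comm _ _

/-- The Euler field is built from the odd derivatives, so it kills F, but it also multiplies F by n
+ 1, which is not zero. In degree 0 the statement would fail. -/
theorem eq_zero_of_partialDer_inr_eq_zero {n : ℕ} {F : SuperFn} (hF : F ∈ homogeneous (n + 1))
    (h : ∀ c, partialDer (.inr c) F = 0) : F = 0 := by
  have h1 : euler F = 0 := by
    rw [euler, vectorField_apply]
    refine finsum_eq_zero_of_forall_eq_zero fun c => ?_
    rcases c with c | c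
    · rw [zero_mul]
    · rw [h, mul_zero]
  rw [euler_of_mem_homogeneous hF] at h1
  exact (smul_eq_zero.1 h1).resolve_left (by positivity)

namespace IsVectorField

variable {e f : Bool} {V : Module.End ℝ SuperFn}

/-- An odd derivative lowers the degree by one, and the coefficient in front of it, of degree m + 1,
makes up for this. -/
theorem apply_mem_homogeneous (hV : IsVectorField e V) {m n : ℕ}
    (h0 : ∀ c, V (gen (.inl c)) ∈ homogeneous m) (h1 : ∀ c, V (gen (.inr c)) ∈ homogeneous (m + 1))
    {F : SuperFn} (hF : F ∈ homogeneous n) : V F ∈ homogeneous (m + n) := by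
  rw [hV.apply_eq_sum (s := depSet F) fun c => partialDer_eq_zero_of_notMem]
  refine sum_mem fun c _ => ?_
  rcases c with c | c
  · exact mul_mem_homogeneous (h0 c) (partialDer_inl_mem_homogeneous hF c)
  -- In degree 0 the odd derivatives vanish outright; the bound n - 1 would not suffice there.
  · rcases n with _ | n
    · rw [partialDer_inr_eq_zero hF, mul_zero]
      exact zero_mem _
    · have := mul_mem_homogeneous (h1 c) (partialDer_inr_mem_homogeneous hF c)
      rwa [Nat.add_sub_cancel, add_right_comm] at this

theorem pow_apply_mem_homogeneous {n : ℕ} (hV : ∀ F ∈ homogeneous n, V F ∈ homogeneous n)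
    {F : SuperFn} (hF : F ∈ homogeneous n) (l : ℕ) : (V ^ l) F ∈ homogeneous n := by
  induction l with
  | zero => exact hF
  | succ l ih => rw [pow_succ', Module.End.mul_apply]; exact hV _ ih

end IsVectorField

/-! ### The total derivatives -/

namespace Expr

theorem eval_Y : Y.eval = y := rfl
theorem eval_U (k l : ℕ) : (U k l).eval = u k l := rfl
theorem eval_UY (k l : ℕ) : (UY k l).eval = uy k l := rfl
theorem eval_V (k l : ℕ) : (V k l).eval = v k l := rfl
theorem eval_VY (k l : ℕ) : (VY k l).eval = vy k l := rfl
theorem eval_P (k l : ℕ) : (P k l).eval = p k l := rfl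
theorem eval_PY (k l : ℕ) : (PY k l).eval = py k l := rfl
theorem eval_Q (k l : ℕ) : (Q k l).eval = q k l := rfl
theorem eval_QY (k l : ℕ) : (QY k l).eval = qy k l := rfl
theorem eval_W1 (l : ℕ) : (W1 l).eval = w1 l := rfl
theorem eval_W2 (l : ℕ) : (W2 l).eval = w2 l := rfl
theorem eval_W3 (l : ℕ) : (W3 l).eval = w3 l := rfl
theorem eval_W4 (l : ℕ) : (W4 l).eval = w4 l := rfl
theorem eval_one : (const 1 0).eval = 1 := by simp [eval]
theorem eval_half : half.eval = (1 / 2 : ℝ) • 1 := by simp [half, eval]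

theorem eval_RhsU : RhsU.eval = rhsU := by
  simp [RhsU, rhsU, eval_U, eval_UY]
theorem eval_RhsV : RhsV.eval = rhsV := by
  simp [RhsV, rhsV, eval_U, eval_UY, eval_V, eval_VY]
theorem eval_RhsP : RhsP.eval = rhsP := by
  simp [RhsP, rhsP, eval_U, eval_UY, eval_P, eval_PY]
theorem eval_RhsQ : RhsQ.eval = rhsQ := by
  simp [RhsQ, rhsQ, eval_U, eval_UY, eval_V, eval_VY, eval_P, eval_PY, eval_Q, eval_QY]
theorem eval_X1 : X1.eval = PavlovMikhalev.X1 := by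
  simp [X1, PavlovMikhalev.X1, eval_U, eval_P, eval_PY]
theorem eval_Y1 : Y1.eval = PavlovMikhalev.Y1 := by
  simp [Y1, PavlovMikhalev.Y1, eval_U, eval_UY, eval_P, eval_PY]
theorem eval_X2 : X2.eval = PavlovMikhalev.X2 := by
  simp [X2, PavlovMikhalev.X2, eval_U, eval_V, eval_P, eval_Q, eval_QY]
theorem eval_Y2 : Y2.eval = PavlovMikhalev.Y2 := by
  simp [Y2, PavlovMikhalev.Y2, eval_U, eval_UY, eval_V, eval_VY, eval_P, eval_PY, eval_Q, eval_QY]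
theorem eval_X3 : X3.eval = PavlovMikhalev.X3 := by
  have h : (3 : SuperFn) * ((1 / 2 : ℝ) • 1) = (3 / 2 : ℝ) • 1 := by
    have h3 : (3 : SuperFn) = (3 : ℝ) • 1 := by
      rw [← eval_three]
      change ((3 : ℤ) / 2 ^ 0 : ℝ) • (1 : SuperFn) = _
      norm_num
    rw [h3, smul_mul_smul_comm, mul_one]
    norm_num
  simp only [X3, PavlovMikhalev.X3, eval_add, eval_sub, eval_mul, eval_U, eval_UY, eval_P, eval_PY,
    eval_Y, eval_half, eval_three, h, smul_one_mul, pow_two]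
theorem eval_Y3 : Y3.eval = PavlovMikhalev.Y3 := by
  simp only [Y3, PavlovMikhalev.Y3, eval_add, eval_sub, eval_mul, eval_U, eval_UY, eval_P, eval_PY,
    eval_Y, eval_half, smul_one_mul, pow_two]
theorem eval_X4 : X4.eval = PavlovMikhalev.X4 := by
  simp only [X4, PavlovMikhalev.X4, eval_add, eval_sub, eval_mul, eval_U, eval_UY, eval_V, eval_VY,
    eval_P, eval_PY, eval_Q, eval_QY, eval_Y]
theorem eval_Y4 : Y4.eval = PavlovMikhalev.Y4 := by
  simp only [Y4, PavlovMikhalev.Y4, eval_add, eval_sub, eval_mul, eval_U, eval_UY, eval_V, eval_VY,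
    eval_P, eval_PY, eval_Q, eval_QY, eval_Y, eval_two, pow_two]

end Expr

/-! ### Commutation of vector fields tested on coordinates. -/

theorem IsVectorField.pow_comm {V W : Module.End ℝ SuperFn} (h : V * W = W * V) (n : ℕ)
    (F : SuperFn) : V ((W ^ n) F) = (W ^ n) (V F) := by
  have h1 : V * W ^ n = W ^ n * V := (show Commute V W from h).pow_right n
  exact LinearMap.congr_fun h1 F

/-- Even vector fields commute with vector fields if they do so on the coordinates. -/
theorem IsVectorField.comm_of_gen {e : Bool} {V W : Module.End ℝ SuperFn}
    (hV : IsVectorField e V) (hW : IsVectorField false W)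
    (h : ∀ c, V (W (gen c)) = W (V (gen c))) : V * W = W * V := by
  have hk : koszul e false = 1 := by simp [koszul]
  simpa [hk] using hV.commute_of_gen hW (by simpa [hk] using h)

/-! ### The total derivative `D_t` -/

@[simp] theorem Dt_u (k l : ℕ) : Dt (u k l) = u k (l + 1) := vectorField_gen _ (.inl (.u k l))
@[simp] theorem Dt_uy (k l : ℕ) : Dt (uy k l) = uy k (l + 1) := vectorField_gen _ (.inl (.uy k l))
@[simp] theorem Dt_v (k l : ℕ) : Dt (v k l) = v k (l + 1) := vectorField_gen _ (.inl (.v k l))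
@[simp] theorem Dt_vy (k l : ℕ) : Dt (vy k l) = vy k (l + 1) := vectorField_gen _ (.inl (.vy k l))
@[simp] theorem Dt_p (k l : ℕ) : Dt (p k l) = p k (l + 1) := vectorField_gen _ (.inr (.p k l))
@[simp] theorem Dt_py (k l : ℕ) : Dt (py k l) = py k (l + 1) := vectorField_gen _ (.inr (.py k l))
@[simp] theorem Dt_q (k l : ℕ) : Dt (q k l) = q k (l + 1) := vectorField_gen _ (.inr (.q k l))
@[simp] theorem Dt_qy (k l : ℕ) : Dt (qy k l) = qy k (l + 1) := vectorField_gen _ (.inr (.qy k l))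
@[simp] theorem Dt_w1 (l : ℕ) : Dt (w1 l) = w1 (l + 1) := vectorField_gen _ (.inr (.w1 l))
@[simp] theorem Dt_w2 (l : ℕ) : Dt (w2 l) = w2 (l + 1) := vectorField_gen _ (.inr (.w2 l))
@[simp] theorem Dt_w3 (l : ℕ) : Dt (w3 l) = w3 (l + 1) := vectorField_gen _ (.inr (.w3 l))
@[simp] theorem Dt_w4 (l : ℕ) : Dt (w4 l) = w4 (l + 1) := vectorField_gen _ (.inr (.w4 l))
@[simp] theorem Dt_gen_x : Dt (gen (.inl .x)) = 0 := vectorField_gen _ (.inl .x)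
@[simp] theorem Dt_gen_y : Dt (gen (.inl .y)) = 0 := vectorField_gen _ (.inl .y)
@[simp] theorem Dt_gen_t : Dt (gen (.inl .t)) = 1 := vectorField_gen _ (.inl .t)

theorem isVectorField_Dt : IsVectorField false Dt := by
  refine isVectorField_vectorField ?_
  rintro ((_ | _ | _ | _ | _ | _ | _) | (_ | _ | _ | _ | _ | _ | _ | _))
  exacts [HasParity.zero _, HasParity.zero _, HasParity.one, hasParity_evenGen _,
    hasParity_evenGen _, hasParity_evenGen _, hasParity_evenGen _, hasParity_oddGen _,
    hasParity_oddGen _, hasParity_oddGen _, hasParity_oddGen _, hasParity_oddGen _,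
    hasParity_oddGen _, hasParity_oddGen _, hasParity_oddGen _]

theorem Expr.eval_dt (a : Expr) : (dt a).eval = Dt a.eval := by
  refine eval_der isVectorField_Dt ?_ a
  rintro ((_ | _ | _ | _ | _ | _ | _) | (_ | _ | _ | _ | _ | _ | _ | _))
  · exact (eval_zero).trans Dt_gen_x.symm
  · exact (eval_zero).trans Dt_gen_y.symm
  · exact (eval_one).trans Dt_gen_t.symm
  · exact (Dt_u _ _).symm
  · exact (Dt_uy _ _).symm
  · exact (Dt_v _ _).symm
  · exact (Dt_vy _ _).symm
  · exact (Dt_p _ _).symm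
  · exact (Dt_py _ _).symm
  · exact (Dt_q _ _).symm
  · exact (Dt_qy _ _).symm
  · exact (Dt_w1 _).symm
  · exact (Dt_w2 _).symm
  · exact (Dt_w3 _).symm
  · exact (Dt_w4 _).symm

theorem Expr.eval_dt_iterate (n : ℕ) (a : Expr) : (dt^[n] a).eval = (Dt ^ n) a.eval :=
  eval_iterate eval_dt n a

theorem Dt_mem_homogeneous {n : ℕ} {F : SuperFn} (hF : F ∈ homogeneous n) :
    Dt F ∈ homogeneous n := by
  rw [← zero_add n]
  refine isVectorField_Dt.apply_mem_homogeneous ?_ ?_ hF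
  · rintro (_ | _ | _ | _ | _ | _ | _)
    · rw [Dt_gen_x]; exact zero_mem _
    · rw [Dt_gen_y]; exact zero_mem _
    · rw [Dt_gen_t]; simpa using smul_one_mem_homogeneous 1
    · exact (Dt_u _ _).symm ▸ evenGen_mem_homogeneous _
    · exact (Dt_uy _ _).symm ▸ evenGen_mem_homogeneous _
    · exact (Dt_v _ _).symm ▸ evenGen_mem_homogeneous _
    · exact (Dt_vy _ _).symm ▸ evenGen_mem_homogeneous _
  · rintro (_ | _ | _ | _ | _ | _ | _ | _)
    · exact (Dt_p _ _).symm ▸ oddGen_mem_homogeneous _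
    · exact (Dt_py _ _).symm ▸ oddGen_mem_homogeneous _
    · exact (Dt_q _ _).symm ▸ oddGen_mem_homogeneous _
    · exact (Dt_qy _ _).symm ▸ oddGen_mem_homogeneous _
    · exact (Dt_w1 _).symm ▸ oddGen_mem_homogeneous _
    · exact (Dt_w2 _).symm ▸ oddGen_mem_homogeneous _
    · exact (Dt_w3 _).symm ▸ oddGen_mem_homogeneous _
    · exact (Dt_w4 _).symm ▸ oddGen_mem_homogeneous _

theorem Dt_pow_mem_homogeneous {n : ℕ} {F : SuperFn} (hF : F ∈ homogeneous n) (l : ℕ) :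
    (Dt ^ l) F ∈ homogeneous n :=
  IsVectorField.pow_apply_mem_homogeneous (fun _ => Dt_mem_homogeneous) hF l

/-! ### The total derivative `D_x` -/

@[simp] theorem Dx_u (k l : ℕ) : Dx (u k l) = u (k + 1) l := vectorField_gen _ (.inl (.u k l))
@[simp] theorem Dx_uy (k l : ℕ) : Dx (uy k l) = uy (k + 1) l := vectorField_gen _ (.inl (.uy k l))
@[simp] theorem Dx_v (k l : ℕ) : Dx (v k l) = v (k + 1) l := vectorField_gen _ (.inl (.v k l))
@[simp] theorem Dx_vy (k l : ℕ) : Dx (vy k l) = vy (k + 1) l := vectorField_gen _ (.inl (.vy k l))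
@[simp] theorem Dx_p (k l : ℕ) : Dx (p k l) = p (k + 1) l := vectorField_gen _ (.inr (.p k l))
@[simp] theorem Dx_py (k l : ℕ) : Dx (py k l) = py (k + 1) l := vectorField_gen _ (.inr (.py k l))
@[simp] theorem Dx_q (k l : ℕ) : Dx (q k l) = q (k + 1) l := vectorField_gen _ (.inr (.q k l))
@[simp] theorem Dx_qy (k l : ℕ) : Dx (qy k l) = qy (k + 1) l := vectorField_gen _ (.inr (.qy k l))
@[simp] theorem Dx_w1 (l : ℕ) : Dx (w1 l) = (Dt ^ l) X1 := vectorField_gen _ (.inr (.w1 l))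
@[simp] theorem Dx_w2 (l : ℕ) : Dx (w2 l) = (Dt ^ l) X2 := vectorField_gen _ (.inr (.w2 l))
@[simp] theorem Dx_w3 (l : ℕ) : Dx (w3 l) = (Dt ^ l) X3 := vectorField_gen _ (.inr (.w3 l))
@[simp] theorem Dx_w4 (l : ℕ) : Dx (w4 l) = (Dt ^ l) X4 := vectorField_gen _ (.inr (.w4 l))
@[simp] theorem Dx_gen_x : Dx (gen (.inl .x)) = 1 := vectorField_gen _ (.inl .x)
@[simp] theorem Dx_gen_y : Dx (gen (.inl .y)) = 0 := vectorField_gen _ (.inl .y)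
@[simp] theorem Dx_gen_t : Dx (gen (.inl .t)) = 0 := vectorField_gen _ (.inl .t)

theorem X1_mem_homogeneous : X1 ∈ homogeneous 1 :=
  Expr.eval_X1 ▸ Expr.eval_mem_homogeneous (by decide +kernel)
theorem X2_mem_homogeneous : X2 ∈ homogeneous 1 :=
  Expr.eval_X2 ▸ Expr.eval_mem_homogeneous (by decide +kernel)
theorem X3_mem_homogeneous : X3 ∈ homogeneous 1 :=
  Expr.eval_X3 ▸ Expr.eval_mem_homogeneous (by decide +kernel)
theorem X4_mem_homogeneous : X4 ∈ homogeneous 1 :=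
  Expr.eval_X4 ▸ Expr.eval_mem_homogeneous (by decide +kernel)

theorem isVectorField_Dx : IsVectorField false Dx := by
  refine isVectorField_vectorField ?_
  rintro ((_ | _ | _ | _ | _ | _ | _) | (_ | _ | _ | _ | _ | _ | _ | _))
  exacts [HasParity.one, HasParity.zero _, HasParity.zero _, hasParity_evenGen _,
    hasParity_evenGen _, hasParity_evenGen _, hasParity_evenGen _, hasParity_oddGen _,
    hasParity_oddGen _, hasParity_oddGen _, hasParity_oddGen _,
    hasParity_of_mem_homogeneous (Dt_pow_mem_homogeneous X1_mem_homogeneous _),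
    hasParity_of_mem_homogeneous (Dt_pow_mem_homogeneous X2_mem_homogeneous _),
    hasParity_of_mem_homogeneous (Dt_pow_mem_homogeneous X3_mem_homogeneous _),
    hasParity_of_mem_homogeneous (Dt_pow_mem_homogeneous X4_mem_homogeneous _)]

theorem Expr.eval_dx (a : Expr) : (dx a).eval = Dx a.eval := by
  refine eval_der isVectorField_Dx ?_ a
  rintro ((_ | _ | _ | _ | _ | _ | _) | (_ | _ | _ | _ | _ | _ | _ | _))
  · exact (eval_one).trans Dx_gen_x.symm
  · exact (eval_zero).trans Dx_gen_y.symm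
  · exact (eval_zero).trans Dx_gen_t.symm
  · exact (Dx_u _ _).symm
  · exact (Dx_uy _ _).symm
  · exact (Dx_v _ _).symm
  · exact (Dx_vy _ _).symm
  · exact (Dx_p _ _).symm
  · exact (Dx_py _ _).symm
  · exact (Dx_q _ _).symm
  · exact (Dx_qy _ _).symm
  · exact (eval_dt_iterate _ _).trans (eval_X1 ▸ (Dx_w1 _).symm)
  · exact (eval_dt_iterate _ _).trans (eval_X2 ▸ (Dx_w2 _).symm)
  · exact (eval_dt_iterate _ _).trans (eval_X3 ▸ (Dx_w3 _).symm)
  · exact (eval_dt_iterate _ _).trans (eval_X4 ▸ (Dx_w4 _).symm)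

theorem Expr.eval_dx_dt_iterate (k l : ℕ) (a : Expr) :
    (dx^[k] (dt^[l] a)).eval = (Dx ^ k) ((Dt ^ l) a.eval) := by
  rw [eval_iterate eval_dx, eval_dt_iterate]

theorem Dx_mem_homogeneous {n : ℕ} {F : SuperFn} (hF : F ∈ homogeneous n) :
    Dx F ∈ homogeneous n := by
  rw [← zero_add n]
  refine isVectorField_Dx.apply_mem_homogeneous ?_ ?_ hF
  · rintro (_ | _ | _ | _ | _ | _ | _)
    · rw [Dx_gen_x]; simpa using smul_one_mem_homogeneous 1
    · rw [Dx_gen_y]; exact zero_mem _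
    · rw [Dx_gen_t]; exact zero_mem _
    · exact (Dx_u _ _).symm ▸ evenGen_mem_homogeneous _
    · exact (Dx_uy _ _).symm ▸ evenGen_mem_homogeneous _
    · exact (Dx_v _ _).symm ▸ evenGen_mem_homogeneous _
    · exact (Dx_vy _ _).symm ▸ evenGen_mem_homogeneous _
  · rintro (_ | _ | _ | _ | _ | _ | _ | _)
    · exact (Dx_p _ _).symm ▸ oddGen_mem_homogeneous _
    · exact (Dx_py _ _).symm ▸ oddGen_mem_homogeneous _
    · exact (Dx_q _ _).symm ▸ oddGen_mem_homogeneous _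
    · exact (Dx_qy _ _).symm ▸ oddGen_mem_homogeneous _
    · exact (Dx_w1 _).symm ▸ Dt_pow_mem_homogeneous X1_mem_homogeneous _
    · exact (Dx_w2 _).symm ▸ Dt_pow_mem_homogeneous X2_mem_homogeneous _
    · exact (Dx_w3 _).symm ▸ Dt_pow_mem_homogeneous X3_mem_homogeneous _
    · exact (Dx_w4 _).symm ▸ Dt_pow_mem_homogeneous X4_mem_homogeneous _

theorem Dx_Dt_pow_mem_homogeneous {n : ℕ} {F : SuperFn} (hF : F ∈ homogeneous n) (k l : ℕ) :
    (Dx ^ k) ((Dt ^ l) F) ∈ homogeneous n :=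
  IsVectorField.pow_apply_mem_homogeneous (fun _ => Dx_mem_homogeneous)
    (Dt_pow_mem_homogeneous hF l) k

/-! ### The total derivative `D_y` -/

@[simp] theorem Dy_u (k l : ℕ) : Dy (u k l) = uy k l := vectorField_gen _ (.inl (.u k l))
@[simp] theorem Dy_uy (k l : ℕ) : Dy (uy k l) = (Dx ^ k) ((Dt ^ l) rhsU) :=
  vectorField_gen _ (.inl (.uy k l))
@[simp] theorem Dy_v (k l : ℕ) : Dy (v k l) = vy k l := vectorField_gen _ (.inl (.v k l))
@[simp] theorem Dy_vy (k l : ℕ) : Dy (vy k l) = (Dx ^ k) ((Dt ^ l) rhsV) :=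
  vectorField_gen _ (.inl (.vy k l))
@[simp] theorem Dy_p (k l : ℕ) : Dy (p k l) = py k l := vectorField_gen _ (.inr (.p k l))
@[simp] theorem Dy_py (k l : ℕ) : Dy (py k l) = (Dx ^ k) ((Dt ^ l) rhsP) :=
  vectorField_gen _ (.inr (.py k l))
@[simp] theorem Dy_q (k l : ℕ) : Dy (q k l) = qy k l := vectorField_gen _ (.inr (.q k l))
@[simp] theorem Dy_qy (k l : ℕ) : Dy (qy k l) = (Dx ^ k) ((Dt ^ l) rhsQ) :=
  vectorField_gen _ (.inr (.qy k l))
@[simp] theorem Dy_w1 (l : ℕ) : Dy (w1 l) = (Dt ^ l) Y1 := vectorField_gen _ (.inr (.w1 l))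
@[simp] theorem Dy_w2 (l : ℕ) : Dy (w2 l) = (Dt ^ l) Y2 := vectorField_gen _ (.inr (.w2 l))
@[simp] theorem Dy_w3 (l : ℕ) : Dy (w3 l) = (Dt ^ l) Y3 := vectorField_gen _ (.inr (.w3 l))
@[simp] theorem Dy_w4 (l : ℕ) : Dy (w4 l) = (Dt ^ l) Y4 := vectorField_gen _ (.inr (.w4 l))
@[simp] theorem Dy_gen_x : Dy (gen (.inl .x)) = 0 := vectorField_gen _ (.inl .x)
@[simp] theorem Dy_gen_y : Dy (gen (.inl .y)) = 1 := vectorField_gen _ (.inl .y)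
@[simp] theorem Dy_gen_t : Dy (gen (.inl .t)) = 0 := vectorField_gen _ (.inl .t)

theorem Y1_mem_homogeneous : Y1 ∈ homogeneous 1 :=
  Expr.eval_Y1 ▸ Expr.eval_mem_homogeneous (by decide +kernel)
theorem Y2_mem_homogeneous : Y2 ∈ homogeneous 1 :=
  Expr.eval_Y2 ▸ Expr.eval_mem_homogeneous (by decide +kernel)
theorem Y3_mem_homogeneous : Y3 ∈ homogeneous 1 :=
  Expr.eval_Y3 ▸ Expr.eval_mem_homogeneous (by decide +kernel)
theorem Y4_mem_homogeneous : Y4 ∈ homogeneous 1 :=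
  Expr.eval_Y4 ▸ Expr.eval_mem_homogeneous (by decide +kernel)
theorem rhsU_mem_homogeneous : rhsU ∈ homogeneous 0 :=
  Expr.eval_RhsU ▸ Expr.eval_mem_homogeneous (by decide +kernel)
theorem rhsV_mem_homogeneous : rhsV ∈ homogeneous 0 :=
  Expr.eval_RhsV ▸ Expr.eval_mem_homogeneous (by decide +kernel)
theorem rhsP_mem_homogeneous : rhsP ∈ homogeneous 1 :=
  Expr.eval_RhsP ▸ Expr.eval_mem_homogeneous (by decide +kernel)
theorem rhsQ_mem_homogeneous : rhsQ ∈ homogeneous 1 :=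
  Expr.eval_RhsQ ▸ Expr.eval_mem_homogeneous (by decide +kernel)

theorem isVectorField_Dy : IsVectorField false Dy := by
  refine isVectorField_vectorField ?_
  rintro ((_ | _ | _ | _ | _ | _ | _) | (_ | _ | _ | _ | _ | _ | _ | _))
  exacts [HasParity.zero _, HasParity.one, HasParity.zero _, hasParity_evenGen _,
    hasParity_of_mem_homogeneous (Dx_Dt_pow_mem_homogeneous rhsU_mem_homogeneous _ _),
    hasParity_evenGen _,
    hasParity_of_mem_homogeneous (Dx_Dt_pow_mem_homogeneous rhsV_mem_homogeneous _ _),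
    hasParity_oddGen _,
    hasParity_of_mem_homogeneous (Dx_Dt_pow_mem_homogeneous rhsP_mem_homogeneous _ _),
    hasParity_oddGen _,
    hasParity_of_mem_homogeneous (Dx_Dt_pow_mem_homogeneous rhsQ_mem_homogeneous _ _),
    hasParity_of_mem_homogeneous (Dt_pow_mem_homogeneous Y1_mem_homogeneous _),
    hasParity_of_mem_homogeneous (Dt_pow_mem_homogeneous Y2_mem_homogeneous _),
    hasParity_of_mem_homogeneous (Dt_pow_mem_homogeneous Y3_mem_homogeneous _),
    hasParity_of_mem_homogeneous (Dt_pow_mem_homogeneous Y4_mem_homogeneous _)]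

theorem Expr.eval_dy (a : Expr) : (dy a).eval = Dy a.eval := by
  refine eval_der isVectorField_Dy ?_ a
  rintro ((_ | _ | _ | _ | _ | _ | _) | (_ | _ | _ | _ | _ | _ | _ | _))
  · exact (eval_zero).trans Dy_gen_x.symm
  · exact (eval_one).trans Dy_gen_y.symm
  · exact (eval_zero).trans Dy_gen_t.symm
  · exact (Dy_u _ _).symm
  · exact (eval_dx_dt_iterate _ _ _).trans (eval_RhsU ▸ (Dy_uy _ _).symm)
  · exact (Dy_v _ _).symm
  · exact (eval_dx_dt_iterate _ _ _).trans (eval_RhsV ▸ (Dy_vy _ _).symm)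
  · exact (Dy_p _ _).symm
  · exact (eval_dx_dt_iterate _ _ _).trans (eval_RhsP ▸ (Dy_py _ _).symm)
  · exact (Dy_q _ _).symm
  · exact (eval_dx_dt_iterate _ _ _).trans (eval_RhsQ ▸ (Dy_qy _ _).symm)
  · exact (eval_dt_iterate _ _).trans (eval_Y1 ▸ (Dy_w1 _).symm)
  · exact (eval_dt_iterate _ _).trans (eval_Y2 ▸ (Dy_w2 _).symm)
  · exact (eval_dt_iterate _ _).trans (eval_Y3 ▸ (Dy_w3 _).symm)
  · exact (eval_dt_iterate _ _).trans (eval_Y4 ▸ (Dy_w4 _).symm)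

theorem Dy_mem_homogeneous {n : ℕ} {F : SuperFn} (hF : F ∈ homogeneous n) :
    Dy F ∈ homogeneous n := by
  rw [← zero_add n]
  refine isVectorField_Dy.apply_mem_homogeneous ?_ ?_ hF
  · rintro (_ | _ | _ | _ | _ | _ | _)
    · rw [Dy_gen_x]; exact zero_mem _
    · rw [Dy_gen_y]; simpa using smul_one_mem_homogeneous 1
    · rw [Dy_gen_t]; exact zero_mem _
    · exact (Dy_u _ _).symm ▸ evenGen_mem_homogeneous _
    · exact (Dy_uy _ _).symm ▸ Dx_Dt_pow_mem_homogeneous rhsU_mem_homogeneous _ _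
    · exact (Dy_v _ _).symm ▸ evenGen_mem_homogeneous _
    · exact (Dy_vy _ _).symm ▸ Dx_Dt_pow_mem_homogeneous rhsV_mem_homogeneous _ _
  · rintro (_ | _ | _ | _ | _ | _ | _ | _)
    · exact (Dy_p _ _).symm ▸ oddGen_mem_homogeneous _
    · exact (Dy_py _ _).symm ▸ Dx_Dt_pow_mem_homogeneous rhsP_mem_homogeneous _ _
    · exact (Dy_q _ _).symm ▸ oddGen_mem_homogeneous _
    · exact (Dy_qy _ _).symm ▸ Dx_Dt_pow_mem_homogeneous rhsQ_mem_homogeneous _ _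
    · exact (Dy_w1 _).symm ▸ Dt_pow_mem_homogeneous Y1_mem_homogeneous _
    · exact (Dy_w2 _).symm ▸ Dt_pow_mem_homogeneous Y2_mem_homogeneous _
    · exact (Dy_w3 _).symm ▸ Dt_pow_mem_homogeneous Y3_mem_homogeneous _
    · exact (Dy_w4 _).symm ▸ Dt_pow_mem_homogeneous Y4_mem_homogeneous _

/-! ### The total derivatives commute -/

theorem Dt_Dt_pow (l : ℕ) (F : SuperFn) : Dt ((Dt ^ l) F) = (Dt ^ (l + 1)) F := by
  rw [pow_succ', Module.End.mul_apply]

theorem Dx_Dx_pow (l : ℕ) (F : SuperFn) : Dx ((Dx ^ l) F) = (Dx ^ (l + 1)) F := by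
  rw [pow_succ', Module.End.mul_apply]

/-- Proves an equality of vector fields by cases on the coordinate. -/
theorem forall_gen {P : SuperFn → Prop} (hx : P (gen (.inl .x))) (hy : P (gen (.inl .y)))
    (ht : P (gen (.inl .t))) (hu : ∀ k l, P (u k l)) (huy : ∀ k l, P (uy k l))
    (hv : ∀ k l, P (v k l)) (hvy : ∀ k l, P (vy k l)) (hp : ∀ k l, P (p k l))
    (hpy : ∀ k l, P (py k l)) (hq : ∀ k l, P (q k l)) (hqy : ∀ k l, P (qy k l))
    (hw1 : ∀ l, P (w1 l)) (hw2 : ∀ l, P (w2 l)) (hw3 : ∀ l, P (w3 l)) (hw4 : ∀ l, P (w4 l))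
    (c : Coord) : P (gen c) := by
  rcases c with (_ | _ | _ | ⟨k, l⟩ | ⟨k, l⟩ | ⟨k, l⟩ | ⟨k, l⟩) |
    (⟨k, l⟩ | ⟨k, l⟩ | ⟨k, l⟩ | ⟨k, l⟩ | l | l | l | l)
  exacts [hx, hy, ht, hu k l, huy k l, hv k l, hvy k l, hp k l, hpy k l, hq k l, hqy k l,
    hw1 l, hw2 l, hw3 l, hw4 l]

theorem Dx_mul_Dt : Dx * Dt = Dt * Dx := by
  refine isVectorField_Dx.comm_of_gen isVectorField_Dt (forall_gen
    (P := fun F => Dx (Dt F) = Dt (Dx F)) ?_ ?_ ?_ ?_ ?_ ?_ ?_ ?_ ?_ ?_ ?_ ?_ ?_ ?_ ?_) <;>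
    simp [isVectorField_Dx.map_one, isVectorField_Dt.map_one, Dt_Dt_pow]

theorem Dt_Dx_pow (k : ℕ) (F : SuperFn) : Dt ((Dx ^ k) F) = (Dx ^ k) (Dt F) :=
  IsVectorField.pow_comm Dx_mul_Dt.symm k F

theorem Dx_Dt_pow (k : ℕ) (F : SuperFn) : Dx ((Dt ^ k) F) = (Dt ^ k) (Dx F) :=
  IsVectorField.pow_comm Dx_mul_Dt k F

theorem Dy_mul_Dt : Dy * Dt = Dt * Dy := by
  refine isVectorField_Dy.comm_of_gen isVectorField_Dt (forall_gen
    (P := fun F => Dy (Dt F) = Dt (Dy F)) ?_ ?_ ?_ ?_ ?_ ?_ ?_ ?_ ?_ ?_ ?_ ?_ ?_ ?_ ?_) <;>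
    simp [isVectorField_Dy.map_one, isVectorField_Dt.map_one, Dt_Dt_pow, Dt_Dx_pow]

theorem Dy_Dt_pow (k : ℕ) (F : SuperFn) : Dy ((Dt ^ k) F) = (Dt ^ k) (Dy F) :=
  IsVectorField.pow_comm Dy_mul_Dt k F

/-- Compatibility of the covering: the two ways of computing `w_{1,xy}` agree by virtue of the
tangent equation, which enters through `Dy`. -/
theorem Dx_Y1 : Dx Y1 = Dy X1 := by
  rw [← Expr.eval_Y1, ← Expr.eval_X1, ← Expr.eval_dx, ← Expr.eval_dy]
  exact Expr.eval_congr (by decide +kernel)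
theorem Dx_Y2 : Dx Y2 = Dy X2 := by
  rw [← Expr.eval_Y2, ← Expr.eval_X2, ← Expr.eval_dx, ← Expr.eval_dy]
  exact Expr.eval_congr (by decide +kernel)
theorem Dx_Y3 : Dx Y3 = Dy X3 := by
  rw [← Expr.eval_Y3, ← Expr.eval_X3, ← Expr.eval_dx, ← Expr.eval_dy]
  exact Expr.eval_congr (by decide +kernel)
theorem Dx_Y4 : Dx Y4 = Dy X4 := by
  rw [← Expr.eval_Y4, ← Expr.eval_X4, ← Expr.eval_dx, ← Expr.eval_dy]
  exact Expr.eval_congr (by decide +kernel)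

/-- On local coordinates this is built into the definition of `Dy`, because the right-hand sides are
prolonged by `Dx` and `Dt`. On the nonlocal ones it is the compatibility of the four coverings. -/
theorem Dx_mul_Dy : Dx * Dy = Dy * Dx := by
  refine isVectorField_Dx.comm_of_gen isVectorField_Dy (forall_gen
    (P := fun F => Dx (Dy F) = Dy (Dx F)) ?_ ?_ ?_ ?_ ?_ ?_ ?_ ?_ ?_ ?_ ?_ ?_ ?_ ?_ ?_) <;>
    simp [isVectorField_Dx.map_one, isVectorField_Dy.map_one, Dx_Dx_pow, Dx_Dt_pow, Dy_Dt_pow,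
      Dx_Y1, Dx_Y2, Dx_Y3, Dx_Y4]

theorem Dy_Dx_pow (k : ℕ) (F : SuperFn) : Dy ((Dx ^ k) F) = (Dx ^ k) (Dy F) :=
  IsVectorField.pow_comm Dx_mul_Dy.symm k F

theorem Dx_Dy (F : SuperFn) : Dx (Dy F) = Dy (Dx F) := LinearMap.congr_fun Dx_mul_Dy F
theorem Dy_Dt (F : SuperFn) : Dy (Dt F) = Dt (Dy F) := LinearMap.congr_fun Dy_mul_Dt F

/-! ### Evolutionary vector fields -/

section Ev

variable (φ : GenSection)

@[simp] theorem Ev_u (k l : ℕ) : Ev φ (u k l) = (Dx ^ k) ((Dt ^ l) φ.u) :=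
  vectorField_gen _ (.inl (.u k l))
@[simp] theorem Ev_uy (k l : ℕ) : Ev φ (uy k l) = Dy ((Dx ^ k) ((Dt ^ l) φ.u)) :=
  vectorField_gen _ (.inl (.uy k l))
@[simp] theorem Ev_v (k l : ℕ) : Ev φ (v k l) = (Dx ^ k) ((Dt ^ l) φ.v) :=
  vectorField_gen _ (.inl (.v k l))
@[simp] theorem Ev_vy (k l : ℕ) : Ev φ (vy k l) = Dy ((Dx ^ k) ((Dt ^ l) φ.v)) :=
  vectorField_gen _ (.inl (.vy k l))
@[simp] theorem Ev_p (k l : ℕ) : Ev φ (p k l) = (Dx ^ k) ((Dt ^ l) φ.p) :=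
  vectorField_gen _ (.inr (.p k l))
@[simp] theorem Ev_py (k l : ℕ) : Ev φ (py k l) = Dy ((Dx ^ k) ((Dt ^ l) φ.p)) :=
  vectorField_gen _ (.inr (.py k l))
@[simp] theorem Ev_q (k l : ℕ) : Ev φ (q k l) = (Dx ^ k) ((Dt ^ l) φ.q) :=
  vectorField_gen _ (.inr (.q k l))
@[simp] theorem Ev_qy (k l : ℕ) : Ev φ (qy k l) = Dy ((Dx ^ k) ((Dt ^ l) φ.q)) :=
  vectorField_gen _ (.inr (.qy k l))
@[simp] theorem Ev_w1 (l : ℕ) : Ev φ (w1 l) = (Dt ^ l) φ.w1 := vectorField_gen _ (.inr (.w1 l))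
@[simp] theorem Ev_w2 (l : ℕ) : Ev φ (w2 l) = (Dt ^ l) φ.w2 := vectorField_gen _ (.inr (.w2 l))
@[simp] theorem Ev_w3 (l : ℕ) : Ev φ (w3 l) = (Dt ^ l) φ.w3 := vectorField_gen _ (.inr (.w3 l))
@[simp] theorem Ev_w4 (l : ℕ) : Ev φ (w4 l) = (Dt ^ l) φ.w4 := vectorField_gen _ (.inr (.w4 l))
@[simp] theorem Ev_gen_x : Ev φ (gen (.inl .x)) = 0 := vectorField_gen _ (.inl .x)
@[simp] theorem Ev_gen_y : Ev φ (gen (.inl .y)) = 0 := vectorField_gen _ (.inl .y)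
@[simp] theorem Ev_gen_t : Ev φ (gen (.inl .t)) = 0 := vectorField_gen _ (.inl .t)

/-- The degrees of the components of an odd symmetry. -/
structure GenSection.HasDegrees : Prop where
  deg_u : φ.u ∈ homogeneous 1
  deg_v : φ.v ∈ homogeneous 1
  deg_p : φ.p ∈ homogeneous 2
  deg_q : φ.q ∈ homogeneous 2
  deg_w1 : φ.w1 ∈ homogeneous 2
  deg_w2 : φ.w2 ∈ homogeneous 2
  deg_w3 : φ.w3 ∈ homogeneous 2
  deg_w4 : φ.w4 ∈ homogeneous 2

variable {φ}

theorem IsOddNonlocalSymmetry.hasDegrees (h : IsOddNonlocalSymmetry φ) : φ.HasDegrees :=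
  ⟨h.deg_u, h.deg_v, h.deg_p, h.deg_q, h.deg_w1, h.deg_w2, h.deg_w3, h.deg_w4⟩

namespace GenSection.HasDegrees

theorem Ev_gen_mem (h : φ.HasDegrees) (c : Coord) :
    Ev φ (gen c) ∈ homogeneous (if Coord.odd c then 2 else 1) := by
  rcases c with (_ | _ | _ | _ | _ | _ | _) | (_ | _ | _ | _ | _ | _ | _ | _)
  · exact (Ev_gen_x φ).symm ▸ zero_mem _
  · exact (Ev_gen_y φ).symm ▸ zero_mem _
  · exact (Ev_gen_t φ).symm ▸ zero_mem _
  · exact (Ev_u φ _ _).symm ▸ Dx_Dt_pow_mem_homogeneous h.deg_u _ _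
  · exact (Ev_uy φ _ _).symm ▸ Dy_mem_homogeneous (Dx_Dt_pow_mem_homogeneous h.deg_u _ _)
  · exact (Ev_v φ _ _).symm ▸ Dx_Dt_pow_mem_homogeneous h.deg_v _ _
  · exact (Ev_vy φ _ _).symm ▸ Dy_mem_homogeneous (Dx_Dt_pow_mem_homogeneous h.deg_v _ _)
  · exact (Ev_p φ _ _).symm ▸ Dx_Dt_pow_mem_homogeneous h.deg_p _ _
  · exact (Ev_py φ _ _).symm ▸ Dy_mem_homogeneous (Dx_Dt_pow_mem_homogeneous h.deg_p _ _)
  · exact (Ev_q φ _ _).symm ▸ Dx_Dt_pow_mem_homogeneous h.deg_q _ _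
  · exact (Ev_qy φ _ _).symm ▸ Dy_mem_homogeneous (Dx_Dt_pow_mem_homogeneous h.deg_q _ _)
  · exact (Ev_w1 φ _).symm ▸ Dt_pow_mem_homogeneous h.deg_w1 _
  · exact (Ev_w2 φ _).symm ▸ Dt_pow_mem_homogeneous h.deg_w2 _
  · exact (Ev_w3 φ _).symm ▸ Dt_pow_mem_homogeneous h.deg_w3 _
  · exact (Ev_w4 φ _).symm ▸ Dt_pow_mem_homogeneous h.deg_w4 _

theorem isVectorField_Ev (h : φ.HasDegrees) : IsVectorField true (Ev φ) := by
  constructor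
  · obtain ⟨a, ha⟩ : ∃ a, Ev φ = vectorField a := ⟨_, rfl⟩
    simp only [ha, vectorField_gen]
  · intro c
    have := hasParity_of_mem_homogeneous (h.Ev_gen_mem c)
    cases hc : Coord.odd c <;> simpa [hc] using this

theorem Ev_mem_homogeneous (h : φ.HasDegrees) {n : ℕ} {F : SuperFn} (hF : F ∈ homogeneous n) :
    Ev φ F ∈ homogeneous (n + 1) := by
  rw [add_comm]
  exact h.isVectorField_Ev.apply_mem_homogeneous (fun c => h.Ev_gen_mem (.inl c))
    (fun c => h.Ev_gen_mem (.inr c)) hF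

/-- No condition on the components arises, because the t-derivatives of all dependent variables are
independent coordinates and `Ev` is prolonged along them by `Dt`. -/
theorem Ev_mul_Dt (h : φ.HasDegrees) : Ev φ * Dt = Dt * Ev φ := by
  refine h.isVectorField_Ev.comm_of_gen isVectorField_Dt (forall_gen
    (P := fun F => Ev φ (Dt F) = Dt (Ev φ F)) ?_ ?_ ?_ ?_ ?_ ?_ ?_ ?_ ?_ ?_ ?_ ?_ ?_ ?_ ?_) <;>
    simp [h.isVectorField_Ev.map_one, Dt_Dt_pow, Dt_Dx_pow, ← Dy_Dt]

theorem Ev_Dt_pow (h : φ.HasDegrees) (l : ℕ) (F : SuperFn) :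
    Ev φ ((Dt ^ l) F) = (Dt ^ l) (Ev φ F) := IsVectorField.pow_comm h.Ev_mul_Dt l F

/-- The x-derivatives of the local variables are free coordinates, so only the equations `w_{i,x} =
X_i` impose conditions. -/
theorem Ev_mul_Dx (h : φ.HasDegrees) (h1 : Ev φ X1 = Dx φ.w1) (h2 : Ev φ X2 = Dx φ.w2)
    (h3 : Ev φ X3 = Dx φ.w3) (h4 : Ev φ X4 = Dx φ.w4) : Ev φ * Dx = Dx * Ev φ := by
  refine h.isVectorField_Ev.comm_of_gen isVectorField_Dx (forall_gen
    (P := fun F => Ev φ (Dx F) = Dx (Ev φ F)) ?_ ?_ ?_ ?_ ?_ ?_ ?_ ?_ ?_ ?_ ?_ ?_ ?_ ?_ ?_) <;>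
    simp [h.isVectorField_Ev.map_one, Dx_Dx_pow, Dx_Dt_pow, Dx_Dy, h.Ev_Dt_pow, h1, h2, h3, h4]

/-- The conditions come from the second y-derivatives, where they are the linearized equations, and
from `w_{i,y} = Y_i`. Commutation with `Dx` is needed first, to pass through the prolonged
right-hand sides. -/
theorem Ev_mul_Dy (h : φ.HasDegrees) (hx : Ev φ * Dx = Dx * Ev φ)
    (hu : Ev φ rhsU = Dy (Dy φ.u)) (hv : Ev φ rhsV = Dy (Dy φ.v))
    (hp : Ev φ rhsP = Dy (Dy φ.p)) (hq : Ev φ rhsQ = Dy (Dy φ.q))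
    (h1 : Ev φ Y1 = Dy φ.w1) (h2 : Ev φ Y2 = Dy φ.w2)
    (h3 : Ev φ Y3 = Dy φ.w3) (h4 : Ev φ Y4 = Dy φ.w4) : Ev φ * Dy = Dy * Ev φ := by
  have hxp := IsVectorField.pow_comm hx
  refine h.isVectorField_Ev.comm_of_gen isVectorField_Dy (forall_gen
    (P := fun F => Ev φ (Dy F) = Dy (Ev φ F)) ?_ ?_ ?_ ?_ ?_ ?_ ?_ ?_ ?_ ?_ ?_ ?_ ?_ ?_ ?_) <;>
    simp [h.isVectorField_Ev.map_one, Dy_Dx_pow, Dy_Dt_pow, h.Ev_Dt_pow, hxp, hu, hv, hp, hq,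
      h1, h2, h3, h4]

end GenSection.HasDegrees

theorem IsOddNonlocalSymmetry.of_hasDegrees (h : φ.HasDegrees)
    (hu : Ev φ rhsU = Dy (Dy φ.u)) (hv : Ev φ rhsV = Dy (Dy φ.v))
    (hp : Ev φ rhsP = Dy (Dy φ.p)) (hq : Ev φ rhsQ = Dy (Dy φ.q))
    (hx1 : Ev φ X1 = Dx φ.w1) (hx2 : Ev φ X2 = Dx φ.w2)
    (hx3 : Ev φ X3 = Dx φ.w3) (hx4 : Ev φ X4 = Dx φ.w4)
    (hy1 : Ev φ Y1 = Dy φ.w1) (hy2 : Ev φ Y2 = Dy φ.w2)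
    (hy3 : Ev φ Y3 = Dy φ.w3) (hy4 : Ev φ Y4 = Dy φ.w4) : IsOddNonlocalSymmetry φ :=
  have hx := h.Ev_mul_Dx hx1 hx2 hx3 hx4
  { h with
    comm_x := hx
    comm_y := h.Ev_mul_Dy hx hu hv hp hq hy1 hy2 hy3 hy4
    comm_t := h.Ev_mul_Dt }

end Ev

/-! ### The bracket of symmetries -/

/-- A vector field that annihilates the independent variables and commutes with the total
derivatives is evolutionary. -/
theorem IsVectorField.eq_Ev {e : Bool} {S : Module.End ℝ SuperFn} (hS : IsVectorField e S)
    (hx : S (gen (.inl .x)) = 0) (hy : S (gen (.inl .y)) = 0) (ht : S (gen (.inl .t)) = 0)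
    (hSx : S * Dx = Dx * S) (hSy : S * Dy = Dy * S) (hSt : S * Dt = Dt * S) :
    S = Ev ⟨S (u 0 0), S (v 0 0), S (p 0 0), S (q 0 0), S (w1 0), S (w2 0), S (w3 0),
      S (w4 0)⟩ := by
  -- A doubly indexed family is obtained from its first member by `Dx` and `Dt`, so the value of S
  -- there determines all the others.
  have kx : ∀ {f : ℕ → ℕ → SuperFn}, (∀ k l, Dx (f k l) = f (k + 1) l) →
      (∀ k l, Dt (f k l) = f k (l + 1)) → ∀ k l, S (f k l) = (Dx ^ k) ((Dt ^ l) (S (f 0 0))) := by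
    intro f hfx hft k l
    rw [← IsVectorField.pow_comm hSt, ← IsVectorField.pow_comm hSx]
    congr 1
    have h1 : (Dt ^ l) (f 0 0) = f 0 l := by
      induction l with
      | zero => rfl
      | succ l ih => rw [← Dt_Dt_pow, ih, hft]
    rw [h1]
    induction k with
    | zero => rfl
    | succ k ih => rw [← Dx_Dx_pow, ← ih, hfx]
  have kw : ∀ {f : ℕ → SuperFn}, (∀ l, Dt (f l) = f (l + 1)) →
      ∀ l, S (f l) = (Dt ^ l) (S (f 0)) := by
    intro f hft l
    rw [← IsVectorField.pow_comm hSt]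
    congr 1
    induction l with
    | zero => rfl
    | succ l ih => rw [← Dt_Dt_pow, ← ih, hft]
  have hy' : ∀ F, S (Dy F) = Dy (S F) := LinearMap.congr_fun hSy
  conv_lhs => rw [hS.eq_vectorField]
  unfold Ev
  congr 1
  funext c
  rcases c with (_ | _ | _ | ⟨k, l⟩ | ⟨k, l⟩ | ⟨k, l⟩ | ⟨k, l⟩) |
    (⟨k, l⟩ | ⟨k, l⟩ | ⟨k, l⟩ | ⟨k, l⟩ | l | l | l | l)
  · exact hx
  · exact hy
  · exact ht
  · exact kx Dx_u Dt_u k l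
  · exact (congrArg S (Dy_u k l)).symm.trans ((hy' _).trans (congrArg Dy (kx Dx_u Dt_u k l)))
  · exact kx Dx_v Dt_v k l
  · exact (congrArg S (Dy_v k l)).symm.trans ((hy' _).trans (congrArg Dy (kx Dx_v Dt_v k l)))
  · exact kx Dx_p Dt_p k l
  · exact (congrArg S (Dy_p k l)).symm.trans ((hy' _).trans (congrArg Dy (kx Dx_p Dt_p k l)))
  · exact kx Dx_q Dt_q k l
  · exact (congrArg S (Dy_q k l)).symm.trans ((hy' _).trans (congrArg Dy (kx Dx_q Dt_q k l)))
  · exact kw Dt_w1 l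
  · exact kw Dt_w2 l
  · exact kw Dt_w3 l
  · exact kw Dt_w4 l

theorem superCommutator_apply (φ ψ : GenSection) (F : SuperFn) :
    superCommutator φ ψ F = Ev φ (Ev ψ F) + Ev ψ (Ev φ F) := rfl

namespace IsOddNonlocalSymmetry

variable {φ ψ : GenSection}

theorem isVectorField_superCommutator (hφ : IsOddNonlocalSymmetry φ)
    (hψ : IsOddNonlocalSymmetry ψ) : IsVectorField false (superCommutator φ ψ) := by
  have h := hφ.hasDegrees.isVectorField_Ev.commutator hψ.hasDegrees.isVectorField_Ev
  -- For two odd fields the Koszul sign is -1, so the supercommutator is a sum.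
  have hs : superCommutator φ ψ = Ev φ * Ev ψ - koszul true true • (Ev ψ * Ev φ) := by
    refine LinearMap.ext fun F => ?_
    simp [koszul, superCommutator]
  rw [hs]
  exact h

theorem superCommutator_comm (hφ : IsOddNonlocalSymmetry φ) (hψ : IsOddNonlocalSymmetry ψ) :
    superCommutator φ ψ * Dx = Dx * superCommutator φ ψ ∧
    superCommutator φ ψ * Dy = Dy * superCommutator φ ψ ∧
    superCommutator φ ψ * Dt = Dt * superCommutator φ ψ := by
  have key : ∀ D : Module.End ℝ SuperFn, Ev φ * D = D * Ev φ → Ev ψ * D = D * Ev ψ →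
      superCommutator φ ψ * D = D * superCommutator φ ψ := by
    intro D h1 h2
    rw [superCommutator, add_mul, mul_add, mul_assoc, mul_assoc, h2, h1, ← mul_assoc, ← mul_assoc,
      h1, h2, mul_assoc, mul_assoc]
  exact ⟨key _ hφ.comm_x hψ.comm_x, key _ hφ.comm_y hψ.comm_y, key _ hφ.comm_t hψ.comm_t⟩

/-- The supercommutator of odd symmetries is the evolutionary field of their bracket. -/
theorem superCommutator_eq_Ev (hφ : IsOddNonlocalSymmetry φ) (hψ : IsOddNonlocalSymmetry ψ) :
    superCommutator φ ψ = Ev (fnBracket φ ψ) := by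
  obtain ⟨hx, hy, ht⟩ := superCommutator_comm hφ hψ
  exact (isVectorField_superCommutator hφ hψ).eq_Ev (by simp [superCommutator_apply])
    (by simp [superCommutator_apply]) (by simp [superCommutator_apply]) hx hy ht

end IsOddNonlocalSymmetry

/-! ### Evolutionary fields given by expressions -/

namespace Expr

theorem Section.hasDegrees {s : Section} (h : (hasDegree 1 s.u && hasDegree 1 s.v &&
    hasDegree 2 s.p && hasDegree 2 s.q && hasDegree 2 s.w1 && hasDegree 2 s.w2 &&
    hasDegree 2 s.w3 && hasDegree 2 s.w4) = true) : s.eval.HasDegrees := by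
  simp only [Bool.and_eq_true] at h
  obtain ⟨⟨⟨⟨⟨⟨⟨hu, hv⟩, hp⟩, hq⟩, h1⟩, h2⟩, h3⟩, h4⟩ := h
  exact ⟨eval_mem_homogeneous hu, eval_mem_homogeneous hv, eval_mem_homogeneous hp,
    eval_mem_homogeneous hq, eval_mem_homogeneous h1, eval_mem_homogeneous h2,
    eval_mem_homogeneous h3, eval_mem_homogeneous h4⟩

theorem eval_ev {s : Section} (h : s.eval.HasDegrees) (a : Expr) :
    (ev s a).eval = Ev s.eval a.eval := by
  refine eval_der h.isVectorField_Ev ?_ a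
  rintro ((_ | _ | _ | _ | _ | _ | _) | (_ | _ | _ | _ | _ | _ | _ | _))
  · exact eval_zero.trans (Ev_gen_x s.eval).symm
  · exact eval_zero.trans (Ev_gen_y s.eval).symm
  · exact eval_zero.trans (Ev_gen_t s.eval).symm
  · exact (eval_dx_dt_iterate _ _ _).trans (Ev_u s.eval _ _).symm
  · exact ((eval_dy _).trans (congrArg Dy (eval_dx_dt_iterate _ _ _))).trans (Ev_uy s.eval _ _).symm
  · exact (eval_dx_dt_iterate _ _ _).trans (Ev_v s.eval _ _).symm
  · exact ((eval_dy _).trans (congrArg Dy (eval_dx_dt_iterate _ _ _))).trans (Ev_vy s.eval _ _).symm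
  · exact (eval_dx_dt_iterate _ _ _).trans (Ev_p s.eval _ _).symm
  · exact ((eval_dy _).trans (congrArg Dy (eval_dx_dt_iterate _ _ _))).trans (Ev_py s.eval _ _).symm
  · exact (eval_dx_dt_iterate _ _ _).trans (Ev_q s.eval _ _).symm
  · exact ((eval_dy _).trans (congrArg Dy (eval_dx_dt_iterate _ _ _))).trans (Ev_qy s.eval _ _).symm
  · exact (eval_dt_iterate _ _).trans (Ev_w1 s.eval _).symm
  · exact (eval_dt_iterate _ _).trans (Ev_w2 s.eval _).symm
  · exact (eval_dt_iterate _ _).trans (Ev_w3 s.eval _).symm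
  · exact (eval_dt_iterate _ _).trans (Ev_w4 s.eval _).symm

/-- Expressions that vanish if the section generates a symmetry. -/
def Section.defects (s : Section) : List Expr :=
  [ev s RhsU - dy (dy s.u), ev s RhsV - dy (dy s.v), ev s RhsP - dy (dy s.p),
    ev s RhsQ - dy (dy s.q), ev s X1 - dx s.w1, ev s X2 - dx s.w2, ev s X3 - dx s.w3,
    ev s X4 - dx s.w4, ev s Y1 - dy s.w1, ev s Y2 - dy s.w2, ev s Y3 - dy s.w3,
    ev s Y4 - dy s.w4]

theorem Section.isOddNonlocalSymmetry {s : Section} (h : s.eval.HasDegrees)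
    (hs : s.defects.all isZero = true) : IsOddNonlocalSymmetry s.eval := by
  simp only [defects, List.all_cons, List.all_nil, Bool.and_true, Bool.and_eq_true] at hs
  have key : ∀ {a b : Expr}, isZero (ev s a - b) = true → Ev s.eval a.eval = b.eval :=
    fun hab => (eval_ev h _).symm.trans (eval_congr hab)
  obtain ⟨hu, hv, hp, hq, hx1, hx2, hx3, hx4, hy1, hy2, hy3, hy4⟩ := hs
  refine .of_hasDegrees h ?_ ?_ ?_ ?_ ?_ ?_ ?_ ?_ ?_ ?_ ?_ ?_
  · rw [← eval_RhsU, key hu, eval_dy, eval_dy]; rfl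
  · rw [← eval_RhsV, key hv, eval_dy, eval_dy]; rfl
  · rw [← eval_RhsP, key hp, eval_dy, eval_dy]; rfl
  · rw [← eval_RhsQ, key hq, eval_dy, eval_dy]; rfl
  · rw [← eval_X1, key hx1, eval_dx]; rfl
  · rw [← eval_X2, key hx2, eval_dx]; rfl
  · rw [← eval_X3, key hx3, eval_dx]; rfl
  · rw [← eval_X4, key hx4, eval_dx]; rfl
  · rw [← eval_Y1, key hy1, eval_dy]; rfl
  · rw [← eval_Y2, key hy2, eval_dy]; rfl
  · rw [← eval_Y3, key hy3, eval_dy]; rfl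
  · rw [← eval_Y4, key hy4, eval_dy]; rfl

end Expr

/-! ### Functions that do not depend on some coordinates -/

/-- The function `F` does not depend on the coordinates in `s`. -/
def Avoids (s : Coord → Bool) (F : SuperFn) : Prop := ∀ c, s c = true → partialDer c F = 0

namespace Avoids

variable {s : Coord → Bool} {F G : SuperFn}

theorem add (hF : Avoids s F) (hG : Avoids s G) : Avoids s (F + G) := fun c hc => by
  rw [map_add, hF c hc, hG c hc, add_zero]

theorem neg (hF : Avoids s F) : Avoids s (-F) := fun c hc => by
  rw [map_neg, hF c hc, neg_zero]

theorem mul (hF : Avoids s F) (hG : Avoids s G) : Avoids s (F * G) := fun c hc => by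
  rw [partialDer_mul, hF c hc, hG c hc, zero_mul, mul_zero, add_zero]

theorem gen {c : Coord} (hc : s c = false) : Avoids s (gen c) := fun d hd => by
  rw [partialDer_gen, if_neg (fun h => by rw [h, hd] at hc; exact Bool.noConfusion hc)]

/-- A vector field `V` preserves the independence of the coordinates in `s`, if they occur only
in the values of `V` on coordinates in `s`. -/
theorem map {e : Bool} {V : Module.End ℝ SuperFn} (hV : IsVectorField e V)
    (h : ∀ d, s d = false → Avoids s (V (PavlovMikhalev.gen d))) (hF : Avoids s F) :
    Avoids s (V F) := fun c hc => by
  rw [hV.partialDer_apply, hF c hc, map_zero, smul_zero, zero_add, vectorField_apply]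
  refine finsum_eq_zero_of_forall_eq_zero fun d => ?_
  cases hd : s d
  · rw [h d hd c hc, zero_mul]
  · rw [hF d hd, mul_zero]

theorem map_pow {e : Bool} {V : Module.End ℝ SuperFn} (hV : IsVectorField e V)
    (h : ∀ d, s d = false → Avoids s (V (PavlovMikhalev.gen d))) (hF : Avoids s F) (n : ℕ) :
    Avoids s ((V ^ n) F) := by
  induction n with
  | zero => exact hF
  | succ n ih => rw [pow_succ', Module.End.mul_apply]; exact ih.map hV h

end Avoids

/-- The coordinates in `s` do not occur in an expression. -/
def Expr.avoids (s : Coord → Bool) : Expr → Bool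
  | const _ _ => true
  | gen c => !s c
  | add a b => avoids s a && avoids s b
  | mul a b => avoids s a && avoids s b
  | neg a => avoids s a

theorem Expr.avoids_eval {s : Coord → Bool} {a : Expr} (h : a.avoids s = true) :
    Avoids s a.eval := by
  induction a with
  | const n e => exact fun c _ => by rw [eval_const, map_smul, partialDer_one, smul_zero]
  | gen c => exact .gen (by simpa [avoids] using h)
  | add a b ha hb =>
    rw [avoids, Bool.and_eq_true] at h
    exact (ha h.1).add (hb h.2)
  | mul a b ha hb =>
    rw [avoids, Bool.and_eq_true] at h
    exact (ha h.1).mul (hb h.2)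
  | neg a ha => exact (ha h).neg

/-! ### The values of the total derivatives on coordinates -/

namespace Coord

/-- The independent variables. -/
def isBase : Coord → Bool
  | .inl .x => true
  | .inl .y => true
  | .inl .t => true
  | _ => false

/-- The nonlocal variables. -/
def isNonlocal : Coord → Bool
  | .inr (.w1 _) => true
  | .inr (.w2 _) => true
  | .inr (.w3 _) => true
  | .inr (.w4 _) => true
  | _ => false

/-- The coordinate `∂_x c`, for local dependent coordinates `c`. -/
def xShift : Coord → Coord
  | .inl (.u k l) => .inl (.u (k + 1) l)
  | .inl (.uy k l) => .inl (.uy (k + 1) l)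
  | .inl (.v k l) => .inl (.v (k + 1) l)
  | .inl (.vy k l) => .inl (.vy (k + 1) l)
  | .inr (.p k l) => .inr (.p (k + 1) l)
  | .inr (.py k l) => .inr (.py (k + 1) l)
  | .inr (.q k l) => .inr (.q (k + 1) l)
  | .inr (.qy k l) => .inr (.qy (k + 1) l)
  | c => c

/-- The coordinate `∂_t c`, for dependent coordinates `c`. -/
def tShift : Coord → Coord
  | .inl (.u k l) => .inl (.u k (l + 1))
  | .inl (.uy k l) => .inl (.uy k (l + 1))
  | .inl (.v k l) => .inl (.v k (l + 1))
  | .inl (.vy k l) => .inl (.vy k (l + 1))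
  | .inr (.p k l) => .inr (.p k (l + 1))
  | .inr (.py k l) => .inr (.py k (l + 1))
  | .inr (.q k l) => .inr (.q k (l + 1))
  | .inr (.qy k l) => .inr (.qy k (l + 1))
  | .inr (.w1 l) => .inr (.w1 (l + 1))
  | .inr (.w2 l) => .inr (.w2 (l + 1))
  | .inr (.w3 l) => .inr (.w3 (l + 1))
  | .inr (.w4 l) => .inr (.w4 (l + 1))
  | c => c

/-- The coordinates `y`, `p_{yxσ}`, `p_{yτ}`, `q_{yxσ}` and `q_{yτ}`, where `τ` consists of
derivatives with respect to `t`. -/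
inductive Family
  | y | pyx | pyt | qyx | qyt

/-- The coordinates in a family. -/
def Family.mem : Family → Coord → Bool
  | .y, .inl .y => true
  | .pyx, .inr (.py (_ + 1) _) => true
  | .pyt, .inr (.py 0 _) => true
  | .qyx, .inr (.qy (_ + 1) _) => true
  | .qyt, .inr (.qy 0 _) => true
  | _, _ => false

theorem isNonlocal_tShift (c : Coord) : isNonlocal (tShift c) = isNonlocal c := by
  rcases c with (_ | _ | _ | _ | _ | _ | _) | (_ | _ | _ | _ | _ | _ | _ | _) <;> rfl

theorem Family.mem_tShift (f : Family) (c : Coord) : f.mem (tShift c) = f.mem c := by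
  rcases c with (_ | _ | _ | _ | _ | _ | _) | (_ | ⟨_ | _, _⟩ | _ | ⟨_ | _, _⟩ | _ | _ | _ | _) <;>
    cases f <;> rfl

end Coord

open Coord

theorem partialDer_zero_of_isBase {c d : Coord} (hd : isBase d = true) {V : Module.End ℝ SuperFn}
    (hx : V (gen (.inl .x)) = 0 ∨ V (gen (.inl .x)) = 1)
    (hy : V (gen (.inl .y)) = 0 ∨ V (gen (.inl .y)) = 1)
    (ht : V (gen (.inl .t)) = 0 ∨ V (gen (.inl .t)) = 1) : partialDer c (V (gen d)) = 0 := by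
  have h : V (gen d) = 0 ∨ V (gen d) = 1 := by
    rcases d with (_ | _ | _ | _ | _ | _ | _) | _ <;> first | assumption | cases hd
  rcases h with h | h
  · rw [h, map_zero]
  · rw [h, partialDer_one]

theorem partialDer_Dt_gen_of_isBase {d : Coord} (hd : isBase d = true) (c : Coord) :
    partialDer c (Dt (gen d)) = 0 :=
  partialDer_zero_of_isBase hd (.inl Dt_gen_x) (.inl Dt_gen_y) (.inr Dt_gen_t)

theorem partialDer_Dx_gen_of_isBase {d : Coord} (hd : isBase d = true) (c : Coord) :
    partialDer c (Dx (gen d)) = 0 :=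
  partialDer_zero_of_isBase hd (.inr Dx_gen_x) (.inl Dx_gen_y) (.inl Dx_gen_t)

theorem partialDer_Dy_gen_of_isBase {d : Coord} (hd : isBase d = true) (c : Coord) :
    partialDer c (Dy (gen d)) = 0 :=
  partialDer_zero_of_isBase hd (.inl Dy_gen_x) (.inr Dy_gen_y) (.inl Dy_gen_t)

theorem Dt_gen {d : Coord} (hd : isBase d = false) : Dt (gen d) = gen (tShift d) := by
  rcases d with (_ | _ | _ | _ | _ | _ | _) | (_ | _ | _ | _ | _ | _ | _ | _)
  exacts [Bool.noConfusion hd, Bool.noConfusion hd, Bool.noConfusion hd, Dt_u _ _, Dt_uy _ _,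
    Dt_v _ _, Dt_vy _ _, Dt_p _ _, Dt_py _ _, Dt_q _ _, Dt_qy _ _, Dt_w1 _, Dt_w2 _, Dt_w3 _,
    Dt_w4 _]

theorem Dx_gen {d : Coord} (hd : isBase d = false) (hd' : isNonlocal d = false) :
    Dx (gen d) = gen (xShift d) := by
  rcases d with (_ | _ | _ | _ | _ | _ | _) | (_ | _ | _ | _ | _ | _ | _ | _)
  exacts [Bool.noConfusion hd, Bool.noConfusion hd, Bool.noConfusion hd, Dx_u _ _, Dx_uy _ _,
    Dx_v _ _, Dx_vy _ _, Dx_p _ _, Dx_py _ _, Dx_q _ _, Dx_qy _ _, Bool.noConfusion hd',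
    Bool.noConfusion hd', Bool.noConfusion hd', Bool.noConfusion hd']

open scoped Classical in
theorem partialDer_Dx_gen {c d : Coord} (hc : isBase c = false) (hd : isNonlocal d = false) :
    partialDer c (Dx (gen d)) = if xShift d = c then 1 else 0 := by
  cases hd' : isBase d
  · rw [Dx_gen hd' hd, partialDer_gen]
  · rw [partialDer_Dx_gen_of_isBase hd', if_neg]
    rintro rfl
    rcases d with (_ | _ | _ | _ | _ | _ | _) | _ <;>
      first | exact Bool.noConfusion hd' | exact Bool.noConfusion hc

namespace Avoids

variable {s : Coord → Bool} {F : SuperFn}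

theorem Dt_gen (hs : ∀ c, s (tShift c) = s c) {d : Coord} (hd : s d = false) :
    Avoids s (Dt (PavlovMikhalev.gen d)) := by
  cases hd' : isBase d
  · rw [PavlovMikhalev.Dt_gen hd']
    exact .gen (by rw [hs, hd])
  · exact fun c _ => partialDer_Dt_gen_of_isBase hd' c

theorem Dt_pow (hs : ∀ c, s (tShift c) = s c) (hF : Avoids s F) (l : ℕ) :
    Avoids s ((Dt ^ l) F) :=
  hF.map_pow isVectorField_Dt (fun _ => Dt_gen hs) l

/-- Coordinates that do not occur in the covering equations do not occur in the values of `D_x`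
on nonlocal variables. -/
theorem Dx_gen_of_isNonlocal (hs : ∀ c, s (tShift c) = s c) (h1 : Expr.X1.avoids s = true)
    (h2 : Expr.X2.avoids s = true) (h3 : Expr.X3.avoids s = true) (h4 : Expr.X4.avoids s = true)
    {d : Coord} (hd : isNonlocal d = true) : Avoids s (Dx (PavlovMikhalev.gen d)) := by
  have h := fun {a : Expr} (ha : a.avoids s = true) l => (Expr.avoids_eval ha).Dt_pow hs l
  rcases d with (_ | _ | _ | _ | _ | _ | _) | (_ | _ | _ | _ | _ | _ | _ | _)
  iterate 11 exact Bool.noConfusion hd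
  · exact (Dx_w1 _).symm ▸ Expr.eval_X1 ▸ h h1 _
  · exact (Dx_w2 _).symm ▸ Expr.eval_X2 ▸ h h2 _
  · exact (Dx_w3 _).symm ▸ Expr.eval_X3 ▸ h h3 _
  · exact (Dx_w4 _).symm ▸ Expr.eval_X4 ▸ h h4 _

end Avoids

/-- `D_x` of a coordinate does not depend on nonlocal variables. -/
theorem avoids_isNonlocal_Dx_gen (d : Coord) : Avoids isNonlocal (Dx (gen d)) := by
  cases hd : isNonlocal d
  · cases hd' : isBase d
    · rw [Dx_gen hd' hd]
      refine .gen ?_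
      rcases d with (_ | _ | _ | _ | _ | _ | _) | (_ | _ | _ | _ | _ | _ | _ | _) <;>
        first | rfl | exact Bool.noConfusion hd
    · exact fun c _ => partialDer_Dx_gen_of_isBase hd' c
  · exact .Dx_gen_of_isNonlocal isNonlocal_tShift rfl rfl rfl rfl hd

/-- `D_y` of a coordinate does not depend on nonlocal variables. -/
theorem avoids_isNonlocal_Dy_gen (d : Coord) : Avoids isNonlocal (Dy (gen d)) := by
  have ht := fun {a : Expr} (ha : a.avoids isNonlocal = true) l =>
    (Expr.avoids_eval ha).Dt_pow isNonlocal_tShift l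
  have hx := fun {a : Expr} (ha : a.avoids isNonlocal = true) k l =>
    (ht ha l).map_pow isVectorField_Dx (fun d _ => avoids_isNonlocal_Dx_gen d) k
  rcases d with (_ | _ | _ | _ | _ | _ | _) | (_ | _ | _ | _ | _ | _ | _ | _)
  · exact fun c _ => partialDer_Dy_gen_of_isBase rfl c
  · exact fun c _ => partialDer_Dy_gen_of_isBase rfl c
  · exact fun c _ => partialDer_Dy_gen_of_isBase rfl c
  · exact (Dy_u _ _).symm ▸ .gen (c := .inl (.uy _ _)) rfl
  · exact (Dy_uy _ _).symm ▸ Expr.eval_RhsU ▸ hx rfl _ _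
  · exact (Dy_v _ _).symm ▸ .gen (c := .inl (.vy _ _)) rfl
  · exact (Dy_vy _ _).symm ▸ Expr.eval_RhsV ▸ hx rfl _ _
  · exact (Dy_p _ _).symm ▸ .gen (c := .inr (.py _ _)) rfl
  · exact (Dy_py _ _).symm ▸ Expr.eval_RhsP ▸ hx rfl _ _
  · exact (Dy_q _ _).symm ▸ .gen (c := .inr (.qy _ _)) rfl
  · exact (Dy_qy _ _).symm ▸ Expr.eval_RhsQ ▸ hx rfl _ _
  · exact (Dy_w1 _).symm ▸ Expr.eval_Y1 ▸ ht rfl _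
  · exact (Dy_w2 _).symm ▸ Expr.eval_Y2 ▸ ht rfl _
  · exact (Dy_w3 _).symm ▸ Expr.eval_Y3 ▸ ht rfl _
  · exact (Dy_w4 _).symm ▸ Expr.eval_Y4 ▸ ht rfl _

open Coord

/-! ### Functions annihilated by the total derivatives -/

theorem vectorField_eq_single {a : Coord → SuperFn} {F : SuperFn} (d : Coord)
    (h : ∀ c, c ≠ d → a c * partialDer c F = 0) : vectorField a F = a d * partialDer d F :=
  finsum_eq_single _ d h

/-- Differentiate `Dx F = 0` by c: the term `Dx (partialDer c F)` drops out, leaving a linear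
relation between the partial derivatives of F. The independence results below are read off from such
relations for suitable c. -/
theorem vectorField_partialDer_Dx {F : SuperFn} (hF : Dx F = 0) {c : Coord}
    (hc : partialDer c F = 0) : vectorField (fun d => partialDer c (Dx (gen d))) F = 0 := by
  have h := isVectorField_Dx.partialDer_apply c F
  rwa [hF, hc, map_zero, map_zero, smul_zero, zero_add, eq_comm] at h

/-- If `c 0, c 1, …` are coordinates with `D_x (c k) = c (k + 1)`, and this is the only
occurrence of the coordinates `c (k + 1)` in `D_x`, then functions annihilated by `D_x` do not
depend on any of them. -/
theorem partialDer_eq_zero_of_Dx {F : SuperFn} (hF : Dx F = 0) {c : ℕ → Coord}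
    (hc : Function.Injective c) (h : ∀ k, partialDer (c (k + 1)) (Dx (gen (c k))) = 1)
    (h' : ∀ k d, d ≠ c k → partialDer d F = 0 ∨ partialDer (c (k + 1)) (Dx (gen d)) = 0) (k : ℕ) :
    partialDer (c k) F = 0 := by
  -- F depends on finitely many coordinates, so its derivatives along `c n` vanish for large n; the
  -- descent starts there.
  obtain ⟨N, hN⟩ := ((finite_partialDer_ne_zero F).preimage hc.injOn).bddAbove
  have h1 : ∀ n, N < n → partialDer (c n) F = 0 := fun n hn => by
    by_contra hne
    exact absurd (hN hne) (not_le.2 hn)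
  -- The relation given by `c (k + 1)` contains only the term of `c k`, with coefficient 1.
  have h2 : ∀ k, partialDer (c (k + 1)) F = 0 → partialDer (c k) F = 0 := fun k hk => by
    have := vectorField_partialDer_Dx hF hk
    rwa [vectorField_eq_single (c k) fun d hd => ?_, h, one_mul] at this
    rcases h' k d hd with h | h
    · rw [h, mul_zero]
    · rw [h, zero_mul]
  have h3 : ∀ m k, N < k + m → partialDer (c k) F = 0 := by
    intro m
    induction m with
    | zero => exact h1
    | succ m ih => exact fun k hk => h2 k (ih (k + 1) (by omega))
  exact h3 (N + 1) k (by omega)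

/-- In a local function, the highest x-derivative of each family would produce a still higher one in
`Dx F`, and nothing could cancel it. Dependence on x, y, t is not excluded here. -/
theorem partialDer_eq_zero_of_avoids_isNonlocal {F : SuperFn} (hF : Dx F = 0)
    (hloc : Avoids isNonlocal F) {c : Coord} (hc : isBase c = false) : partialDer c F = 0 := by
  have key : ∀ f : ℕ → Coord, Function.Injective f → (∀ k, isBase (f k) = false) →
      (∀ k, isNonlocal (f k) = false) → (∀ k d, xShift d = f (k + 1) ↔ d = f k) →
      ∀ k, partialDer (f k) F = 0 := by
    intro f hf hb hn hs
    refine partialDer_eq_zero_of_Dx hF hf (fun k => ?_) fun k d hd => ?_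
    · rw [partialDer_Dx_gen (hb _) (hn _), if_pos ((hs _ _).2 rfl)]
    · cases hd' : isNonlocal d
      · rw [partialDer_Dx_gen (hb _) hd', if_neg ((hs _ _).not.2 hd)]
        exact .inr rfl
      · exact .inl (hloc d hd')
  cases hc' : isNonlocal c
  · rcases c with (_ | _ | _ | ⟨k, l⟩ | ⟨k, l⟩ | ⟨k, l⟩ | ⟨k, l⟩) |
      (⟨k, l⟩ | ⟨k, l⟩ | ⟨k, l⟩ | ⟨k, l⟩ | _ | _ | _ | _)
    any_goals cases hc
    any_goals cases hc'
    · exact key (fun k => .inl (.u k l)) (fun a b h => by simpa using h) (fun _ => rfl)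
        (fun _ => rfl) (fun k d => by rcases d with d | d <;> cases d <;> simp [xShift]) k
    · exact key (fun k => .inl (.uy k l)) (fun a b h => by simpa using h) (fun _ => rfl)
        (fun _ => rfl) (fun k d => by rcases d with d | d <;> cases d <;> simp [xShift]) k
    · exact key (fun k => .inl (.v k l)) (fun a b h => by simpa using h) (fun _ => rfl)
        (fun _ => rfl) (fun k d => by rcases d with d | d <;> cases d <;> simp [xShift]) k
    · exact key (fun k => .inl (.vy k l)) (fun a b h => by simpa using h) (fun _ => rfl)
        (fun _ => rfl) (fun k d => by rcases d with d | d <;> cases d <;> simp [xShift]) k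
    · exact key (fun k => .inr (.p k l)) (fun a b h => by simpa using h) (fun _ => rfl)
        (fun _ => rfl) (fun k d => by rcases d with d | d <;> cases d <;> simp [xShift]) k
    · exact key (fun k => .inr (.py k l)) (fun a b h => by simpa using h) (fun _ => rfl)
        (fun _ => rfl) (fun k d => by rcases d with d | d <;> cases d <;> simp [xShift]) k
    · exact key (fun k => .inr (.q k l)) (fun a b h => by simpa using h) (fun _ => rfl)
        (fun _ => rfl) (fun k d => by rcases d with d | d <;> cases d <;> simp [xShift]) k
    · exact key (fun k => .inr (.qy k l)) (fun a b h => by simpa using h) (fun _ => rfl)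
        (fun _ => rfl) (fun k d => by rcases d with d | d <;> cases d <;> simp [xShift]) k
  · exact hloc c hc'

/-- A local function of positive degree annihilated by `D_x` vanishes. -/
theorem eq_zero_of_Dx_of_avoids_isNonlocal {n : ℕ} {F : SuperFn} (hn : F ∈ homogeneous (n + 1))
    (hF : Dx F = 0) (hloc : Avoids isNonlocal F) : F = 0 :=
  eq_zero_of_partialDer_inr_eq_zero hn fun _ =>
    partialDer_eq_zero_of_avoids_isNonlocal hF hloc rfl

/-- The nonlocal variables do not occur in the coefficients of `Dx`, so differentiation along them
commutes with `Dx`; there is no sign because `Dx` is even. -/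
theorem Dx_partialDer_of_isNonlocal {F : SuperFn} (hF : Dx F = 0) {c : Coord}
    (hc : isNonlocal c = true) : Dx (partialDer c F) = 0 := by
  have h := isVectorField_Dx.partialDer_apply c F
  rw [hF, map_zero, vectorField_apply, finsum_eq_zero_of_forall_eq_zero fun d => by
    rw [avoids_isNonlocal_Dx_gen d c hc, zero_mul]] at h
  simpa [koszul] using h.symm

theorem Dy_partialDer_of_isNonlocal {F : SuperFn} (hF : Dy F = 0) {c : Coord}
    (hc : isNonlocal c = true) : Dy (partialDer c F) = 0 := by
  have h := isVectorField_Dy.partialDer_apply c F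
  rw [hF, map_zero, vectorField_apply, finsum_eq_zero_of_forall_eq_zero fun d => by
    rw [avoids_isNonlocal_Dy_gen d c hc, zero_mul]] at h
  simpa [koszul] using h.symm

/-- A function of degree 0 contains no nonlocal variable, hence depends on x, y, t only, and on such
functions `Dy` is the partial derivative by y. -/
theorem partialDer_y_eq_zero {F : SuperFn} (hF : F ∈ homogeneous 0) (hx : Dx F = 0)
    (hy : Dy F = 0) : partialDer (.inl .y) F = 0 := by
  have hloc : Avoids isNonlocal F := by
    rintro (c | c) hc
    · cases c <;> cases hc
    · exact partialDer_inr_eq_zero hF c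
  rw [isVectorField_Dy.eq_vectorField, vectorField_eq_single (.inl .y), Dy_gen_y, one_mul] at hy
  · exact hy
  · intro d hd
    cases hd' : isBase d
    · rw [partialDer_eq_zero_of_avoids_isNonlocal hx hloc hd', mul_zero]
    · rcases d with (_ | _ | _ | _ | _ | _ | _) | _
      any_goals cases hd'
      · rw [Dy_gen_x, zero_mul]
      · exact absurd rfl hd
      · rw [Dy_gen_t, zero_mul]

/-! #### Linear functions -/

section Linear

variable {F : SuperFn}

/-- F need not be local: the `X_i` contain `p_y` and `p_yt` but no `p_y` differentiated by x, so the
nonlocal terms are absent from the relation given by index k + 1. That relation controls index k, so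
k = 0 is covered too. -/
theorem partialDer_py_eq_zero (hF : Dx F = 0) (k l : ℕ) : partialDer (.inr (.py k l)) F = 0 := by
  refine partialDer_eq_zero_of_Dx hF (c := fun k => .inr (.py k l)) (fun a b h => by simpa using h)
    (fun k => ?_) (fun k d hd => .inr ?_) k
  · rw [partialDer_Dx_gen rfl rfl]
    exact if_pos rfl
  · cases hd' : isNonlocal d
    · rw [partialDer_Dx_gen rfl hd', if_neg]
      rcases d with d | d <;> cases d <;> simp [xShift] at hd ⊢
      exact hd
    · exact Avoids.Dx_gen_of_isNonlocal (Family.mem_tShift .pyx) rfl rfl rfl rfl hd' _ rfl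

theorem partialDer_qy_eq_zero (hF : Dx F = 0) (k l : ℕ) : partialDer (.inr (.qy k l)) F = 0 := by
  refine partialDer_eq_zero_of_Dx hF (c := fun k => .inr (.qy k l)) (fun a b h => by simpa using h)
    (fun k => ?_) (fun k d hd => .inr ?_) k
  · rw [partialDer_Dx_gen rfl rfl]
    exact if_pos rfl
  · cases hd' : isNonlocal d
    · rw [partialDer_Dx_gen rfl hd', if_neg]
      rcases d with d | d <;> cases d <;> simp [xShift] at hd ⊢
      exact hd
    · exact Avoids.Dx_gen_of_isNonlocal (Family.mem_tShift .qyx) rfl rfl rfl rfl hd' _ rfl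

/-- If `D_x F = 0` and the derivatives of `F` along the nonlocal variables do not depend on `y`,
then the relation between them given by a coordinate `c` may be differentiated by `y`. -/
theorem vectorField_partialDer_y_Dx (hF : Dx F = 0) {c : Coord} (hc : partialDer c F = 0)
    (hl : ∀ d, isNonlocal d = false → partialDer c (Dx (gen d)) = 0)
    (hy : ∀ d, isNonlocal d = true → partialDer (.inl .y) (partialDer d F) = 0) :
    vectorField (fun d => partialDer c (partialDer (.inl .y) (Dx (gen d)))) F = 0 := by
  have h := congrArg (partialDer (.inl .y)) (vectorField_partialDer_Dx hF hc)
  rw [map_zero, vectorField_eq_sum _ fun d hd => partialDer_eq_zero_of_notMem hd, map_sum] at h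
  rw [vectorField_eq_sum _ fun d hd => partialDer_eq_zero_of_notMem hd, ← h]
  refine Finset.sum_congr rfl fun d _ => ?_
  rw [partialDer_mul, partialDer_comm c]
  have hk : koszul (Coord.odd c) (Coord.odd (.inl .y)) = 1 := by simp [koszul, Coord.odd]
  rw [hk, one_smul]
  cases hd : isNonlocal d
  · simp [hl d hd, parityPow]
  · rw [hy d hd, mul_zero, add_zero]

/-- The coefficients of `Dt` do not depend on y. -/
theorem partialDer_y_Dt_pow (l : ℕ) (G : SuperFn) :
    partialDer (.inl .y) ((Dt ^ l) G) = (Dt ^ l) (partialDer (.inl .y) G) := by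
  have h : ∀ G, partialDer (.inl .y) (Dt G) = Dt (partialDer (.inl .y) G) := by
    intro G
    rw [isVectorField_Dt.partialDer_apply, vectorField_apply,
      finsum_eq_zero_of_forall_eq_zero fun d => ?_, add_zero]
    · simp [koszul, Coord.odd]
    · cases hd : isBase d
      · rw [Dt_gen hd, partialDer_gen, if_neg, zero_mul]
        rcases d with d | d <;> cases d <;> simp [tShift]
        exact Bool.noConfusion hd
      · rw [partialDer_Dt_gen_of_isBase hd, zero_mul]
  exact IsVectorField.pow_comm (LinearMap.ext h) l G

end Linear

open Coord

/-! ### Coefficients of the t-derivatives of p_y and q_y in the covering equations. -/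

theorem Dt_pow_py (k m l : ℕ) : (Dt ^ l) (py k m) = py k (m + l) := by
  induction l with
  | zero => rfl
  | succ l ih => rw [← Dt_Dt_pow, ih, Dt_py, add_assoc]

theorem Dt_pow_qy (k m l : ℕ) : (Dt ^ l) (qy k m) = qy k (m + l) := by
  induction l with
  | zero => rfl
  | succ l ih => rw [← Dt_Dt_pow, ih, Dt_qy, add_assoc]

/-- G is free of t-derivatives of `p_y`, and `Dt` cannot create any, so they come only from the
separated term. -/
theorem partialDer_py_Dt_pow {G : SuperFn} (hG : Avoids Family.pyt.mem G) (r : ℝ) (m l j : ℕ) :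
    partialDer (.inr (.py 0 j)) ((Dt ^ l) (G + r • py 0 m)) =
      if m + l = j then r • 1 else 0 := by
  rw [map_add, map_add, hG.Dt_pow (Family.mem_tShift .pyt) l _ rfl, zero_add, map_smul, map_smul,
    Dt_pow_py, show py 0 (m + l) = gen (.inr (.py 0 (m + l))) from rfl, partialDer_gen]
  simp

theorem partialDer_qy_Dt_pow {G : SuperFn} (hG : Avoids Family.qyt.mem G) (r : ℝ) (m l j : ℕ) :
    partialDer (.inr (.qy 0 j)) ((Dt ^ l) (G + r • qy 0 m)) =
      if m + l = j then r • 1 else 0 := by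
  rw [map_add, map_add, hG.Dt_pow (Family.mem_tShift .qyt) l _ rfl, zero_add, map_smul, map_smul,
    Dt_pow_qy, show qy 0 (m + l) = gen (.inr (.qy 0 (m + l))) from rfl, partialDer_gen]
  simp

theorem X1_eq : X1 = (2 * Expr.U 1 0 * Expr.P 1 0).eval + (1 : ℝ) • py 0 0 := by
  rw [one_smul, ← Expr.eval_X1]; rfl

theorem X2_eq : X2 = (-(Expr.V 1 0 * Expr.P 1 0) - Expr.U 1 0 * Expr.Q 1 0).eval +
    (1 : ℝ) • qy 0 0 := by
  rw [one_smul, ← Expr.eval_X2, ← Expr.eval_QY, ← Expr.eval_add]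
  exact Expr.eval_congr (by decide +kernel)

/-- Makes differentiation by y computable on expressions, so that the y-linear parts of `X3` and
`X4` can be found by normal form. -/
theorem partialDer_y_eval (a : Expr) : (Expr.der false (fun
    | .inl .y => .const 1 0
    | _ => 0) a).eval = partialDer (.inl .y) a.eval := by
  refine Expr.eval_der (isVectorField_partialDer (.inl .y)) (fun c => ?_) a
  rw [partialDer_gen]
  rcases c with c | c <;> cases c <;> simp [Expr.eval_one]

theorem partialDer_y_X3 : partialDer (.inl .y) X3 =
    (Expr.U 2 0 * Expr.P 0 1 - Expr.U 1 1 * Expr.P 1 0).eval + (-1 / 2 : ℝ) • py 0 1 := by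
  have h : (-1 / 2 : ℝ) • py 0 1 = (-Expr.half * Expr.PY 0 1).eval := by
    rw [Expr.eval_mul, Expr.eval_neg, Expr.eval_half, neg_mul, smul_one_mul, Expr.eval_PY, neg_div,
      neg_smul]
  rw [h, ← Expr.eval_X3, ← partialDer_y_eval, ← Expr.eval_add]
  exact Expr.eval_congr (by decide +kernel)

theorem partialDer_y_X4 : partialDer (.inl .y) X4 =
    (Expr.V 2 0 * Expr.P 0 1 - Expr.V 1 1 * Expr.P 1 0 + Expr.U 2 0 * Expr.Q 0 1
      - Expr.U 1 1 * Expr.Q 1 0).eval + (1 : ℝ) • qy 0 1 := by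
  rw [one_smul, ← Expr.eval_QY, ← Expr.eval_X4, ← partialDer_y_eval, ← Expr.eval_add]
  exact Expr.eval_congr (by decide +kernel)

theorem partialDer_y_X1 : partialDer (.inl .y) X1 = 0 :=
  Expr.eval_X1 ▸ Expr.avoids_eval (s := Family.y.mem) rfl _ rfl

theorem partialDer_y_X2 : partialDer (.inl .y) X2 = 0 :=
  Expr.eval_X2 ▸ Expr.avoids_eval (s := Family.y.mem) rfl _ rfl

theorem Expr.partialDer_Dt_pow_eval {s : Coord → Bool} (hs : ∀ c, s (tShift c) = s c) {a : Expr}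
    (ha : a.avoids s = true) (l : ℕ) {c : Coord} (hc : s c = true) :
    partialDer c ((Dt ^ l) a.eval) = 0 :=
  (avoids_eval ha).Dt_pow hs l c hc

/-- A linear function annihilated by the total derivatives `D_x` and `D_y` is local. -/
theorem avoids_isNonlocal_of_linear {F : SuperFn} (hn : F ∈ homogeneous 1) (hx : Dx F = 0)
    (hy : Dy F = 0) : Avoids isNonlocal F := by
  -- The coefficients of a linear F along nonlocal variables have degree 0 and are killed by `Dx`
  -- and `Dy`, so they do not depend on y. Relations between them may therefore be differentiated by
  -- y.
  have hg : ∀ d, isNonlocal d = true → partialDer (.inl .y) (partialDer d F) = 0 := by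
    rintro (d | d) hd
    · cases d <;> cases hd
    · exact partialDer_y_eq_zero (partialDer_inr_mem_homogeneous hn d)
        (Dx_partialDer_of_isNonlocal hx hd) (Dy_partialDer_of_isNonlocal hy hd)
  have hpl : ∀ j d, isNonlocal d = false → partialDer (.inr (.py 0 j)) (Dx (gen d)) = 0 := by
    intro j d hd
    rw [partialDer_Dx_gen rfl hd, if_neg]
    rcases d with d | d <;> cases d <;> simp [xShift]
  have hql : ∀ j d, isNonlocal d = false → partialDer (.inr (.qy 0 j)) (Dx (gen d)) = 0 := by
    intro j d hd
    rw [partialDer_Dx_gen rfl hd, if_neg]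
    rcases d with d | d <;> cases d <;> simp [xShift]
  have swap : ∀ (c : Coord) d, partialDer c (Dx (gen d)) = 0 →
      partialDer c (partialDer (.inl .y) (Dx (gen d))) = 0 := by
    intro c d h
    rw [partialDer_comm, h, map_zero, smul_zero]
  have e1 : ∀ l, Dx (gen (.inr (.w1 l))) = (Dt ^ l) X1 := Dx_w1
  have e2 : ∀ l, Dx (gen (.inr (.w2 l))) = (Dt ^ l) X2 := Dx_w2
  have e3 : ∀ l, Dx (gen (.inr (.w3 l))) = (Dt ^ l) X3 := Dx_w3
  have e4 : ∀ l, Dx (gen (.inr (.w4 l))) = (Dt ^ l) X4 := Dx_w4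
  -- After differentiation by y only `X3` contains t-derivatives of `p_y`, through `-p_yt / 2`. The
  -- index j + 1 accounts for the extra t-derivative.
  have h3 : ∀ j, partialDer (.inr (.w3 j)) F = 0 := by
    intro j
    have h := vectorField_partialDer_y_Dx hx (partialDer_py_eq_zero hx 0 (j + 1)) (hpl _) hg
    rw [vectorField_eq_single (.inr (.w3 j)), e3, partialDer_y_Dt_pow, partialDer_y_X3,
      partialDer_py_Dt_pow (Expr.avoids_eval rfl), if_pos (add_comm _ _), smul_one_mul] at h
    · exact (smul_eq_zero.1 h).resolve_left (by norm_num)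
    · intro d hd
      cases hd' : isNonlocal d
      · rw [swap _ _ (hpl _ _ hd'), zero_mul]
      · rcases d with d | d <;> cases d
        any_goals cases hd'
        · rw [e1, partialDer_y_Dt_pow, partialDer_y_X1, map_zero, map_zero, zero_mul]
        · rw [e2, partialDer_y_Dt_pow, partialDer_y_X2, map_zero, map_zero, zero_mul]
        · rw [e3, partialDer_y_Dt_pow, partialDer_y_X3,
            partialDer_py_Dt_pow (Expr.avoids_eval rfl), if_neg, zero_mul]
          rintro h'
          exact hd (by congr 2; omega)
        · rw [e4, partialDer_y_Dt_pow, partialDer_y_X4, one_smul, ← Expr.eval_QY, ← Expr.eval_add,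
            Expr.partialDer_Dt_pow_eval (Family.mem_tShift .pyt) rfl _ rfl, zero_mul]
  -- The same with `q_yt`, which survives in the y-derivative of `X4` only.
  have h4 : ∀ j, partialDer (.inr (.w4 j)) F = 0 := by
    intro j
    have h := vectorField_partialDer_y_Dx hx (partialDer_qy_eq_zero hx 0 (j + 1)) (hql _) hg
    rw [vectorField_eq_single (.inr (.w4 j)), e4, partialDer_y_Dt_pow, partialDer_y_X4,
      partialDer_qy_Dt_pow (Expr.avoids_eval rfl), if_pos (add_comm _ _), smul_one_mul,
      one_smul] at h
    · exact h
    · intro d hd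
      cases hd' : isNonlocal d
      · rw [swap _ _ (hql _ _ hd'), zero_mul]
      · rcases d with d | d <;> cases d
        any_goals cases hd'
        · rw [e1, partialDer_y_Dt_pow, partialDer_y_X1, map_zero, map_zero, zero_mul]
        · rw [e2, partialDer_y_Dt_pow, partialDer_y_X2, map_zero, map_zero, zero_mul]
        · rw [h3, mul_zero]
        · rw [e4, partialDer_y_Dt_pow, partialDer_y_X4,
            partialDer_qy_Dt_pow (Expr.avoids_eval rfl), if_neg, zero_mul]
          rintro h'
          exact hd (by congr 2; omega)
  -- Now the relation given by `p_y` itself is used. Besides `X1`, the functions `X3` and `X4` also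
  -- contain `p_y`, but their coefficients have already been shown to vanish.
  have h1 : ∀ j, partialDer (.inr (.w1 j)) F = 0 := by
    intro j
    have h := vectorField_partialDer_Dx hx (partialDer_py_eq_zero hx 0 j)
    rw [vectorField_eq_single (.inr (.w1 j)), e1, X1_eq,
      partialDer_py_Dt_pow (Expr.avoids_eval rfl), if_pos (zero_add _), one_smul, one_mul] at h
    · exact h
    · intro d hd
      cases hd' : isNonlocal d
      · rw [hpl _ _ hd', zero_mul]
      · rcases d with d | d <;> cases d
        any_goals cases hd'
        · rw [e1, X1_eq, partialDer_py_Dt_pow (Expr.avoids_eval rfl), if_neg, zero_mul]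
          rintro h'
          exact hd (by congr 2; omega)
        · rw [e2, ← Expr.eval_X2,
            Expr.partialDer_Dt_pow_eval (Family.mem_tShift .pyt) rfl _ rfl, zero_mul]
        · rw [h3, mul_zero]
        · rw [h4, mul_zero]
  -- With the other three gone, `q_y` in `X2` isolates the last coefficient.
  have h2 : ∀ j, partialDer (.inr (.w2 j)) F = 0 := by
    intro j
    have h := vectorField_partialDer_Dx hx (partialDer_qy_eq_zero hx 0 j)
    rw [vectorField_eq_single (.inr (.w2 j)), e2, X2_eq,
      partialDer_qy_Dt_pow (Expr.avoids_eval rfl), if_pos (zero_add _), one_smul, one_mul] at h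
    · exact h
    · intro d hd
      cases hd' : isNonlocal d
      · rw [hql _ _ hd', zero_mul]
      · rcases d with d | d <;> cases d
        any_goals cases hd'
        · rw [h1, mul_zero]
        · rw [e2, X2_eq, partialDer_qy_Dt_pow (Expr.avoids_eval rfl), if_neg, zero_mul]
          rintro h'
          exact hd (by congr 2; omega)
        · rw [h3, mul_zero]
        · rw [h4, mul_zero]
  rintro (c | c) hc
  · cases c <;> cases hc
  · cases c
    any_goals cases hc
    exacts [h1 _, h2 _, h3 _, h4 _]

/-- A function of positive degree in the odd variables annihilated by the total derivatives `D_x`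
and `D_y` vanishes. -/
theorem eq_zero_of_Dx_of_Dy {n : ℕ} {F : SuperFn} (hn : F ∈ homogeneous (n + 1)) (hx : Dx F = 0)
    (hy : Dy F = 0) : F = 0 := by
  induction n generalizing F with
  | zero => exact eq_zero_of_Dx_of_avoids_isNonlocal hn hx (avoids_isNonlocal_of_linear hn hx hy)
  | succ n ih =>
    refine eq_zero_of_Dx_of_avoids_isNonlocal hn hx ?_
    rintro (c | c) hc
    · cases c <;> cases hc
    -- Derivatives along nonlocal variables have lower degree and are still killed by `Dx` and `Dy`,
    -- so they vanish by induction and F is local.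
    · exact ih (partialDer_inr_mem_homogeneous hn c) (Dx_partialDer_of_isNonlocal hx hc)
        (Dy_partialDer_of_isNonlocal hy hc)

open Coord

/-! ### Uniqueness of lifts, and vanishing of brackets -/

theorem Ev_apply (φ : GenSection) (F : SuperFn) :
    Ev φ F = ∑ᶠ c, Ev φ (gen c) * partialDer c F := by
  obtain ⟨a, ha⟩ : ∃ a, Ev φ = vectorField a := ⟨_, rfl⟩
  simp only [ha, vectorField_gen]
  exact vectorField_apply a F

/-- The values of evolutionary fields on local functions do not depend on the components along
the nonlocal variables. -/
theorem Ev_eq_of_avoids {φ ψ : GenSection} (hu : φ.u = ψ.u) (hv : φ.v = ψ.v) (hp : φ.p = ψ.p)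
    (hq : φ.q = ψ.q) {F : SuperFn} (hF : Avoids isNonlocal F) : Ev φ F = Ev ψ F := by
  have hu' : ∀ k l, Ev φ (u k l) = Ev ψ (u k l) := by simp [hu]
  have huy : ∀ k l, Ev φ (uy k l) = Ev ψ (uy k l) := by simp [hu]
  have hv' : ∀ k l, Ev φ (v k l) = Ev ψ (v k l) := by simp [hv]
  have hvy : ∀ k l, Ev φ (vy k l) = Ev ψ (vy k l) := by simp [hv]
  have hp' : ∀ k l, Ev φ (p k l) = Ev ψ (p k l) := by simp [hp]
  have hpy : ∀ k l, Ev φ (py k l) = Ev ψ (py k l) := by simp [hp]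
  have hq' : ∀ k l, Ev φ (q k l) = Ev ψ (q k l) := by simp [hq]
  have hqy : ∀ k l, Ev φ (qy k l) = Ev ψ (qy k l) := by simp [hq]
  rw [Ev_apply φ, Ev_apply ψ]
  refine finsum_congr fun c => ?_
  cases hc : isNonlocal c
  · congr 1
    rcases c with (_ | _ | _ | _ | _ | _ | _) | (_ | _ | _ | _ | _ | _ | _ | _)
    any_goals cases hc
    exacts [(Ev_gen_x φ).trans (Ev_gen_x ψ).symm, (Ev_gen_y φ).trans (Ev_gen_y ψ).symm,
      (Ev_gen_t φ).trans (Ev_gen_t ψ).symm, hu' _ _, huy _ _, hv' _ _, hvy _ _, hp' _ _, hpy _ _,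
      hq' _ _, hqy _ _]
  · rw [hF c hc, mul_zero, mul_zero]

theorem Ev_zero : Ev 0 = 0 := by
  refine LinearMap.ext fun F => ?_
  have h : ∀ c, Ev 0 (gen c) = 0 := by
    have hu : (0 : GenSection).u = 0 := rfl
    have hv : (0 : GenSection).v = 0 := rfl
    have hp : (0 : GenSection).p = 0 := rfl
    have hq : (0 : GenSection).q = 0 := rfl
    have h1 : (0 : GenSection).w1 = 0 := rfl
    have h2 : (0 : GenSection).w2 = 0 := rfl
    have h3 : (0 : GenSection).w3 = 0 := rfl
    have h4 : (0 : GenSection).w4 = 0 := rfl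
    refine forall_gen (P := fun F => Ev 0 F = 0) ?_ ?_ ?_ ?_ ?_ ?_ ?_ ?_ ?_ ?_ ?_ ?_ ?_ ?_ ?_ <;>
      simp [hu, hv, hp, hq, h1, h2, h3, h4]
  rw [Ev_apply]
  exact finsum_eq_zero_of_forall_eq_zero fun c => by rw [h, zero_mul]

theorem avoids_isNonlocal_X1 : Avoids isNonlocal X1 := Expr.eval_X1 ▸ Expr.avoids_eval rfl
theorem avoids_isNonlocal_X2 : Avoids isNonlocal X2 := Expr.eval_X2 ▸ Expr.avoids_eval rfl
theorem avoids_isNonlocal_X3 : Avoids isNonlocal X3 := Expr.eval_X3 ▸ Expr.avoids_eval rfl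
theorem avoids_isNonlocal_X4 : Avoids isNonlocal X4 := Expr.eval_X4 ▸ Expr.avoids_eval rfl
theorem avoids_isNonlocal_Y1 : Avoids isNonlocal Y1 := Expr.eval_Y1 ▸ Expr.avoids_eval rfl
theorem avoids_isNonlocal_Y2 : Avoids isNonlocal Y2 := Expr.eval_Y2 ▸ Expr.avoids_eval rfl
theorem avoids_isNonlocal_Y3 : Avoids isNonlocal Y3 := Expr.eval_Y3 ▸ Expr.avoids_eval rfl
theorem avoids_isNonlocal_Y4 : Avoids isNonlocal Y4 := Expr.eval_Y4 ▸ Expr.avoids_eval rfl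

theorem map_eq_of_comm {A B D : Module.End ℝ SuperFn} (hA : A * D = D * A) (hB : B * D = D * B)
    {F : SuperFn} (h : A (D F) = B (D F)) : D (A F - B F) = 0 := by
  have hA' := LinearMap.congr_fun hA F
  have hB' := LinearMap.congr_fun hB F
  simp only [Module.End.mul_apply] at hA' hB'
  rw [map_sub, ← hA', ← hB', h, sub_self]

/-- The components along `u`, `v`, `p`, `q` determine an odd symmetry. -/
theorem IsOddNonlocalSymmetry.eq_of_eq {φ ψ : GenSection} (hφ : IsOddNonlocalSymmetry φ)
    (hψ : IsOddNonlocalSymmetry ψ) (hu : φ.u = ψ.u) (hv : φ.v = ψ.v) (hp : φ.p = ψ.p)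
    (hq : φ.q = ψ.q) : φ = ψ := by
  -- The fields agree on the local functions `Dx c` and `Dy c`. Hence the difference of their values
  -- on c is killed by both total derivatives, and rigidity in degree 2 applies.
  have key : ∀ {c : SuperFn}, Avoids isNonlocal (Dx c) → Avoids isNonlocal (Dy c) →
      Ev φ c ∈ homogeneous 2 → Ev ψ c ∈ homogeneous 2 → Ev φ c = Ev ψ c := by
    intro c hx hy h1 h2
    exact sub_eq_zero.1 (eq_zero_of_Dx_of_Dy (sub_mem h1 h2)
      (map_eq_of_comm hφ.comm_x hψ.comm_x (Ev_eq_of_avoids hu hv hp hq hx))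
      (map_eq_of_comm hφ.comm_y hψ.comm_y (Ev_eq_of_avoids hu hv hp hq hy)))
  have k1 := key (c := w1 0) (Dx_w1 0 ▸ avoids_isNonlocal_X1) (Dy_w1 0 ▸ avoids_isNonlocal_Y1)
    (Ev_w1 φ 0 ▸ hφ.deg_w1) (Ev_w1 ψ 0 ▸ hψ.deg_w1)
  have k2 := key (c := w2 0) (Dx_w2 0 ▸ avoids_isNonlocal_X2) (Dy_w2 0 ▸ avoids_isNonlocal_Y2)
    (Ev_w2 φ 0 ▸ hφ.deg_w2) (Ev_w2 ψ 0 ▸ hψ.deg_w2)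
  have k3 := key (c := w3 0) (Dx_w3 0 ▸ avoids_isNonlocal_X3) (Dy_w3 0 ▸ avoids_isNonlocal_Y3)
    (Ev_w3 φ 0 ▸ hφ.deg_w3) (Ev_w3 ψ 0 ▸ hψ.deg_w3)
  have k4 := key (c := w4 0) (Dx_w4 0 ▸ avoids_isNonlocal_X4) (Dy_w4 0 ▸ avoids_isNonlocal_Y4)
    (Ev_w4 φ 0 ▸ hφ.deg_w4) (Ev_w4 ψ 0 ▸ hψ.deg_w4)
  rw [Ev_w1, Ev_w1] at k1
  rw [Ev_w2, Ev_w2] at k2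
  rw [Ev_w3, Ev_w3] at k3
  rw [Ev_w4, Ev_w4] at k4
  exact GenSection.ext hu hv hp hq k1 k2 k3 k4

theorem IsLift.eq {Φ : Shadow} {φ ψ : GenSection} (hφ : IsLift Φ φ) (hψ : IsLift Φ ψ) : φ = ψ :=
  hφ.symm.eq_of_eq hψ.symm (hφ.restrict_u.trans hψ.restrict_u.symm)
    (hφ.restrict_v.trans hψ.restrict_v.symm) (hφ.tangent_p.trans hψ.tangent_p.symm)
    (hφ.tangent_q.trans hψ.tangent_q.symm)

/-- The bracket of odd symmetries vanishes if its components along `u`, `v`, `p`, `q` do. -/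
theorem IsOddNonlocalSymmetry.fnBracket_eq_zero {φ ψ : GenSection} (hφ : IsOddNonlocalSymmetry φ)
    (hψ : IsOddNonlocalSymmetry ψ) (hu : superCommutator φ ψ (u 0 0) = 0)
    (hv : superCommutator φ ψ (v 0 0) = 0) (hp : superCommutator φ ψ (p 0 0) = 0)
    (hq : superCommutator φ ψ (q 0 0) = 0) : fnBracket φ ψ = 0 := by
  obtain ⟨hSx, hSy, -⟩ := superCommutator_comm hφ hψ
  -- The supercommutator is evolutionary, and on local functions it acts like the evolutionary field
  -- of the zero section.
  have hS : ∀ {F}, Avoids isNonlocal F → superCommutator φ ψ F = 0 := by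
    intro F hF
    rw [superCommutator_eq_Ev hφ hψ, Ev_eq_of_avoids (ψ := 0) hu hv hp hq hF, Ev_zero]
    rfl
  have key : ∀ c : OddCoord, Avoids isNonlocal (Dx (oddGen c)) →
      Avoids isNonlocal (Dy (oddGen c)) → superCommutator φ ψ (oddGen c) = 0 := by
    intro c hx hy
    -- Two odd fields raise the degree 1 of a nonlocal variable to 3, so rigidity is applied with n
    -- + 1 = 3.
    refine eq_zero_of_Dx_of_Dy (n := 2) ?_ ?_ ?_
    · rw [superCommutator_apply]
      exact add_mem
        (hφ.hasDegrees.Ev_mem_homogeneous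
          (hψ.hasDegrees.Ev_mem_homogeneous (oddGen_mem_homogeneous c)))
        (hψ.hasDegrees.Ev_mem_homogeneous
          (hφ.hasDegrees.Ev_mem_homogeneous (oddGen_mem_homogeneous c)))
    · exact (LinearMap.congr_fun hSx _).symm.trans (hS hx)
    · exact (LinearMap.congr_fun hSy _).symm.trans (hS hy)
  exact GenSection.ext hu hv hp hq
    (key (.w1 0) (Dx_w1 0 ▸ avoids_isNonlocal_X1) (Dy_w1 0 ▸ avoids_isNonlocal_Y1))
    (key (.w2 0) (Dx_w2 0 ▸ avoids_isNonlocal_X2) (Dy_w2 0 ▸ avoids_isNonlocal_Y2))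
    (key (.w3 0) (Dx_w3 0 ▸ avoids_isNonlocal_X3) (Dy_w3 0 ▸ avoids_isNonlocal_Y3))
    (key (.w4 0) (Dx_w4 0 ▸ avoids_isNonlocal_X4) (Dy_w4 0 ▸ avoids_isNonlocal_Y4))

/-! ### The Cartan differential on expressions -/

theorem Dx_pow_Dt_pow_p (k l : ℕ) : (Dx ^ k) ((Dt ^ l) (p 0 0)) = p k l := by
  have h : (Dt ^ l) (p 0 0) = p 0 l := by
    induction l with
    | zero => rfl
    | succ l ih => rw [← Dt_Dt_pow, ih, Dt_p]
  rw [h]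
  induction k with
  | zero => rfl
  | succ k ih => rw [← Dx_Dx_pow, ih, Dx_p]

theorem Dx_pow_Dt_pow_q (k l : ℕ) : (Dx ^ k) ((Dt ^ l) (q 0 0)) = q k l := by
  have h : (Dt ^ l) (q 0 0) = q 0 l := by
    induction l with
    | zero => rfl
    | succ l ih => rw [← Dt_Dt_pow, ih, Dt_q]
  rw [h]
  induction k with
  | zero => rfl
  | succ k ih => rw [← Dx_Dx_pow, ih, Dx_q]

/-- Seeing the Cartan differential as an evolutionary field lets `eval_ev` compute it, so the lift
conditions become normal-form checks. -/
theorem dC_eq_Ev : dC = Ev Expr.cartan.eval := by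
  have hu : Expr.cartan.eval.u = p 0 0 := rfl
  have hv : Expr.cartan.eval.v = q 0 0 := rfl
  have hp : Expr.cartan.eval.p = 0 := Expr.eval_zero
  have hq : Expr.cartan.eval.q = 0 := Expr.eval_zero
  have h1 : Expr.cartan.eval.w1 = 0 := Expr.eval_zero
  have h2 : Expr.cartan.eval.w2 = 0 := Expr.eval_zero
  have h3 : Expr.cartan.eval.w3 = y * p 1 0 * p 0 1 + p 0 0 * py 0 0 := rfl
  have h4 : Expr.cartan.eval.w4 =
      y * (p 1 0 * q 0 1 - p 0 1 * q 1 0) + p 0 0 * qy 0 0 - py 0 0 * q 0 0 := by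
    change Expr.eval (Expr.Y * (Expr.P 1 0 * Expr.Q 0 1 - Expr.P 0 1 * Expr.Q 1 0)
      + Expr.P 0 0 * Expr.QY 0 0 - Expr.PY 0 0 * Expr.Q 0 0) = _
    simp only [Expr.eval_sub, Expr.eval_add, Expr.eval_mul, Expr.eval_Y, Expr.eval_P,
      Expr.eval_PY, Expr.eval_Q, Expr.eval_QY]
  unfold dC Ev
  congr 1
  funext c
  rcases c with (_ | _ | _ | _ | _ | _ | _) | (_ | _ | _ | _ | _ | _ | _ | _)
  · rfl
  · rfl
  · rfl
  · simp only [hu, Dx_pow_Dt_pow_p]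
  · simp only [hu, Dx_pow_Dt_pow_p, Dy_p]
  · simp only [hv, Dx_pow_Dt_pow_q]
  · simp only [hv, Dx_pow_Dt_pow_q, Dy_q]
  · simp only [hp, map_zero]
  · simp only [hp, map_zero]
  · simp only [hq, map_zero]
  · simp only [hq, map_zero]
  · simp only [h1, map_zero]
  · simp only [h2, map_zero]
  · simp only [h3]
  · simp only [h4]

namespace Expr

theorem eval_ev_cartan (a : Expr) : (ev cartan a).eval = dC a.eval := by
  rw [dC_eq_Ev]
  exact eval_ev (Section.hasDegrees (by decide +kernel)) a

/-! ### The two lifts -/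

theorem lift1_hasDegrees : lift1.eval.HasDegrees := Section.hasDegrees (by decide +kernel)

theorem lift2_hasDegrees : lift2.eval.HasDegrees := Section.hasDegrees (by decide +kernel)

theorem isOddNonlocalSymmetry_lift1 : IsOddNonlocalSymmetry lift1.eval :=
  Section.isOddNonlocalSymmetry lift1_hasDegrees (by decide +kernel)

theorem isOddNonlocalSymmetry_lift2 : IsOddNonlocalSymmetry lift2.eval :=
  Section.isOddNonlocalSymmetry lift2_hasDegrees (by decide +kernel)

theorem lift1_u : lift1.u.eval = Phi1.u := by
  simp [lift1, Phi1, eval_U, eval_P, eval_W1]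

theorem lift1_v : lift1.v.eval = Phi1.v := by
  simp [lift1, Phi1, eval_U, eval_V, eval_P, eval_Q, eval_W2]

theorem lift2_u : lift2.u.eval = Phi2.u := by
  -- An expression with the factors in the order of the shadow; it differs from the component of
  -- `lift2` by commuting even factors, which the normal form settles.
  have h : Phi2.u = (UY 0 0 * P 0 0 - 2 * Y * U 1 0 * P 0 1 - U 1 0 * W1 0 + Y * W1 1
      + 2 * W3 0).eval := by
    simp [Phi2, eval_U, eval_UY, eval_P, eval_Y, eval_W1, eval_W3]
  rw [h]
  exact eval_congr (by decide +kernel)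

theorem lift2_v : lift2.v.eval = Phi2.v := by
  have h : Phi2.v = (-2 * VY 0 0 * P 0 0 + Y * V 1 0 * P 0 1
      + (3 * (U 1 0 * U 1 0) + UY 0 0) * Q 0 0 + Y * U 1 0 * Q 0 1 - V 1 0 * W1 0
      + 2 * U 1 0 * W2 0 + Y * W2 1 - W4 0).eval := by
    simp [Phi2, eval_U, eval_UY, eval_V, eval_VY, eval_P, eval_Q, eval_Y, eval_W1, eval_W2,
      eval_W4, pow_two]
  rw [h]
  exact eval_congr (by decide +kernel)

theorem isLift_of_isZero {Φ : Shadow} {s : Section} (h : IsOddNonlocalSymmetry s.eval)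
    (hu : s.u.eval = Φ.u) (hv : s.v.eval = Φ.v) (hp : isZero (s.p - -(ev cartan s.u)) = true)
    (hq : isZero (s.q - -(ev cartan s.v)) = true) : IsLift Φ s.eval where
  symm := h
  restrict_u := hu
  restrict_v := hv
  tangent_p := by rw [← hu, ← eval_ev_cartan]; exact eval_congr hp
  tangent_q := by rw [← hv, ← eval_ev_cartan]; exact eval_congr hq

theorem isLift_lift1 : IsLift Phi1 lift1.eval :=
  isLift_of_isZero isOddNonlocalSymmetry_lift1 lift1_u lift1_v (by decide +kernel)
    (by decide +kernel)

theorem isLift_lift2 : IsLift Phi2 lift2.eval :=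
  isLift_of_isZero isOddNonlocalSymmetry_lift2 lift2_u lift2_v (by decide +kernel)
    (by decide +kernel)

/-! ### The shadows -/

theorem isShadow_of_isZero {Φ : Shadow} {a b : Expr} (ha : a.eval = Φ.u) (hb : b.eval = Φ.v)
    (hda : hasDegree 1 a = true) (hdb : hasDegree 1 b = true)
    (hu : isZero (dy (dy a) - (dx (dt a) + U 2 0 * dy a + UY 0 0 * dx (dx a) - U 1 0 * dx (dy a)
      - UY 1 0 * dx a)) = true)
    (hv : isZero (dy (dy b) - (2 * V 1 0 * dx (dy a) - VY 1 0 * dx a + V 2 0 * dy a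
      - 2 * VY 0 0 * dx (dx a) + dx (dt b) + 2 * UY 1 0 * dx b - 2 * U 2 0 * dy b
      + UY 0 0 * dx (dx b) - U 1 0 * dx (dy b))) = true) : IsShadow Φ where
  linear_u := ha ▸ eval_mem_homogeneous hda
  linear_v := hb ▸ eval_mem_homogeneous hdb
  eq_u := by
    have h := eval_congr hu
    simpa only [eval_add, eval_sub, eval_mul, eval_dx, eval_dy, eval_dt, eval_U, eval_UY, ha]
      using h
  eq_v := by
    have h := eval_congr hv
    simpa only [eval_add, eval_sub, eval_mul, eval_dx, eval_dy, eval_dt, eval_U, eval_UY, eval_V,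
      eval_VY, eval_two, ha, hb] using h

theorem isShadow_Phi1 : IsShadow Phi1 :=
  isShadow_of_isZero lift1_u lift1_v (by decide +kernel) (by decide +kernel) (by decide +kernel)
    (by decide +kernel)

theorem isShadow_Phi2 : IsShadow Phi2 :=
  isShadow_of_isZero lift2_u lift2_v (by decide +kernel) (by decide +kernel) (by decide +kernel)
    (by decide +kernel)

/-! ### The brackets -/

theorem superCommutator_eq_zero {s r : Section} (hs : s.eval.HasDegrees) (hr : r.eval.HasDegrees)
    {F : SuperFn} {a b : Expr} (ha : Ev s.eval F = a.eval) (hb : Ev r.eval F = b.eval)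
    (h : isZero (ev s b + ev r a) = true) : superCommutator s.eval r.eval F = 0 := by
  rw [superCommutator_apply, ha, hb, ← eval_ev hs, ← eval_ev hr, ← eval_add]
  exact eval_eq_zero h

theorem fnBracket_eq_zero {s r : Section} (hs : IsOddNonlocalSymmetry s.eval)
    (hr : IsOddNonlocalSymmetry r.eval) (hu : isZero (ev s r.u + ev r s.u) = true)
    (hv : isZero (ev s r.v + ev r s.v) = true) (hp : isZero (ev s r.p + ev r s.p) = true)
    (hq : isZero (ev s r.q + ev r s.q) = true) : fnBracket s.eval r.eval = 0 :=
  hs.fnBracket_eq_zero hr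
    (superCommutator_eq_zero hs.hasDegrees hr.hasDegrees (Ev_u s.eval 0 0) (Ev_u r.eval 0 0) hu)
    (superCommutator_eq_zero hs.hasDegrees hr.hasDegrees (Ev_v s.eval 0 0) (Ev_v r.eval 0 0) hv)
    (superCommutator_eq_zero hs.hasDegrees hr.hasDegrees (Ev_p s.eval 0 0) (Ev_p r.eval 0 0) hp)
    (superCommutator_eq_zero hs.hasDegrees hr.hasDegrees (Ev_q s.eval 0 0) (Ev_q r.eval 0 0) hq)

theorem fnBracket_lift1_lift1 : fnBracket lift1.eval lift1.eval = 0 :=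
  fnBracket_eq_zero isOddNonlocalSymmetry_lift1 isOddNonlocalSymmetry_lift1 (by decide +kernel)
    (by decide +kernel) (by decide +kernel) (by decide +kernel)

theorem fnBracket_lift2_lift2 : fnBracket lift2.eval lift2.eval = 0 :=
  fnBracket_eq_zero isOddNonlocalSymmetry_lift2 isOddNonlocalSymmetry_lift2 (by decide +kernel)
    (by decide +kernel) (by decide +kernel) (by decide +kernel)

theorem fnBracket_lift1_lift2 : fnBracket lift1.eval lift2.eval = 0 :=
  fnBracket_eq_zero isOddNonlocalSymmetry_lift1 isOddNonlocalSymmetry_lift2 (by decide +kernel)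
    (by decide +kernel) (by decide +kernel) (by decide +kernel)

end Expr

/-! ### From the explicit lifts to all lifts. -/

theorem isHereditary_of_isLift {Φ : Shadow} {φ : GenSection} (hφ : IsLift Φ φ)
    (h : fnBracket φ φ = 0) : IsHereditary Φ :=
  ⟨⟨φ, hφ⟩, fun _ hφ' => hφ'.eq hφ ▸ h⟩

/-- By uniqueness every lift of a shadow is the given one, so one vanishing bracket settles the
statement for all lifts. -/
theorem areCompatible_of_isLift {Φ Ψ : Shadow} {φ ψ : GenSection} (hφ : IsLift Φ φ)
    (hψ : IsLift Ψ ψ) (h : fnBracket φ ψ = 0) : AreCompatible Φ Ψ :=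
  ⟨⟨φ, hφ⟩, ⟨ψ, hψ⟩, fun _ _ hφ' hψ' => hφ'.eq hφ ▸ hψ'.eq hψ ▸ h⟩

end PavlovMikhalev

end

theorem mainTheorem2 :
    PavlovMikhalev.IsShadow PavlovMikhalev.Phi1 ∧
    PavlovMikhalev.IsShadow PavlovMikhalev.Phi2 ∧
    PavlovMikhalev.IsHereditary PavlovMikhalev.Phi1 ∧
    PavlovMikhalev.IsHereditary PavlovMikhalev.Phi2 ∧
    PavlovMikhalev.AreCompatible PavlovMikhalev.Phi1 PavlovMikhalev.Phi2 ∧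
    (∀ φ ψ : PavlovMikhalev.GenSection,
      PavlovMikhalev.IsOddNonlocalSymmetry φ → PavlovMikhalev.IsOddNonlocalSymmetry ψ →
        PavlovMikhalev.superCommutator φ ψ =
          PavlovMikhalev.Ev (PavlovMikhalev.fnBracket φ ψ)) := by
  open PavlovMikhalev Expr in
  exact ⟨isShadow_Phi1, isShadow_Phi2,
    isHereditary_of_isLift isLift_lift1 fnBracket_lift1_lift1,
    isHereditary_of_isLift isLift_lift2 fnBracket_lift2_lift2,
    areCompatible_of_isLift isLift_lift1 isLift_lift2 fnBracket_lift1_lift2,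
    fun _ _ => IsOddNonlocalSymmetry.superCommutator_eq_Ev⟩
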